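/- **Setting.** A finite semi-Markov decision process (SMDP) $M$ has a finite state set $\mathcal S$, a finite action set $\mathcal A$, non-empty sets $\mathcal A_s\subseteq\mathcal A$ of actions available in $s$, transition probabilities $p(s'\mid s,a)$, and for each $(s,a,s')$ a joint law of a reward $r(s,a,s')$ and a holding time $\tau(s,a,s')>0$. Put $\overline r(s,a)=\sum_{s'}p(s'\mid s,a)\,\mathbb E[r(s,a,s')]$ and $\overline\tau(s,a)=\sum_{s'}p(s'\mid s,a)\,\mathbb E[\tau(s,a,s')]$. A learning algorithm (equivalently, a history-dependent randomized policy) knows the state space and the available actions, and chooses the $i$-th action $a_i\in\mathcal A_{s_{i-1}}$, possibly at random, from the history $s_0,a_1,r_1,\tau_1,s_1,\dots,a_{i-1},r_{i-1},\tau_{i-1},s_{i-1}$. Then the next state $s_i$ is drawn from $p(\cdot\mid s_{i-1},a_i)$, and the reward and holding time $(r_i,\tau_i)$ from the law attached to $(s_{i-1},a_i,s_i)$. The diameter is $D(M)=\max_{s,s'}\min_\pi\mathbb E^\pi[T(s')\mid s_0=s]$, where $T(s')=\inf\{\sum_{i=1}^n\tau_i: n\in\mathbb N,\ s_n=s'\}$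 and $\pi$ ranges over stationary deterministic policies. With $N(t)=\sup\{n:\sum_{i\le n}\tau_i\le t\}$, the optimal average reward $\rho^*(M)$ is the number such that some stationary deterministic policy $\pi^*$ satisfies $\lim_{t\to\infty}\mathbb E^{\pi^*}\big[\tfrac1t\sum_{i\le N(t)}r_i\mid s_0=s\big]=\rho^*(M)$ for every $s$, and $\limsup_{t\to\infty}\mathbb E^{\pi}\big[\tfrac1t\sum_{i\le N(t)}r_i\mid s_0=s\big]\le\rho^*(M)$ for every history-dependent randomized policy $\pi$ and every $s$. The regret of an algorithm $\mathfrak A$ started in $s_0=s$ after $n$ decision steps is $\Delta(M,\mathfrak A,s,n)=\big(\sum_{i=1}^n\tau_i\big)\rho^*(M)-\sum_{i=1}^n r_i$. **Theorem.** There is a universal constant $c>0$ such that the following holds. Let $S,A\ge 10$ be integers, let $T_{\max}\ge 3T_{\min}\ge 3$, $R_{\max}>0$ and $D>\max\{20\,T_{\min}\log_A S,\ 12\,T_{\min}\}$ be reals, and let $n\ge\max\{D,T_{\max}\}\,SA$ be an integer. Then for every learning algorithm $\mathfrak A$ there is an SMDP $M$ with at most $S$ states, with available actions taken from a set of $A$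 actions, with diameter $D(M)=D$, with holding times in $[T_{\min},T_{\max}]$ and rewards in $[0,\tfrac12R_{\max}T_{\max}]$, with $\overline r(s,a)\le R_{\max}\overline\tau(s,a)$ for all states $s$ and all $a\in\mathcal A_s$, and whose optimal average reward $\rho^*(M)$ exists, such that for every initial state $s$ $$\mathbb E\big[\Delta(M,\mathfrak A,s,n)\big]\ \ge\ c\,\big(\sqrt D+\sqrt{T_{\max}}\big)\,R_{\max}\sqrt{SAn}.$$ -/

import Mathlib

open MeasureTheory ProbabilityTheory Filter
open scoped ENNReal BigOperators

noncomputable section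

/-- The sets of available actions: in each of the `m` states a non-empty set of actions, taken from
`k` actions in all. -/
structure ActionSets (m k : ℕ) where
  /-- the actions that can be taken in a state -/
  acts : Fin m → Finset (Fin k)
  nonempty : ∀ s, (acts s).Nonempty

/-- What is observed in one decision step: the action taken, the reward received, the holding time,
and the state reached. -/
abbrev Obs (m k : ℕ) : Type := Fin k × ℝ × ℝ × Fin m

namespace Obs

variable {m k : ℕ}

/-- the action of a decision step -/
def action (x : Obs m k) : Fin k := x.1

/-- the reward of a decision step -/
def reward (x : Obs m k) : ℝ := x.2.1

/-- the holding time of a decision step -/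
def time (x : Obs m k) : ℝ := x.2.2.1

/-- the state reached by a decision step -/
def state (x : Obs m k) : Fin m := x.2.2.2

theorem measurable_state : Measurable (state : Obs m k → Fin m) := by
  unfold state; fun_prop

end Obs

/-- A history `s₀, (a₁, r₁, τ₁, s₁), …, (aₙ, rₙ, τₙ, sₙ)`. The entry of index `0` only serves to
store the initial state `s₀`; its other components carry no information. -/
abbrev History (m k n : ℕ) : Type := (i : Finset.Iic n) → Obs m k

/-- the last state of a history -/
def History.last {m k n : ℕ} (h : History m k n) : Fin m :=
  (h ⟨n, Finset.mem_Iic.2 le_rfl⟩).state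

theorem History.measurable_last {m k n : ℕ} :
    Measurable (History.last : History m k n → Fin m) :=
  Obs.measurable_state.comp (measurable_pi_apply _)

/-- A history-dependent randomized policy. As a learner that knows the state space and the available
actions and observes the history, a learning algorithm is the same thing. -/
structure Policy {m k : ℕ} (𝒜 : ActionSets m k) where
  /-- the conditional law of the action `a_{n+1}`, given the history up to `s_n` -/
  choice : (n : ℕ) → Kernel (History m k n) (Fin k)
  markov : ∀ n, IsMarkovKernel (choice n)
  available : ∀ n h, choice n h {a | a ∉ 𝒜.acts h.last} = 0

/-- A stationary deterministic policy: in each state one of the available actions. -/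
def StationaryPolicy {m k : ℕ} (𝒜 : ActionSets m k) : Type :=
  {d : Fin m → Fin k // ∀ s, d s ∈ 𝒜.acts s}

/-- A stationary deterministic policy, seen as a policy. -/
def StationaryPolicy.toPolicy {m k : ℕ} {𝒜 : ActionSets m k} (d : StationaryPolicy 𝒜) :
    Policy 𝒜 where
  choice n := Kernel.deterministic (fun h : History m k n => d.1 h.last)
    ((Measurable.of_discrete (f := d.1)).comp History.measurable_last)
  markov n := inferInstance
  available n h := by
    rw [Kernel.deterministic_apply, Measure.dirac_apply' _ MeasurableSet.of_discrete]
    simp [d.2 h.last]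

/-- A finite semi-Markov decision process with `m` states and the available actions `𝒜`. -/
structure SMDP {m k : ℕ} (𝒜 : ActionSets m k) where
  /-- `p s a` is the law of the next state when action `a` is taken in state `s` -/
  p : Fin m → Fin k → PMF (Fin m)
  /-- `law s a s'` is the joint law of the pair (reward, holding time) of a transition from `s` to
  `s'` under action `a` -/
  law : Fin m → Fin k → Fin m → Measure (ℝ × ℝ)
  isProb : ∀ s a s', IsProbabilityMeasure (law s a s')
  holding_pos : ∀ s a s', ∀ᵐ x ∂(law s a s'), 0 < x.2

namespace SMDP

variable {m k : ℕ} {𝒜 : ActionSets m k}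

/-- The expected reward of action `a` in state `s`. -/
def meanReward (M : SMDP 𝒜) (s : Fin m) (a : Fin k) : ℝ :=
  ∑ s', (M.p s a s').toReal * ∫ x, x.1 ∂(M.law s a s')

/-- The expected holding time of action `a` in state `s`. -/
def meanHolding (M : SMDP 𝒜) (s : Fin m) (a : Fin k) : ℝ :=
  ∑ s', (M.p s a s').toReal * ∫ x, x.2 ∂(M.law s a s')

/-- The law of (reward, holding time, next state) when action `a` is taken in state `s`. -/
def stepLaw (M : SMDP 𝒜) (s : Fin m) (a : Fin k) : Measure (ℝ × ℝ × Fin m) :=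
  ∑ s', M.p s a s' • (M.law s a s').map (fun x => (x.1, x.2, s'))

theorem isProbabilityMeasure_stepLaw (M : SMDP 𝒜) (s : Fin m) (a : Fin k) :
    IsProbabilityMeasure (M.stepLaw s a) := by
  constructor
  have h : ∀ s', ((M.law s a s').map (fun x : ℝ × ℝ => (x.1, x.2, s'))) Set.univ = 1 := by
    intro s'
    have := M.isProb s a s'
    rw [Measure.map_apply (by fun_prop) MeasurableSet.univ]
    simp
  have h1 := (M.p s a).tsum_coe
  rw [tsum_fintype] at h1
  simp [stepLaw, Measure.finsetSum_apply, h, h1]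

/-- `stepLaw` as a Markov kernel. -/
def stepKernel (M : SMDP 𝒜) : Kernel (Fin m × Fin k) (ℝ × ℝ × Fin m) :=
  Kernel.ofFunOfCountable fun x => M.stepLaw x.1 x.2

instance (M : SMDP 𝒜) : IsMarkovKernel M.stepKernel :=
  ⟨fun x => M.isProbabilityMeasure_stepLaw x.1 x.2⟩

/-- The conditional law of the decision step `n + 1`, given the history up to step `n`: the action is
drawn by the policy, and the reward, the holding time and the next state by the process. -/
def nextKernel (M : SMDP 𝒜) (π : Policy 𝒜) (n : ℕ) : Kernel (History m k n) (Obs m k) :=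
  π.choice n ⊗ₖ M.stepKernel.comap (fun x : History m k n × Fin k => (x.1.last, x.2))
    ((History.measurable_last.comp measurable_fst).prodMk measurable_snd)

instance (M : SMDP 𝒜) (π : Policy 𝒜) (n : ℕ) : IsMarkovKernel (M.nextKernel π n) := by
  have := π.markov n
  unfold nextKernel
  infer_instance

/-- The law of the trajectory `(s₀, (aᵢ, rᵢ, τᵢ, sᵢ)_{i ≥ 1})` under the policy `π`, started at
`s₀ = s`. -/
def trajLaw (M : SMDP 𝒜) (π : Policy 𝒜) (s : Fin m) : Measure (ℕ → Obs m k) :=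
  Kernel.traj (X := fun _ => Obs m k) (M.nextKernel π) 0
    (fun _ => ((𝒜.nonempty s).choose, 0, 0, s))

/-- `N(t) = sup {n : τ₁ + ⋯ + τₙ ≤ t}`, the number of decision steps completed by time `t`. -/
def numSteps (ω : ℕ → Obs m k) (t : ℝ) : ℕ :=
  sSup {n : ℕ | ∑ i ∈ Finset.Icc 1 n, (ω i).time ≤ t}

/-- `E[(r₁ + ⋯ + r_{N(t)}) / t]` under the policy `π` from the initial state `s`. -/
def rewardRate (M : SMDP 𝒜) (π : Policy 𝒜) (s : Fin m) (t : ℝ) : ℝ :=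
  ∫ ω, (∑ i ∈ Finset.Icc 1 (numSteps ω t), (ω i).reward) / t ∂(M.trajLaw π s)

/-- The upper average reward of a policy. -/
def upperGain (M : SMDP 𝒜) (π : Policy 𝒜) (s : Fin m) : EReal :=
  limsup (fun t : ℝ => ((M.rewardRate π s t : ℝ) : EReal)) atTop

/-- The lower average reward of a policy. -/
def lowerGain (M : SMDP 𝒜) (π : Policy 𝒜) (s : Fin m) : EReal :=
  liminf (fun t : ℝ => ((M.rewardRate π s t : ℝ) : EReal)) atTop

/-- `ρ` is the optimal average reward `ρ*(M)`: it is the average reward, from every initial state, of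
a stationary deterministic policy, and no policy has a larger upper average reward from any initial
state. -/
def IsOptimalGain (M : SMDP 𝒜) (ρ : ℝ) : Prop :=
  (∃ d : StationaryPolicy 𝒜, ∀ s,
    M.lowerGain d.toPolicy s = (ρ : EReal) ∧ M.upperGain d.toPolicy s = (ρ : EReal)) ∧
  ∀ (π : Policy 𝒜) (s : Fin m), M.upperGain π s ≤ (ρ : EReal)

/-- `T(s') = inf {τ₁ + ⋯ + τₙ : n ∈ ℕ, sₙ = s'}`, the time at which `s'` is first encountered
(`∞` if it never is). -/
def hittingTime (s' : Fin m) (ω : ℕ → Obs m k) : ℝ≥0∞ :=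
  ⨅ (n : ℕ) (_ : (ω n).state = s'), ∑ i ∈ Finset.Icc 1 n, ENNReal.ofReal (ω i).time

/-- The diameter: the largest, over pairs of states, of the smallest expected time (over the finitely
many stationary deterministic policies) needed to get from the one to the other. -/
def diameter (M : SMDP 𝒜) : ℝ≥0∞ :=
  ⨆ (s : Fin m) (s' : Fin m), ⨅ d : StationaryPolicy 𝒜,
    ∫⁻ ω, hittingTime s' ω ∂(M.trajLaw d.toPolicy s)

/-- The regret after `n` decision steps along a trajectory, where `ρ` is the optimal average
reward. -/
def regret (ρ : ℝ) (n : ℕ) (ω : ℕ → Obs m k) : ℝ :=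
  (∑ i ∈ Finset.Icc 1 n, (ω i).time) * ρ - ∑ i ∈ Finset.Icc 1 n, (ω i).reward

/-- The expected regret after `n` decision steps of the algorithm `π`, started in state `s`. -/
def expectedRegret (M : SMDP 𝒜) (ρ : ℝ) (π : Policy 𝒜) (s : Fin m) (n : ℕ) : ℝ :=
  ∫ ω, regret ρ n ω ∂(M.trajLaw π s)

end SMDP

end

/-! Every step of the hard processes lasts exactly `Tmin`; `Tmax` matters only because it permits
rewards of order `Rmax * Tmax`. There are `N` contexts, a state `good` and a state `far`. In each
context about half of the `A` actions are arms. An arm succeeds with probability `δ`, the hidden arm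
of the context with probability `δ + ε`. A success pays `R₁` and leads to `good`, which is left with
probability `η` per step; a failure leads to a uniformly random context. The remaining actions
navigate between contexts, except for the exit, which leads to `good` and to `far` with probability
`q` each. As `far` is entered only through the exit, the diameter is `T * (1 / q + 2 / η)`, and `q`
is tuned to make it exactly `D` (`diameter_eq`).

Rewards in `good` and `far` are chosen such that the optimality equation has gain `(δ + ε) * (R₁ +
H)` per step and a bias equal to `H` in `good` and `0` elsewhere. An action in a context other than
the hidden arm loses at least `ε * (R₁ + H)`. Hence the regret is at least this loss times the
expected number of wrong actions, minus `H` (`le_expectedRegret_mdp`). If `ε² ≈ δ * N * K / n`, the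
hidden arms cannot be identified from `n` steps, order `n` actions are wrong, and the regret is of
order `(R₁ + H) * √(S * A * δ * n)`. With `R₁ ≈ Rmax * Tmax`, `δ ≈ Tmin / Tmax`, `H = 0` this gives
the term `√Tmax`; with `R₁ = 0`, `H ≈ Rmax * D`, `δ = η ≈ Tmin / D` it gives `√D`. The larger of the
two terms decides which choice is made.

One process must be bad for all initial states at once, so a bound in the mean over the hidden arms
is not enough: few wrong actions must have a probability exponentially small in `N`, to survive a
sum over the states. Two estimates give this. If few actions are wrong, then most contexts are
visited about `r` times, except with small probability, because arms lead to random contexts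
(`measure_deficit_le`, an exponential supermartingale in the number of missing visits). If the
contexts are visited enough, compare with the process in which no arm is hidden: summed over all `K
^ N` choices `θ`, the likelihood ratios on the event of few wrong actions factorize over the
contexts. In each context at most one arm can have received more than half of the visits, so each
factor is at most a fraction of `K` (`sum_likelihood_le`, `lintegral_prod_weight_le`). Averaging
over `θ` yields suitable hidden arms (`exists_measure_wrongs_le`). -/

noncomputable section

/-! ### Trajectory laws: the last step and the initial coordinate. -/

namespace ProbabilityTheory.Kernel

variable {X : Type*} [MeasurableSpace X] (κ : (n : ℕ) → Kernel ((_ : Finset.Iic n) → X) X)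
  [∀ n, IsMarkovKernel (κ n)]

/-- Disintegration of the law of a trajectory along the first `n + 1` coordinates. -/
theorem lintegral_traj_step (x₀ : (_ : Finset.Iic 0) → X) (n : ℕ) {F : (ℕ → X) → ℝ≥0∞}
    (hF : Measurable F) (hd : DependsOn F (Set.Iic (n + 1))) :
    ∫⁻ ω, F ω ∂(traj (X := fun _ => X) κ 0 x₀) =
      ∫⁻ ω, ∫⁻ x, F (Function.update ω (n + 1) x) ∂(κ n (Preorder.frestrictLe n ω))
        ∂(traj (X := fun _ => X) κ 0 x₀) := by
  have h1 : ∀ h : (_ : Finset.Iic n) → X, ∀ ω : ℕ → X, Preorder.frestrictLe n ω = h →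
      ∫⁻ ω', F ω' ∂(traj (X := fun _ => X) κ n h) =
        ∫⁻ x, F (Function.update ω (n + 1) x) ∂(κ n h) := by
    intro h ω hω
    rw [lintegral_traj (X := fun _ => X) (κ := κ) h hF, ← map_traj_succ_self (X := fun _ => X) (κ := κ),
      Kernel.map_apply _ (by fun_prop),
      MeasureTheory.lintegral_map (f := fun x => F (Function.update ω (n + 1) x))
        (hF.comp (measurable_update ω)) (by fun_prop)]
    refine lintegral_congr fun ω' => hd fun i hi => ?_
    rcases (Set.mem_Iic.1 hi).lt_or_eq with h2 | h2
    · have h3 : i ∈ Finset.Iic n := Finset.mem_Iic.2 (by omega)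
      have h4 : i ≠ n + 1 := by omega
      rw [Function.update_of_ne h4]
      simp only [Function.updateFinset, h3, dif_pos]
      rw [← hω]; rfl
    · subst h2
      have h3 : n + 1 ∉ Finset.Iic n := by simp
      simp [Function.updateFinset]
  nth_rw 1 [← traj_comp_partialTraj (X := fun _ => X) (κ := κ) (Nat.zero_le n)]
  rw [Kernel.lintegral_comp _ _ _ hF, ← traj_map_frestrictLe_apply (X := fun _ => X),
    MeasureTheory.lintegral_map (hF.lintegral_kernel) (by fun_prop)]
  exact lintegral_congr fun ω => h1 _ ω rfl

theorem ae_traj_zero (x₀ : (_ : Finset.Iic 0) → X) [MeasurableSingletonClass X] :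
    ∀ᵐ ω ∂(traj (X := fun _ => X) κ 0 x₀), ω 0 = x₀ ⟨0, by simp⟩ := by
  have h : (traj (X := fun _ => X) κ 0 x₀).map (fun ω => ω 0) = Measure.dirac (x₀ ⟨0, by simp⟩) := by
    have : (fun ω : ℕ → X => ω 0) =
      (fun h : (_ : Finset.Iic 0) → X => h ⟨0, by simp⟩) ∘ Preorder.frestrictLe 0 := rfl
    rw [this, ← Measure.map_map (by fun_prop) (by fun_prop),
      traj_map_frestrictLe_apply (X := fun _ => X), partialTraj_self, Kernel.id_apply,
      Measure.map_dirac' (by fun_prop)]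
  have h2 : ∀ᵐ x ∂((traj (X := fun _ => X) κ 0 x₀).map (fun ω => ω 0)), x = x₀ ⟨0, by simp⟩ := by
    rw [h]; exact (ae_dirac_iff (measurableSet_singleton _)).2 rfl
  exact ae_of_ae_map (measurable_pi_apply 0).aemeasurable h2

end ProbabilityTheory.Kernel

/-! ### Decision processes with constant holding time. -/

/-- A finite Markov decision process in which every step takes the time `T`, with a reward that is
a function of the transition. -/
structure FiniteMDP (m k : ℕ) where
  /-- transition probabilities -/
  w : Fin m → Fin k → Fin m → ℝ
  /-- rewards of transitions -/
  rew : Fin m → Fin k → Fin m → ℝ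
  /-- duration of a step -/
  T : ℝ
  w_nonneg : ∀ s a s', 0 ≤ w s a s'
  w_sum : ∀ s a, ∑ s', w s a s' = 1
  T_pos : 0 < T

namespace FiniteMDP

variable {m k : ℕ} (E : FiniteMDP m k) (𝒜 : ActionSets m k)

/-- A finite Markov decision process, seen as a semi-Markov decision process. -/
def toSMDP : SMDP 𝒜 where
  p s a := PMF.ofFintype (fun s' => ENNReal.ofReal (E.w s a s')) (by
    rw [← ENNReal.ofReal_sum_of_nonneg fun s' _ => E.w_nonneg s a s', E.w_sum, ENNReal.ofReal_one])
  law s a s' := Measure.dirac (E.rew s a s', E.T)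
  isProb s a s' := inferInstance
  holding_pos s a s' := by simpa using E.T_pos

/-- What is observed when action `a` leads from `s` to `s'`. -/
def obs (s : Fin m) (a : Fin k) (s' : Fin m) : Obs m k := (a, E.rew s a s', E.T, s')

variable {𝒜}

theorem lintegral_nextKernel (π : Policy 𝒜) (n : ℕ) (h : History m k n) {f : Obs m k → ℝ≥0∞}
    (hf : Measurable f) :
    ∫⁻ x, f x ∂((E.toSMDP 𝒜).nextKernel π n h) =
      ∫⁻ a, ∑ s', ENNReal.ofReal (E.w h.last a s') * f (E.obs h.last a s') ∂(π.choice n h) := by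
  have := π.markov n
  unfold SMDP.nextKernel
  rw [Kernel.lintegral_compProd _ _ _ hf]
  refine lintegral_congr fun a => ?_
  rw [Kernel.comap_apply]
  change ∫⁻ b, f (a, b) ∂((E.toSMDP 𝒜).stepLaw h.last a) = _
  unfold SMDP.stepLaw
  rw [lintegral_finsetSum_measure]
  refine Finset.sum_congr rfl fun s' _ => ?_
  have hm : Measurable fun b : ℝ × ℝ × Fin m => f (a, b) := hf.comp measurable_prodMk_left
  rw [lintegral_smul_measure]
  rw [lintegral_map hm (by fun_prop)]
  change _ * ∫⁻ x, f (a, x.1, x.2, s') ∂(Measure.dirac (E.rew h.last a s', E.T)) = _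
  rw [lintegral_dirac' _ (by fun_prop)]
  rfl

theorem lintegral_trajLaw_step (π : Policy 𝒜) (s : Fin m) (n : ℕ) {F : (ℕ → Obs m k) → ℝ≥0∞}
    (hF : Measurable F) (hd : DependsOn F (Set.Iic (n + 1))) :
    ∫⁻ ω, F ω ∂((E.toSMDP 𝒜).trajLaw π s) =
      ∫⁻ ω, ∫⁻ a, ∑ s', ENNReal.ofReal (E.w (ω n).state a s') *
        F (Function.update ω (n + 1) (E.obs (ω n).state a s'))
          ∂(π.choice n (Preorder.frestrictLe n ω)) ∂((E.toSMDP 𝒜).trajLaw π s) := by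
  unfold SMDP.trajLaw
  rw [Kernel.lintegral_traj_step _ _ n hF hd]
  refine lintegral_congr fun ω => ?_
  exact E.lintegral_nextKernel π n _ (f := fun x => F (Function.update ω (n + 1) x))
    (hF.comp (measurable_update ω))

instance (M : SMDP 𝒜) (π : Policy 𝒜) (s : Fin m) : IsProbabilityMeasure (M.trajLaw π s) := by
  unfold SMDP.trajLaw; infer_instance

theorem ae_state_zero (M : SMDP 𝒜) (π : Policy 𝒜) (s : Fin m) :
    ∀ᵐ ω ∂(M.trajLaw π s), (ω 0).state = s := by
  unfold SMDP.trajLaw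
  filter_upwards [Kernel.ae_traj_zero (M.nextKernel π)
    (fun _ => ((𝒜.nonempty s).choose, 0, 0, s))] with ω hω
  rw [hω]; rfl

/-- Observed steps are transitions of the process. -/
theorem ae_obs (π : Policy 𝒜) (s : Fin m) :
    ∀ᵐ ω ∂((E.toSMDP 𝒜).trajLaw π s), ∀ n,
      ω (n + 1) = E.obs (ω n).state (ω (n + 1)).action (ω (n + 1)).state := by
  rw [ae_all_iff]
  intro n
  have hms : ∀ i, Measurable fun ω : ℕ → Obs m k => (ω i).state := fun i =>
    Obs.measurable_state.comp (measurable_pi_apply i)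
  have hma : ∀ i, Measurable fun ω : ℕ → Obs m k => (ω i).action := fun i =>
    measurable_fst.comp (measurable_pi_apply i)
  have hobs : Measurable fun ω : ℕ → Obs m k =>
      E.obs (ω n).state (ω (n + 1)).action (ω (n + 1)).state := by
    have : Measurable fun x : Fin m × Fin k × Fin m => E.obs x.1 x.2.1 x.2.2 :=
      Measurable.of_discrete
    exact this.comp ((hms n).prodMk ((hma _).prodMk (hms _)))
  have hS : MeasurableSet {ω : ℕ → Obs m k |
      ω (n + 1) ≠ E.obs (ω n).state (ω (n + 1)).action (ω (n + 1)).state} :=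
    (measurableSet_eq_fun (measurable_pi_apply _) hobs).compl
  rw [ae_iff]
  change (E.toSMDP 𝒜).trajLaw π s {ω | ω (n + 1) ≠ _} = 0
  rw [← lintegral_indicator_one hS,
    E.lintegral_trajLaw_step π s n (measurable_one.indicator hS)]
  · simp [Set.indicator, obs, Obs.state, Obs.action]
  · intro x y hxy
    simp [Set.indicator, hxy n (by simp), hxy (n + 1) (by simp)]

end FiniteMDP

/-! ### Statistics updated along a trajectory. -/

namespace Obs

variable {m k : ℕ}

theorem measurable_state_apply (i : ℕ) : Measurable fun ω : ℕ → Obs m k => (ω i).state :=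
  measurable_state.comp (measurable_pi_apply i)

theorem measurable_action_apply (i : ℕ) : Measurable fun ω : ℕ → Obs m k => (ω i).action :=
  measurable_fst.comp (measurable_pi_apply i)

theorem measurable_transition {Y : Type*} [MeasurableSpace Y] (g : Fin m → Fin k → Fin m → Y)
    (t : ℕ) : Measurable fun ω : ℕ → Obs m k =>
      g (ω t).state (ω (t + 1)).action (ω (t + 1)).state := by
  have : Measurable fun x : Fin m × Fin k × Fin m => g x.1 x.2.1 x.2.2 := Measurable.of_discrete
  exact this.comp ((measurable_state_apply t).prodMk
    ((measurable_action_apply _).prodMk (measurable_state_apply _)))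

/-- A statistic of a trajectory that is updated at every transition. -/
def stat {V : Type*} (upd : V → Fin m → Fin k → Fin m → V) (v₀ : V) (ω : ℕ → Obs m k) : ℕ → V
  | 0 => v₀
  | t + 1 => upd (stat upd v₀ ω t) (ω t).state (ω (t + 1)).action (ω (t + 1)).state

section stat

variable {V : Type*} (upd : V → Fin m → Fin k → Fin m → V) (v₀ : V)

theorem dependsOn_stat (t : ℕ) : DependsOn (fun ω => stat upd v₀ ω t) (Set.Iic t) := by
  induction t with
  | zero => intro x y _; rfl
  | succ t ih =>
    intro x y hxy
    have h1 : stat upd v₀ x t = stat upd v₀ y t :=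
      ih fun i hi => hxy i (Set.mem_Iic.2 ((Set.mem_Iic.1 hi).trans t.le_succ))
    simp only [stat, h1, hxy t (by simp), hxy (t + 1) (by simp)]

theorem stat_update (t : ℕ) (ω : ℕ → Obs m k) (x : Obs m k) :
    stat upd v₀ (Function.update ω (t + 1) x) (t + 1) =
      upd (stat upd v₀ ω t) (ω t).state x.action x.state := by
  have h1 : stat upd v₀ (Function.update ω (t + 1) x) t = stat upd v₀ ω t :=
    dependsOn_stat upd v₀ t fun i hi =>
      Function.update_of_ne (by have := Set.mem_Iic.1 hi; omega) _ _
  simp [stat, h1]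

theorem measurable_stat [Countable V] [MeasurableSpace V] [DiscreteMeasurableSpace V] (t : ℕ) :
    Measurable fun ω => stat upd v₀ ω t := by
  induction t with
  | zero => exact measurable_const
  | succ t ih =>
    have : Measurable fun x : V × Fin m × Fin k × Fin m => upd x.1 x.2.1 x.2.2.1 x.2.2.2 :=
      Measurable.of_discrete
    exact this.comp (ih.prodMk ((measurable_state_apply t).prodMk
      ((measurable_action_apply _).prodMk (measurable_state_apply _))))

end stat

end Obs

open Obs

/-! ### Sub- and supermartingale potentials, and change of measure. -/

namespace FiniteMDP

variable {m k : ℕ} (E : FiniteMDP m k) {𝒜 : ActionSets m k}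

/-- Under the policy `π` only transitions satisfying `adm` occur. -/
def Plays (π : Policy 𝒜) (adm : Fin m → Fin k → Prop) : Prop :=
  ∀ n h, ∀ᵐ a ∂(π.choice n h), adm h.last a

theorem plays_true (π : Policy 𝒜) : Plays π fun _ _ => True := fun _ _ => by simp

theorem plays_toPolicy (d : StationaryPolicy 𝒜) : Plays d.toPolicy fun s a => a = d.1 s := by
  intro n h
  simp only [StationaryPolicy.toPolicy]
  rw [Kernel.deterministic_apply]
  exact (ae_dirac_iff (measurableSet_singleton _)).2 rfl

@[simp] theorem obs_state (s : Fin m) (a : Fin k) (s' : Fin m) : (E.obs s a s').state = s' := rfl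
@[simp] theorem obs_action (s : Fin m) (a : Fin k) (s' : Fin m) : (E.obs s a s').action = a := rfl

theorem lintegral_potential_zero {V : Type*} (upd : V → Fin m → Fin k → Fin m → V) (v₀ : V)
    (π : Policy 𝒜) (s : Fin m) (Ψ : Fin m → V → ℝ≥0∞) :
    ∫⁻ ω, Ψ (ω 0).state (stat upd v₀ ω 0) ∂((E.toSMDP 𝒜).trajLaw π s) = Ψ s v₀ := by
  rw [lintegral_congr_ae (g := fun _ => Ψ s v₀)]
  · simp
  · filter_upwards [ae_state_zero (E.toSMDP 𝒜) π s] with ω hω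
    simp [hω, stat]

section potential

variable {V : Type*} [Countable V] [MeasurableSpace V] [DiscreteMeasurableSpace V]
  (upd : V → Fin m → Fin k → Fin m → V) (v₀ : V)

theorem measurable_potential (Ψ : Fin m → V → ℝ≥0∞) (n : ℕ) :
    Measurable fun ω : ℕ → Obs m k => Ψ (ω n).state (stat upd v₀ ω n) := by
  have : Measurable fun x : Fin m × V => Ψ x.1 x.2 := Measurable.of_discrete
  exact this.comp ((measurable_state_apply n).prodMk (measurable_stat upd v₀ n))

theorem lintegral_potential_succ (π : Policy 𝒜) (s : Fin m) (Ψ : Fin m → V → ℝ≥0∞) (n : ℕ) :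
    ∫⁻ ω, Ψ (ω (n + 1)).state (stat upd v₀ ω (n + 1)) ∂((E.toSMDP 𝒜).trajLaw π s) =
      ∫⁻ ω, ∫⁻ a, ∑ s', ENNReal.ofReal (E.w (ω n).state a s') *
        Ψ s' (upd (stat upd v₀ ω n) (ω n).state a s') ∂(π.choice n (Preorder.frestrictLe n ω))
          ∂((E.toSMDP 𝒜).trajLaw π s) := by
  rw [E.lintegral_trajLaw_step π s n (measurable_potential upd v₀ Ψ (n + 1))]
  · simp only [stat_update, Function.update_self, obs_state, obs_action]
  · intro x y hxy
    have := dependsOn_stat upd v₀ (n + 1) hxy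
    simp only at this
    simp only [this, hxy (n + 1) (by simp)]

variable {upd v₀}

/-- The one-step inequality makes the potential a supermartingale under any policy playing
admissible actions. The statistic `v` carries whatever part of the past the potential needs, so no
filtration or conditional expectation is required. -/
theorem lintegral_potential_le {π : Policy 𝒜} {adm : Fin m → Fin k → Prop} (hπ : Plays π adm)
    (s : Fin m) (Ψ : ℕ → Fin m → V → ℝ≥0∞)
    (hΨ : ∀ t s v a, adm s a →
      ∑ s', ENNReal.ofReal (E.w s a s') * Ψ (t + 1) s' (upd v s a s') ≤ Ψ t s v) (n : ℕ) :
    ∫⁻ ω, Ψ n (ω n).state (stat upd v₀ ω n) ∂((E.toSMDP 𝒜).trajLaw π s) ≤ Ψ 0 s v₀ := by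
  induction n with
  | zero => rw [lintegral_potential_zero]
  | succ n ih =>
    rw [lintegral_potential_succ]
    refine (lintegral_mono fun ω => ?_).trans ih
    have := π.markov n
    calc _ ≤ ∫⁻ a, Ψ n (ω n).state (stat upd v₀ ω n) ∂(π.choice n (Preorder.frestrictLe n ω)) :=
          lintegral_mono_ae ((hπ n _).mono fun a ha => hΨ n _ _ a ha)
      _ = _ := by simp

theorem le_lintegral_potential {π : Policy 𝒜} {adm : Fin m → Fin k → Prop} (hπ : Plays π adm)
    (s : Fin m) (Ψ : ℕ → Fin m → V → ℝ≥0∞)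
    (hΨ : ∀ t s v a, adm s a →
      Ψ t s v ≤ ∑ s', ENNReal.ofReal (E.w s a s') * Ψ (t + 1) s' (upd v s a s')) (n : ℕ) :
    Ψ 0 s v₀ ≤ ∫⁻ ω, Ψ n (ω n).state (stat upd v₀ ω n) ∂((E.toSMDP 𝒜).trajLaw π s) := by
  induction n with
  | zero => rw [lintegral_potential_zero]
  | succ n ih =>
    rw [lintegral_potential_succ]
    refine ih.trans (lintegral_mono fun ω => ?_)
    have := π.markov n
    calc _ = ∫⁻ a, Ψ n (ω n).state (stat upd v₀ ω n) ∂(π.choice n (Preorder.frestrictLe n ω)) := by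
          simp
      _ ≤ _ := lintegral_mono_ae ((hπ n _).mono fun a ha => hΨ n _ _ a ha)

theorem sum_ofReal_mul_ofReal (s : Fin m) (a : Fin k) {f : Fin m → ℝ} (hf : ∀ s', 0 ≤ f s') :
    ∑ s', ENNReal.ofReal (E.w s a s') * ENNReal.ofReal (f s') =
      ENNReal.ofReal (∑ s', E.w s a s' * f s') := by
  rw [ENNReal.ofReal_sum_of_nonneg fun s' _ => mul_nonneg (E.w_nonneg _ _ _) (hf s')]
  exact Finset.sum_congr rfl fun s' _ => (ENNReal.ofReal_mul (E.w_nonneg _ _ _)).symm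

theorem lintegral_ofReal_potential_le {π : Policy 𝒜} {adm : Fin m → Fin k → Prop}
    (hπ : Plays π adm) (s : Fin m) (Ψ : ℕ → Fin m → V → ℝ) (h0 : ∀ t s v, 0 ≤ Ψ t s v)
    (hΨ : ∀ t s v a, adm s a → ∑ s', E.w s a s' * Ψ (t + 1) s' (upd v s a s') ≤ Ψ t s v)
    (n : ℕ) :
    ∫⁻ ω, ENNReal.ofReal (Ψ n (ω n).state (stat upd v₀ ω n)) ∂((E.toSMDP 𝒜).trajLaw π s) ≤
      ENNReal.ofReal (Ψ 0 s v₀) := by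
  refine E.lintegral_potential_le (upd := upd) (v₀ := v₀) hπ s
    (fun t s v => ENNReal.ofReal (Ψ t s v)) (fun t s v a ha => ?_) n
  rw [E.sum_ofReal_mul_ofReal s a fun s' => h0 _ _ _]
  exact ENNReal.ofReal_le_ofReal (hΨ t s v a ha)

theorem le_lintegral_ofReal_potential {π : Policy 𝒜} {adm : Fin m → Fin k → Prop}
    (hπ : Plays π adm) (s : Fin m) (Ψ : ℕ → Fin m → V → ℝ) (h0 : ∀ t s v, 0 ≤ Ψ t s v)
    (hΨ : ∀ t s v a, adm s a → Ψ t s v ≤ ∑ s', E.w s a s' * Ψ (t + 1) s' (upd v s a s'))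
    (n : ℕ) :
    ENNReal.ofReal (Ψ 0 s v₀) ≤
      ∫⁻ ω, ENNReal.ofReal (Ψ n (ω n).state (stat upd v₀ ω n)) ∂((E.toSMDP 𝒜).trajLaw π s) := by
  refine E.le_lintegral_potential (upd := upd) (v₀ := v₀) hπ s
    (fun t s v => ENNReal.ofReal (Ψ t s v)) (fun t s v a ha => ?_) n
  rw [E.sum_ofReal_mul_ofReal s a fun s' => h0 _ _ _]
  exact ENNReal.ofReal_le_ofReal (hΨ t s v a ha)

/-- Change of measure between two processes with the same rewards, whose transition
probabilities differ by a factor `lr`. -/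
theorem lintegral_change_of_measure (E' : FiniteMDP m k) (π : Policy 𝒜) (s : Fin m)
    (lr : Fin m → Fin k → Fin m → ℝ) (hobs : ∀ s a s', E'.obs s a s' = E.obs s a s')
    (hw : ∀ s a s', E'.w s a s' = E.w s a s' * lr s a s')
    (ℓ : V → ℝ) (hℓ0 : ∀ v, 0 ≤ ℓ v) (hℓ : ∀ v s a s', ℓ (upd v s a s') = ℓ v * lr s a s')
    (h1 : ℓ v₀ = 1) (n : ℕ) {F : (ℕ → Obs m k) → ℝ≥0∞}
    (hF : Measurable F) (hd : DependsOn F (Set.Iic n)) :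
    ∫⁻ ω, F ω ∂((E'.toSMDP 𝒜).trajLaw π s) =
      ∫⁻ ω, F ω * ENNReal.ofReal (ℓ (stat upd v₀ ω n)) ∂((E.toSMDP 𝒜).trajLaw π s) := by
  induction n generalizing F with
  | zero =>
    simp only [stat, h1, ENNReal.ofReal_one, mul_one]
    have key : ∀ E : FiniteMDP m k, ∫⁻ ω, F ω ∂((E.toSMDP 𝒜).trajLaw π s) =
        F (fun _ => ((𝒜.nonempty s).choose, 0, 0, s)) := by
      intro E
      rw [lintegral_congr_ae (g := fun _ => F (fun _ => ((𝒜.nonempty s).choose, 0, 0, s)))]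
      · simp
      · unfold SMDP.trajLaw
        filter_upwards [Kernel.ae_traj_zero ((E.toSMDP 𝒜).nextKernel π)
          (fun _ => ((𝒜.nonempty s).choose, 0, 0, s))] with ω hω
        refine hd fun i hi => ?_
        have : i = 0 := by simpa using hi
        rw [this, hω]
    rw [key, key]
  | succ n ih =>
    -- Integrating out the last step under `E'` leaves a function of the first `n` steps, to which
    -- the induction hypothesis applies; the factor `lr` of the last step turns the likelihood after
    -- `n` steps into that after `n + 1`.
    set G : (ℕ → Obs m k) → ℝ≥0∞ := fun ω =>
      ∫⁻ x, F (Function.update ω (n + 1) x)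
        ∂((E'.toSMDP 𝒜).nextKernel π n (Preorder.frestrictLe n ω)) with hG
    have hGm : Measurable G := by
      have h2 : Measurable fun p : (ℕ → Obs m k) × Obs m k =>
          F (Function.update p.1 (n + 1) p.2) := hF.comp measurable_update'
      exact h2.lintegral_kernel_prod_right'
        (κ := ((E'.toSMDP 𝒜).nextKernel π n).comap (Preorder.frestrictLe n) (by fun_prop))
    have hGd : DependsOn G (Set.Iic n) := by
      intro x y hxy
      have h3 : Preorder.frestrictLe (π := fun _ => Obs m k) n x = Preorder.frestrictLe n y := by
        ext1 i
        exact hxy i (Finset.mem_Iic.1 i.2)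
      simp only [hG, h3]
      refine lintegral_congr fun b => hd fun i hi => ?_
      by_cases hi' : i = n + 1
      · subst hi'; simp
      · rw [Function.update_of_ne hi', Function.update_of_ne hi']
        exact hxy i (Set.mem_Iic.2 (by have := Set.mem_Iic.1 hi; omega))
    have hstep : ∀ ω, G ω = ∫⁻ a, ∑ s', ENNReal.ofReal (E'.w (ω n).state a s') *
        F (Function.update ω (n + 1) (E'.obs (ω n).state a s'))
          ∂(π.choice n (Preorder.frestrictLe n ω)) := fun ω =>
      E'.lintegral_nextKernel π n _ (f := fun x => F (Function.update ω (n + 1) x))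
        (hF.comp (measurable_update ω))
    have hℓm : Measurable fun ω : ℕ → Obs m k => ENNReal.ofReal (ℓ (stat upd v₀ ω (n + 1))) :=
      (measurable_potential upd v₀ (fun _ v => ENNReal.ofReal (ℓ v)) (n + 1))
    rw [E'.lintegral_trajLaw_step π s n hF hd, E.lintegral_trajLaw_step π s n
      (F := fun ω => F ω * ENNReal.ofReal (ℓ (stat upd v₀ ω (n + 1)))) (hF.mul hℓm)]
    · rw [← lintegral_congr hstep, ih hGm hGd]
      refine lintegral_congr fun ω => ?_
      rw [hstep, ← lintegral_mul_const _ (Measurable.of_discrete)]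
      refine lintegral_congr fun a => ?_
      rw [Finset.sum_mul]
      refine Finset.sum_congr rfl fun s' _ => ?_
      rw [stat_update, hobs, hℓ, hw, ENNReal.ofReal_mul (E.w_nonneg _ _ _), obs_state, obs_action,
        ENNReal.ofReal_mul (hℓ0 _)]
      ring
    · intro x y hxy
      have := dependsOn_stat upd v₀ (n + 1) hxy
      simp only at this
      simp only [this, hd hxy]

end potential

end FiniteMDP

namespace FiniteMDP

variable {m k : ℕ} (E : FiniteMDP m k) {𝒜 : ActionSets m k}

/-! ### Expected hitting times. -/

section hitting

/-- Counts the steps made before the state `y` is visited; the second component records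
whether it has been. -/
def hitUpd (y : Fin m) (v : ℕ × Bool) (s : Fin m) (_ : Fin k) (_ : Fin m) : ℕ × Bool :=
  if v.2 = true ∨ s = y then (v.1, true) else (v.1 + 1, false)

/-- The number of steps among the first `t` made before the state `y` is visited. -/
def hitCount (y : Fin m) (ω : ℕ → Obs m k) (t : ℕ) : ℕ × Bool := stat (hitUpd y) (0, false) ω t

variable (y : Fin m) (ω : ℕ → Obs m k)

theorem hitCount_succ (t : ℕ) : hitCount y ω (t + 1) =
    if (hitCount y ω t).2 = true ∨ (ω t).state = y then ((hitCount y ω t).1, true)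
    else ((hitCount y ω t).1 + 1, false) := rfl

theorem hitCount_of_not (t : ℕ) (h : (hitCount y ω t).2 = false) :
    (hitCount y ω t).1 = t ∧ ∀ i < t, (ω i).state ≠ y := by
  induction t with
  | zero => exact ⟨rfl, by simp⟩
  | succ t ih =>
    rw [hitCount_succ] at h ⊢
    split_ifs at h ⊢ with h1
    push Not at h1
    have h2 := ih (by simpa using h1.1)
    refine ⟨by simp [h2.1], fun i hi => ?_⟩
    rcases Nat.lt_succ_iff_lt_or_eq.1 hi with h3 | h3
    · exact h2.2 i h3
    · rw [h3]; exact h1.2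

theorem hitCount_le {n : ℕ} (hn : (ω n).state = y) (t : ℕ) : (hitCount y ω t).1 ≤ n := by
  induction t with
  | zero => exact Nat.zero_le _
  | succ t ih =>
    rw [hitCount_succ]
    split_ifs with h1
    · exact ih
    · push Not at h1
      obtain ⟨h2, h3⟩ := hitCount_of_not y ω t (by simpa using h1.1)
      have : t ≤ n := by by_contra h; exact h3 n (by omega) hn
      have : t ≠ n := fun h => h1.2 (h ▸ hn)
      simp only [h2]; omega

theorem hitCount_mono : Monotone fun t => (hitCount y ω t).1 :=
  monotone_nat_of_le_succ fun t => by
    simp only [hitCount_succ]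
    split_ifs <;> simp

variable {T : ℝ} {ω}

theorem hittingTime_eq (hω : ∀ i, (ω (i + 1)).time = T) :
    SMDP.hittingTime y ω = ⨅ (n : ℕ) (_ : (ω n).state = y), n * ENNReal.ofReal T := by
  unfold SMDP.hittingTime
  refine iInf_congr fun n => iInf_congr fun _ => ?_
  rw [Finset.sum_congr rfl (g := fun _ => ENNReal.ofReal T)]
  · simp
  · intro i hi
    obtain ⟨j, rfl⟩ : ∃ j, i = j + 1 := ⟨i - 1, by have := (Finset.mem_Icc.1 hi).1; omega⟩
    rw [hω]

theorem hitCount_le_hittingTime (hω : ∀ i, (ω (i + 1)).time = T) (t : ℕ) :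
    (hitCount y ω t).1 * ENNReal.ofReal T ≤ SMDP.hittingTime y ω := by
  rw [hittingTime_eq y hω]
  refine le_iInf₂ fun n hn => ?_
  gcongr
  exact hitCount_le y ω hn t

/-- The count freezes at the first visit to `y`; if there is none it grows without bound, which
matches the value `∞` of the hitting time. -/
theorem hittingTime_le_iSup (hT : 0 < T) (hω : ∀ i, (ω (i + 1)).time = T) :
    SMDP.hittingTime y ω ≤ ⨆ t, (hitCount y ω t).1 * ENNReal.ofReal T := by
  rw [hittingTime_eq y hω]
  by_cases h : ∃ n, (ω n).state = y
  · refine (iInf₂_le (Nat.find h) (Nat.find_spec h)).trans ?_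
    refine le_trans ?_ (le_iSup _ (Nat.find h))
    have : (hitCount y ω (Nat.find h)).2 = false := by
      have : ∀ t ≤ Nat.find h, (hitCount y ω t).2 = false := by
        intro t ht
        induction t with
        | zero => rfl
        | succ t ih =>
          rw [hitCount_succ, if_neg]
          push Not
          exact ⟨by simp [ih (by omega)], Nat.find_min h (by omega)⟩
      exact this _ le_rfl
    rw [(hitCount_of_not y ω _ this).1]
  · have h2 : ∀ t, (hitCount y ω t).1 = t := by
      intro t
      refine (hitCount_of_not y ω t ?_).1
      induction t with
      | zero => rfl
      | succ t ih =>
        rw [hitCount_succ, if_neg]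
        push Not
        exact ⟨by simp [ih], fun h3 => h ⟨t, h3⟩⟩
    simp only [h2]
    rw [← ENNReal.iSup_mul, ENNReal.iSup_natCast, ENNReal.top_mul (by simpa using hT)]
    exact le_top

theorem ae_time (π : Policy 𝒜) (s : Fin m) :
    ∀ᵐ ω ∂((E.toSMDP 𝒜).trajLaw π s), ∀ n, (ω (n + 1)).time = E.T := by
  filter_upwards [E.ae_obs π s] with ω hω n
  rw [hω n]; rfl

/-- A supersolution bounds the expected hitting time from above. -/
theorem lintegral_hittingTime_le {π : Policy 𝒜} {adm : Fin m → Fin k → Prop} (hπ : Plays π adm)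
    (s y : Fin m) (V : Fin m → ℝ) (hV0 : ∀ s, 0 ≤ V s) (hy : V y = 0)
    (hV : ∀ s a, s ≠ y → adm s a → E.T + ∑ s', E.w s a s' * V s' ≤ V s) :
    ∫⁻ ω, SMDP.hittingTime y ω ∂((E.toSMDP 𝒜).trajLaw π s) ≤ ENNReal.ofReal (V s) := by
  have hT := E.T_pos
  let Ψ : ℕ → Fin m → ℕ × Bool → ℝ := fun _ s v =>
    v.1 * E.T + if v.2 = true ∨ s = y then 0 else V s
  have hP : ∀ t : ℕ, ∫⁻ ω, ((hitCount y ω t).1 : ℝ≥0∞) * ENNReal.ofReal E.T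
      ∂((E.toSMDP 𝒜).trajLaw π s) ≤ ENNReal.ofReal (V s) := by
    intro n
    have := E.lintegral_ofReal_potential_le (upd := hitUpd y) (v₀ := (0, false)) hπ s Ψ
      (fun t s v => by
        simp only [Ψ]
        split_ifs
        · positivity
        · have := hV0 s; positivity) ?_ n
    · refine (lintegral_mono fun ω => ?_).trans (this.trans (ENNReal.ofReal_le_ofReal ?_))
      · simp only [Ψ]
        rw [← ENNReal.ofReal_natCast, ← ENNReal.ofReal_mul (by positivity)]
        refine ENNReal.ofReal_le_ofReal ?_
        change _ ≤ ((hitCount y ω n).1 : ℝ) * E.T + _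
        split_ifs
        · simp
        · simpa using hV0 _
      · have : ∀ p : Prop, ∀ [Decidable p], (if p then 0 else V s) ≤ V s := fun p _ => by
          split_ifs
          exacts [hV0 s, le_rfl]
        simpa [Ψ] using this _
    · rintro t s ⟨c, done⟩ a ha
      simp only [Ψ, hitUpd]
      by_cases h1 : done = true ∨ s = y
      · simp only [h1, if_true, true_or, add_zero]
        rw [← Finset.sum_mul, E.w_sum, one_mul]
      · simp only [h1, if_false, Bool.false_eq_true, false_or]
        have h2 : ∀ s', (if s' = y then 0 else V s') = V s' := fun s' => by
          split_ifs with h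
          · rw [h, hy]
          · rfl
        simp only [h2, mul_add, Finset.sum_add_distrib, ← Finset.sum_mul, E.w_sum]
        have := hV s a (fun h => h1 (Or.inr h)) ha
        push_cast
        linarith
  have hm : ∀ t, Measurable fun ω : ℕ → Obs m k =>
      ((hitCount y ω t).1 : ℝ≥0∞) * ENNReal.ofReal E.T := fun t =>
    measurable_potential (hitUpd y) (0, false) (fun _ v => (v.1 : ℝ≥0∞) * ENNReal.ofReal E.T) t
  calc _ ≤ ∫⁻ ω, ⨆ t, ((hitCount y ω t).1 : ℝ≥0∞) * ENNReal.ofReal E.T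
        ∂((E.toSMDP 𝒜).trajLaw π s) :=
        lintegral_mono_ae ((E.ae_time π s).mono fun ω hω => hittingTime_le_iSup y hT hω)
    _ = ⨆ t, ∫⁻ ω, ((hitCount y ω t).1 : ℝ≥0∞) * ENNReal.ofReal E.T
        ∂((E.toSMDP 𝒜).trajLaw π s) := by
        refine lintegral_iSup hm fun i j hij ω => ?_
        have := hitCount_mono y ω hij
        simp only at this ⊢
        gcongr
    _ ≤ _ := iSup_le hP

/-- A bounded subsolution bounds the expected hitting time from below. -/
theorem le_lintegral_hittingTime {π : Policy 𝒜} {adm : Fin m → Fin k → Prop} (hπ : Plays π adm)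
    (s y : Fin m) (hsy : s ≠ y) (V : Fin m → ℝ) (hV0 : ∀ s, 0 ≤ V s) (hy : V y = 0)
    (hV : ∀ s a, s ≠ y → adm s a → V s ≤ E.T + ∑ s', E.w s a s' * V s') :
    ENNReal.ofReal (V s) ≤ ∫⁻ ω, SMDP.hittingTime y ω ∂((E.toSMDP 𝒜).trajLaw π s) := by
  have hT := E.T_pos
  obtain ⟨B, hB⟩ : ∃ B, ∀ s, V s ≤ B := ⟨∑ s, V s, fun s =>
    Finset.single_le_sum (fun s _ => hV0 s) (Finset.mem_univ s)⟩
  have hB0 : 0 ≤ B := (hV0 s).trans (hB s)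
  let Ψ : ℕ → Fin m → ℕ × Bool → ℝ := fun _ s v =>
    v.1 * E.T + if v.2 = true ∨ s = y then 0 else V s
  set I := ∫⁻ ω, SMDP.hittingTime y ω ∂((E.toSMDP 𝒜).trajLaw π s) with hI
  -- A trajectory that misses `y` for `n` steps has hitting time at least `n * T`. The remaining
  -- value, at most `B`, is therefore at most `B / (n * T)` times the hitting time, a correction
  -- that vanishes as `n` grows.
  have hP : ∀ n : ℕ, ENNReal.ofReal (V s) ≤
      (1 + ENNReal.ofReal (B / E.T) * ((n + 1 : ℕ) : ℝ≥0∞)⁻¹) * I := by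
    intro n'
    set n := n' + 1
    have := E.le_lintegral_ofReal_potential (upd := hitUpd y) (v₀ := (0, false)) hπ s Ψ
      (fun t s v => by
        simp only [Ψ]
        split_ifs
        · positivity
        · have := hV0 s; positivity) ?_ n
    · have h1 : ENNReal.ofReal (V s) = ENNReal.ofReal (Ψ 0 s (0, false)) := by
        simp [Ψ, hsy]
      rw [h1]
      refine this.trans ?_
      rw [hI, ← lintegral_const_mul' _ _ (by
        refine ENNReal.add_ne_top.2 ⟨by simp, ENNReal.mul_ne_top (by simp) (by simp [n])⟩)]
      refine lintegral_mono_ae ((E.ae_time π s).mono fun ω hω => ?_)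
      have h2 := hitCount_le_hittingTime y hω n
      change ENNReal.ofReal (((hitCount y ω n).1 : ℝ) * E.T +
        if (hitCount y ω n).2 = true ∨ (ω n).state = y then 0 else V (ω n).state) ≤ _
      by_cases h3 : (hitCount y ω n).2 = true ∨ (ω n).state = y
      · rw [if_pos h3, add_zero, ENNReal.ofReal_mul (by positivity), ENNReal.ofReal_natCast, add_mul,
          one_mul]
        exact h2.trans le_self_add
      · rw [if_neg h3]
        push Not at h3
        have h4 := (hitCount_of_not y ω n (by simpa using h3.1)).1
        rw [h4] at h2 ⊢
        calc ENNReal.ofReal ((n : ℝ) * E.T + V (ω n).state)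
            ≤ ENNReal.ofReal ((1 + B / E.T * (n : ℝ)⁻¹) * (n * E.T)) := by
              refine ENNReal.ofReal_le_ofReal ?_
              have hn : (n : ℝ) ≠ 0 := Nat.cast_ne_zero.2 (Nat.succ_ne_zero n')
              have : (1 + B / E.T * (n : ℝ)⁻¹) * (n * E.T) = n * E.T + B := by
                field_simp
              rw [this]
              linarith [hB (ω n).state]
          _ = (1 + ENNReal.ofReal (B / E.T) * ((n : ℕ) : ℝ≥0∞)⁻¹) * (n * ENNReal.ofReal E.T) := by
              have hn : (0 : ℝ) < n := Nat.cast_pos.2 (Nat.succ_pos n')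
              rw [ENNReal.ofReal_mul (by positivity), ENNReal.ofReal_add (by positivity) (by positivity),
                ENNReal.ofReal_mul (by positivity), ENNReal.ofReal_mul (by positivity),
                ENNReal.ofReal_inv_of_pos hn, ENNReal.ofReal_natCast, ENNReal.ofReal_one]
          _ ≤ _ := by gcongr
    · rintro t s ⟨c, done⟩ a ha
      simp only [Ψ, hitUpd]
      by_cases h1 : done = true ∨ s = y
      · simp only [h1, if_true, true_or, add_zero]
        rw [← Finset.sum_mul, E.w_sum, one_mul]
      · simp only [h1, if_false, Bool.false_eq_true, false_or]
        have h2 : ∀ s', (if s' = y then 0 else V s') = V s' := fun s' => by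
          split_ifs with h
          · rw [h, hy]
          · rfl
        simp only [h2, mul_add, Finset.sum_add_distrib, ← Finset.sum_mul, E.w_sum]
        have := hV s a (fun h => h1 (Or.inr h)) ha
        push_cast
        linarith
  by_cases hItop : I = ⊤
  · rw [hItop]; exact le_top
  have hlim : Tendsto (fun n : ℕ => (1 + ENNReal.ofReal (B / E.T) * ((n + 1 : ℕ) : ℝ≥0∞)⁻¹) * I)
      atTop (nhds ((1 + ENNReal.ofReal (B / E.T) * 0) * I)) := by
    refine ENNReal.Tendsto.mul_const ?_ (Or.inr hItop)
    refine tendsto_const_nhds.add (ENNReal.Tendsto.const_mul ?_ (Or.inr (by simp)))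
    exact (tendsto_add_atTop_iff_nat 1).2 ENNReal.tendsto_inv_nat_nhds_zero
  have := ge_of_tendsto' hlim hP
  simpa using this

end hitting

/-! ### Average reward, optimality equation and regret. -/

section reward

/-- The sum of `g` over the first `n` transitions. -/
def transSum (g : Fin m → Fin k → Fin m → ℝ) (n : ℕ) (ω : ℕ → Obs m k) : ℝ :=
  ∑ t ∈ Finset.range n, g (ω t).state (ω (t + 1)).action (ω (t + 1)).state

theorem transSum_succ (g : Fin m → Fin k → Fin m → ℝ) (n : ℕ) (ω : ℕ → Obs m k) :
    transSum g (n + 1) ω =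
      transSum g n ω + g (ω n).state (ω (n + 1)).action (ω (n + 1)).state :=
  Finset.sum_range_succ _ _

theorem integrable_transition (P : Measure (ℕ → Obs m k)) [IsFiniteMeasure P]
    (g : Fin m → Fin k → Fin m → ℝ) (t : ℕ) :
    Integrable (fun ω => g (ω t).state (ω (t + 1)).action (ω (t + 1)).state) P := by
  refine Integrable.of_bound (measurable_transition g t).aestronglyMeasurable
    (∑ s, ∑ a, ∑ s', |g s a s'|) (ae_of_all _ fun ω => ?_)
  have h1 : ∀ s a, 0 ≤ ∑ s', |g s a s'| := fun s a => Finset.sum_nonneg fun _ _ => abs_nonneg _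
  have h2 : ∀ s, 0 ≤ ∑ a, ∑ s', |g s a s'| := fun s => Finset.sum_nonneg fun _ _ => h1 _ _
  calc _ ≤ ∑ s', |g (ω t).state (ω (t + 1)).action s'| :=
        Finset.single_le_sum (f := fun s' => |g (ω t).state (ω (t + 1)).action s'|)
          (fun _ _ => abs_nonneg _) (Finset.mem_univ _)
    _ ≤ ∑ a, ∑ s', |g (ω t).state a s'| :=
        Finset.single_le_sum (f := fun a => ∑ s', |g (ω t).state a s'|)
          (fun _ _ => h1 _ _) (Finset.mem_univ _)
    _ ≤ _ := Finset.single_le_sum (f := fun s => ∑ a, ∑ s', |g s a s'|)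
          (fun _ _ => h2 _) (Finset.mem_univ _)

theorem integrable_transSum (P : Measure (ℕ → Obs m k)) [IsFiniteMeasure P]
    (g : Fin m → Fin k → Fin m → ℝ) (n : ℕ) : Integrable (transSum g n) P := by
  unfold transSum
  exact integrable_finsetSum _ fun t _ => integrable_transition P g t

theorem integral_transition_nonpos {π : Policy 𝒜} {adm : Fin m → Fin k → Prop}
    (hπ : Plays π adm) (s : Fin m) (g : Fin m → Fin k → Fin m → ℝ)
    (hg : ∀ s a, adm s a → ∑ s', E.w s a s' * g s a s' ≤ 0) (t : ℕ) :
    ∫ ω, g (ω t).state (ω (t + 1)).action (ω (t + 1)).state ∂((E.toSMDP 𝒜).trajLaw π s) ≤ 0 := by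
  set P := (E.toSMDP 𝒜).trajLaw π s
  obtain ⟨C, hC⟩ : ∃ C, ∀ s a s', |g s a s'| ≤ C := by
    refine ⟨∑ s, ∑ a, ∑ s', |g s a s'|, fun s a s' => ?_⟩
    have h1 : ∀ s a, 0 ≤ ∑ s', |g s a s'| := fun s a => Finset.sum_nonneg fun _ _ => abs_nonneg _
    have h2 : ∀ s, 0 ≤ ∑ a, ∑ s', |g s a s'| := fun s => Finset.sum_nonneg fun _ _ => h1 _ _
    calc |g s a s'| ≤ ∑ s', |g s a s'| :=
          Finset.single_le_sum (f := fun s' => |g s a s'|)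
            (fun _ _ => abs_nonneg _) (Finset.mem_univ _)
      _ ≤ ∑ a, ∑ s', |g s a s'| :=
          Finset.single_le_sum (f := fun a => ∑ s', |g s a s'|)
            (fun _ _ => h1 _ _) (Finset.mem_univ _)
      _ ≤ _ := Finset.single_le_sum (f := fun s => ∑ a, ∑ s', |g s a s'|)
            (fun _ _ => h2 _) (Finset.mem_univ _)
  -- The one-step formula is available for `ℝ≥0∞`-valued functions only, so `g` is shifted to be
  -- nonnegative.
  have h0 : ∀ s a s', 0 ≤ g s a s' + C := fun s a s' => by
    have := abs_le.1 (hC s a s'); linarith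
  have hC0 : 0 ≤ C := (abs_nonneg _).trans (hC s (𝒜.nonempty s).choose s)
  have h1 : ∫⁻ ω, ENNReal.ofReal (g (ω t).state (ω (t + 1)).action (ω (t + 1)).state + C) ∂P ≤
      ENNReal.ofReal C := by
    rw [E.lintegral_trajLaw_step π s t
      (measurable_transition (fun s a s' => ENNReal.ofReal (g s a s' + C)) t)]
    · calc _ ≤ ∫⁻ _, ENNReal.ofReal C ∂P := lintegral_mono fun ω => ?_
        _ = _ := by simp
      have := π.markov t
      calc _ ≤ ∫⁻ a, ENNReal.ofReal C ∂(π.choice t (Preorder.frestrictLe t ω)) := by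
            refine lintegral_mono_ae ((hπ t _).mono fun a ha => ?_)
            have ht : t ≠ t + 1 := by omega
            simp only [Function.update_self, Function.update_of_ne ht, obs_state, obs_action]
            rw [E.sum_ofReal_mul_ofReal _ _ fun s' => h0 _ _ _]
            refine ENNReal.ofReal_le_ofReal ?_
            simp only [mul_add, Finset.sum_add_distrib, ← Finset.sum_mul, E.w_sum, one_mul]
            have := hg _ a ha
            change ∑ s', E.w (ω t).state a s' * g (ω t).state a s' ≤ 0 at this
            linarith
        _ = _ := by simp
    · intro x y hxy
      simp only [hxy t (by simp), hxy (t + 1) (by simp)]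
  have h2 : ∫ ω, (g (ω t).state (ω (t + 1)).action (ω (t + 1)).state + C) ∂P ≤ C := by
    rw [integral_eq_lintegral_of_nonneg_ae (ae_of_all _ fun ω => h0 _ _ _)
      (measurable_transition (fun s a s' => g s a s' + C) t).aestronglyMeasurable]
    exact ENNReal.toReal_le_of_le_ofReal hC0 h1
  rw [integral_add (integrable_transition P g t) (integrable_const _)] at h2
  simpa using h2

theorem integrable_state (P : Measure (ℕ → Obs m k)) [IsFiniteMeasure P] (h : Fin m → ℝ) (n : ℕ) :
    Integrable (fun ω => h (ω n).state) P :=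
  integrable_transition P (fun s _ _ => h s) n

/-- The optimality inequality bounds the expected reward of a policy. -/
theorem integral_transSum_le {π : Policy 𝒜} {adm : Fin m → Fin k → Prop} (hπ : Plays π adm)
    (s : Fin m) (h : Fin m → ℝ) (ρ : ℝ) (g : Fin m → Fin k → Fin m → ℝ)
    (hg : ∀ s a, adm s a → ∑ s', E.w s a s' * (g s a s' + h s') ≤ ρ + h s) (n : ℕ) :
    ∫ ω, transSum g n ω ∂((E.toSMDP 𝒜).trajLaw π s) +
      ∫ ω, h (ω n).state ∂((E.toSMDP 𝒜).trajLaw π s) ≤ n * ρ + h s := by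
  set P := (E.toSMDP 𝒜).trajLaw π s with hP
  induction n with
  | zero =>
    have : ∫ ω, h (ω 0).state ∂P = h s := by
      rw [integral_congr_ae (g := fun _ => h s)]
      · simp
      · filter_upwards [ae_state_zero (E.toSMDP 𝒜) π s] with ω hω
        rw [hω]
    simp [transSum, this]
  | succ n ih =>
    have h1 := E.integral_transition_nonpos hπ s (fun s a s' => g s a s' + h s' - ρ - h s)
      (fun s a ha => by
        have := hg s a ha
        simp only [mul_sub, Finset.sum_sub_distrib, ← Finset.sum_mul, E.w_sum, one_mul]
        linarith) n
    rw [← hP, integral_sub, integral_sub, integral_add] at h1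
    · have h2 : ∫ ω, transSum g (n + 1) ω ∂P = ∫ ω, transSum g n ω ∂P +
          ∫ ω, g (ω n).state (ω (n + 1)).action (ω (n + 1)).state ∂P := by
        rw [← integral_add (integrable_transSum P g n) (integrable_transition P g n)]
        simp [transSum_succ]
      rw [h2]
      simp only [integral_const, probReal_univ, smul_eq_mul, one_mul] at h1
      push_cast
      linarith
    · exact integrable_transition P g n
    · exact integrable_state P h _
    · exact integrable_transition P (fun s a s' => g s a s' + h s') n
    · exact integrable_const _
    · exact integrable_transition P (fun s a s' => g s a s' + h s' - ρ) n
    · exact integrable_state P h _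

theorem le_integral_transSum {π : Policy 𝒜} {adm : Fin m → Fin k → Prop} (hπ : Plays π adm)
    (s : Fin m) (h : Fin m → ℝ) (ρ : ℝ) (g : Fin m → Fin k → Fin m → ℝ)
    (hg : ∀ s a, adm s a → ρ + h s ≤ ∑ s', E.w s a s' * (g s a s' + h s')) (n : ℕ) :
    n * ρ + h s ≤ ∫ ω, transSum g n ω ∂((E.toSMDP 𝒜).trajLaw π s) +
      ∫ ω, h (ω n).state ∂((E.toSMDP 𝒜).trajLaw π s) := by
  have h1 := E.integral_transSum_le hπ s (fun s => -h s) (-ρ) (fun s a s' => -g s a s')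
    (fun s a ha => by
      have := hg s a ha
      have h2 : ∑ s', E.w s a s' * (-g s a s' + -h s') =
          -∑ s', E.w s a s' * (g s a s' + h s') := by
        rw [← Finset.sum_neg_distrib]
        exact Finset.sum_congr rfl fun _ _ => by ring
      linarith) n
  have h3 : transSum (fun s a s' => -g s a s') n = fun ω => -transSum g n ω := by
    funext ω; simp [transSum]
  rw [h3, integral_neg, integral_neg] at h1
  linarith

theorem ae_sum_reward (π : Policy 𝒜) (s : Fin m) :
    ∀ᵐ ω ∂((E.toSMDP 𝒜).trajLaw π s), ∀ n : ℕ,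
      ∑ i ∈ Finset.Icc 1 n, (ω i).reward = transSum E.rew n ω := by
  filter_upwards [E.ae_obs π s] with ω hω n
  induction n with
  | zero => simp [transSum]
  | succ n ih =>
    rw [← Finset.insert_Icc_right_eq_Icc_add_one (by omega), Finset.sum_insert (by simp), ih,
      transSum_succ, add_comm]
    congr 1
    nth_rw 1 [hω n]; rfl

theorem ae_sum_time (π : Policy 𝒜) (s : Fin m) :
    ∀ᵐ ω ∂((E.toSMDP 𝒜).trajLaw π s), ∀ n : ℕ,
      ∑ i ∈ Finset.Icc 1 n, (ω i).time = n * E.T := by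
  filter_upwards [E.ae_time π s] with ω hω n
  rw [Finset.sum_congr rfl (g := fun _ => E.T)]
  · simp
  · intro i hi
    obtain ⟨j, rfl⟩ : ∃ j, i = j + 1 := ⟨i - 1, by have := (Finset.mem_Icc.1 hi).1; omega⟩
    rw [hω]

theorem ae_numSteps (π : Policy 𝒜) (s : Fin m) :
    ∀ᵐ ω ∂((E.toSMDP 𝒜).trajLaw π s), ∀ t, 0 ≤ t → SMDP.numSteps ω t = ⌊t / E.T⌋₊ := by
  filter_upwards [E.ae_sum_time π s] with ω hω t ht
  unfold SMDP.numSteps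
  simp only [hω]
  have : {n : ℕ | (n : ℝ) * E.T ≤ t} = Set.Iic ⌊t / E.T⌋₊ := by
    ext n
    rw [Set.mem_ofPred_eq, Set.mem_Iic, Nat.le_floor_iff (div_nonneg ht E.T_pos.le),
      le_div_iff₀ E.T_pos]
  rw [this, csSup_Iic]

theorem rewardRate_eq (π : Policy 𝒜) (s : Fin m) {t : ℝ} (ht : 0 ≤ t) :
    (E.toSMDP 𝒜).rewardRate π s t =
      (∫ ω, transSum E.rew ⌊t / E.T⌋₊ ω ∂((E.toSMDP 𝒜).trajLaw π s)) / t := by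
  unfold SMDP.rewardRate
  rw [← integral_div]
  refine integral_congr_ae ?_
  filter_upwards [E.ae_numSteps π s, E.ae_sum_reward π s] with ω h1 h2
  rw [h1 t ht, h2]

theorem tendsto_rate (ρ C : ℝ) :
    Tendsto (fun t : ℝ => ((⌊t / E.T⌋₊ : ℝ) * ρ + C) / t) atTop (nhds (ρ / E.T)) := by
  have h1 : Tendsto (fun t : ℝ => (⌊E.T⁻¹ * t⌋₊ : ℝ) / t) atTop (nhds E.T⁻¹) :=
    tendsto_nat_floor_mul_div_atTop (inv_nonneg.2 E.T_pos.le)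
  have h2 : Tendsto (fun t : ℝ => C / t) atTop (nhds 0) := tendsto_const_nhds.div_atTop tendsto_id
  have h3 := (h1.mul_const ρ).add h2
  rw [add_zero, show E.T⁻¹ * ρ = ρ / E.T by rw [div_eq_mul_inv, mul_comm]] at h3
  refine h3.congr fun t => ?_
  rw [show E.T⁻¹ * t = t / E.T by rw [div_eq_mul_inv, mul_comm]]
  ring

/-- A solution of the optimality equation, attained by a stationary policy, gives the optimal
gain. -/
theorem isOptimalGain (h : Fin m → ℝ) (ρ : ℝ) (d : StationaryPolicy 𝒜)
    (hle : ∀ s a, ∑ s', E.w s a s' * (E.rew s a s' + h s') ≤ ρ + h s)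
    (hd : ∀ s, ρ + h s ≤ ∑ s', E.w s (d.1 s) s' * (E.rew s (d.1 s) s' + h s')) :
    (E.toSMDP 𝒜).IsOptimalGain (ρ / E.T) := by
  obtain ⟨B, hB⟩ : ∃ B, ∀ s, |h s| ≤ B := ⟨∑ s, |h s|, fun s =>
    Finset.single_le_sum (f := fun s => |h s|) (fun s _ => abs_nonneg _) (Finset.mem_univ s)⟩
  have hbd : ∀ (π : Policy 𝒜) (s : Fin m) (n : ℕ),
      |∫ ω, h (ω n).state ∂((E.toSMDP 𝒜).trajLaw π s)| ≤ B := fun π s n => by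
    have := norm_integral_le_of_norm_le_const (μ := (E.toSMDP 𝒜).trajLaw π s)
      (f := fun ω : ℕ → Obs m k => h (ω n).state) (ae_of_all _ fun ω => hB (ω n).state)
    simpa using this
  have hup : ∀ (π : Policy 𝒜) (s : Fin m), ∀ᶠ t : ℝ in atTop,
      (E.toSMDP 𝒜).rewardRate π s t ≤ ((⌊t / E.T⌋₊ : ℝ) * ρ + 2 * B) / t := fun π s => by
    filter_upwards [eventually_gt_atTop 0] with t ht
    rw [E.rewardRate_eq π s ht.le]
    gcongr
    have h1 := E.integral_transSum_le (plays_true π) s h ρ E.rew (fun s a _ => hle s a) ⌊t / E.T⌋₊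
    have h2 := abs_le.1 (hbd π s ⌊t / E.T⌋₊)
    have h3 := abs_le.1 (hB s)
    linarith
  have hlo : ∀ s : Fin m, ∀ᶠ t : ℝ in atTop,
      ((⌊t / E.T⌋₊ : ℝ) * ρ + -(2 * B)) / t ≤ (E.toSMDP 𝒜).rewardRate d.toPolicy s t := fun s => by
    filter_upwards [eventually_gt_atTop 0] with t ht
    rw [E.rewardRate_eq _ s ht.le]
    gcongr
    have h1 := E.le_integral_transSum (plays_toPolicy d) s h ρ E.rew
      (fun s a ha => by rw [ha]; exact hd s) ⌊t / E.T⌋₊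
    have h2 := abs_le.1 (hbd d.toPolicy s ⌊t / E.T⌋₊)
    have h3 := abs_le.1 (hB s)
    linarith
  have hlim : ∀ s : Fin m, Tendsto (fun t : ℝ =>
      (((E.toSMDP 𝒜).rewardRate d.toPolicy s t : ℝ) : EReal)) atTop (nhds ((ρ / E.T : ℝ) : EReal)) :=
    fun s => (continuous_coe_real_ereal.tendsto _).comp
      (tendsto_of_tendsto_of_tendsto_of_le_of_le' (E.tendsto_rate ρ _) (E.tendsto_rate ρ _)
        (hlo s) (hup d.toPolicy s))
  refine ⟨⟨d, fun s => ⟨(hlim s).liminf_eq, (hlim s).limsup_eq⟩⟩, fun π s => ?_⟩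
  have h1 : Tendsto (fun t : ℝ => ((((⌊t / E.T⌋₊ : ℝ) * ρ + 2 * B) / t : ℝ) : EReal)) atTop
      (nhds ((ρ / E.T : ℝ) : EReal)) :=
    (continuous_coe_real_ereal.tendsto _).comp (E.tendsto_rate ρ _)
  rw [← h1.limsup_eq]
  refine limsup_le_limsup ?_
  filter_upwards [hup π s] with t ht
  exact_mod_cast ht

theorem expectedRegret_eq (π : Policy 𝒜) (s : Fin m) (ρ : ℝ) (n : ℕ) :
    (E.toSMDP 𝒜).expectedRegret (ρ / E.T) π s n =
      n * ρ - ∫ ω, transSum E.rew n ω ∂((E.toSMDP 𝒜).trajLaw π s) := by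
  unfold SMDP.expectedRegret SMDP.regret
  have hT := E.T_pos.ne'
  rw [integral_congr_ae (g := fun ω => (n : ℝ) * ρ - transSum E.rew n ω)]
  · rw [integral_sub (integrable_const _) (integrable_transSum _ _ _)]
    simp
  · filter_upwards [E.ae_sum_reward π s, E.ae_sum_time π s] with ω h1 h2
    rw [h1, h2]
    field_simp

/-- The regret is at least the expected sum of the gaps of the actions, up to the span of the
bias. -/
theorem le_expectedRegret (π : Policy 𝒜) (s : Fin m) (h : Fin m → ℝ) (ρ : ℝ)
    (c : Fin m → Fin k → Fin m → ℝ) (H : ℝ) (h0 : ∀ s, 0 ≤ h s) (hH : ∀ s, h s ≤ H)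
    (hle : ∀ s a, ∑ s', E.w s a s' * (E.rew s a s' + c s a s' + h s') ≤ ρ + h s) (n : ℕ) :
    ∫ ω, transSum c n ω ∂((E.toSMDP 𝒜).trajLaw π s) - H ≤
      (E.toSMDP 𝒜).expectedRegret (ρ / E.T) π s n := by
  rw [expectedRegret_eq]
  have h1 := E.integral_transSum_le (plays_true π) s h ρ (fun s a s' => E.rew s a s' + c s a s')
    (fun s a _ => hle s a) n
  have h2 : transSum (fun s a s' => E.rew s a s' + c s a s') n =
      fun ω => transSum E.rew n ω + transSum c n ω := by
    funext ω; simp [transSum, Finset.sum_add_distrib]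
  rw [h2, integral_add (integrable_transSum _ _ _) (integrable_transSum _ _ _)] at h1
  have h3 : 0 ≤ ∫ ω, h (ω n).state ∂((E.toSMDP 𝒜).trajLaw π s) := integral_nonneg fun ω => h0 _
  linarith [hH s]

end reward

end FiniteMDP

/-! ### The family of processes with hidden arms. -/

/-- All actions are available in every state. -/
def ActionSets.full (m k : ℕ) (hk : 0 < k) : ActionSets m k where
  acts _ := Finset.univ
  nonempty _ := ⟨⟨0, hk⟩, Finset.mem_univ _⟩

/-- A stationary policy when all actions are available. -/
def StationaryPolicy.ofFun {m k : ℕ} (hk : 0 < k) (d : Fin m → Fin k) :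
    StationaryPolicy (ActionSets.full m k hk) := ⟨d, fun _ => Finset.mem_univ _⟩

/-- Parameters of a family of decision processes with a hidden good arm in each of `N` contexts.
Besides the contexts there is a state `good`, entered upon a success of an arm, and a state `far`,
which is hard to reach. In a context the actions below `K` are arms, the last action is the exit,
and the other actions lead to other contexts. -/
structure HiddenArms where
  /-- number of contexts -/
  N : ℕ
  /-- number of arms -/
  K : ℕ
  /-- number of actions -/
  A : ℕ
  /-- exit probability -/
  q : ℝ
  /-- probability of leaving `good` -/
  η : ℝ
  /-- success probability of an arm -/
  δ : ℝ
  /-- additional success probability of the hidden arms -/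
  ε : ℝ
  /-- reward of a success -/
  R₁ : ℝ
  /-- reward of a step in `good` -/
  R₂ : ℝ
  /-- reward of a step in `far` -/
  R₃ : ℝ
  /-- duration of a step -/
  T : ℝ
  N_pos : 0 < N
  K_pos : 0 < K
  K_le : K + 2 ≤ A
  q_pos : 0 < q
  q_le : 2 * q ≤ 1
  η_pos : 0 < η
  η_le : η ≤ 1
  δ_pos : 0 < δ
  ε_pos : 0 < ε
  δε_le : δ + ε ≤ 1
  T_pos : 0 < T

namespace HiddenArms

section states

variable {N : ℕ} {α : Type*}

/-- the state of a context -/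
def ctx (j : Fin N) : Fin (N + 2) := j.castSucc.castSucc
/-- the state entered upon success -/
def good : Fin (N + 2) := (Fin.last N).castSucc
/-- the state that is hard to reach -/
def far : Fin (N + 2) := Fin.last (N + 1)

/-- A function on the states, given by its values on contexts, `good` and `far`. -/
def pick (x : Fin N → α) (g z : α) (s : Fin (N + 2)) : α :=
  Fin.lastCases (motive := fun _ => α) z (Fin.lastCases (motive := fun _ => α) g x) s

@[simp] theorem pick_ctx (x : Fin N → α) (g z : α) (j : Fin N) : pick x g z (ctx j) = x j := by
  simp [pick, ctx]
@[simp] theorem pick_good (x : Fin N → α) (g z : α) : pick x g z good = g := by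
  simp [pick, good]
@[simp] theorem pick_far (x : Fin N → α) (g z : α) : pick x g z far = z := by
  simp [pick, far]

theorem state_cases {p : Fin (N + 2) → Prop} (hx : ∀ j, p (ctx j)) (hg : p good) (hz : p far) :
    ∀ s, p s := fun s => by
  refine Fin.lastCases hz (fun s => ?_) s
  exact Fin.lastCases hg hx s

theorem eq_ctx_or (s : Fin (N + 2)) : (∃ j, s = ctx j) ∨ s = good ∨ s = far := by
  revert s
  exact state_cases (fun j => Or.inl ⟨j, rfl⟩) (by simp) (by simp)

theorem sum_states [AddCommMonoid α] (f : Fin (N + 2) → α) :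
    ∑ s, f s = ∑ j, f (ctx j) + f good + f far := by
  rw [Fin.sum_univ_castSucc, Fin.sum_univ_castSucc]; rfl

@[simp] theorem ctx_inj {i j : Fin N} : ctx i = ctx j ↔ i = j := by simp [ctx]
@[simp] theorem ctx_ne_good (i : Fin N) : ctx i ≠ good := by
  simp [ctx, good]
@[simp] theorem ctx_ne_far (i : Fin N) : ctx i ≠ far := Fin.castSucc_ne_last _
@[simp] theorem good_ne_far : (good : Fin (N + 2)) ≠ far := Fin.castSucc_ne_last _
@[simp] theorem good_ne_ctx (i : Fin N) : good ≠ ctx i := (ctx_ne_good i).symm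
@[simp] theorem far_ne_ctx (i : Fin N) : far ≠ ctx i := (ctx_ne_far i).symm
@[simp] theorem far_ne_good : (far : Fin (N + 2)) ≠ good := good_ne_far.symm

end states

variable (B : HiddenArms)

/-- The number of actions that lead to other contexts. -/
def b : ℕ := B.A - 1 - B.K

theorem A_pos : 0 < B.A := by have := B.K_le; omega

/-- The context reached by an action that is neither an arm nor the exit. -/
def dest (j : Fin B.N) (a : ℕ) : Fin B.N := ⟨(B.b * j + (a - B.K)) % B.N, Nat.mod_lt _ B.N_pos⟩

/-- The success probability of an arm. -/
def armProb (θ : Fin B.N → ℕ) (j : Fin B.N) (a : ℕ) : ℝ := if a = θ j then B.δ + B.ε else B.δ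

theorem armProb_pos (θ : Fin B.N → ℕ) (j : Fin B.N) (a : ℕ) : 0 < B.armProb θ j a := by
  have := B.δ_pos; have := B.ε_pos
  unfold armProb; split_ifs <;> linarith

theorem armProb_le (θ : Fin B.N → ℕ) (j : Fin B.N) (a : ℕ) : B.armProb θ j a ≤ B.δ + B.ε := by
  have := B.ε_pos
  unfold armProb; split_ifs <;> linarith

/-- transition probabilities when `θ` lists the hidden arms -/
def w (θ : Fin B.N → ℕ) (s : Fin (B.N + 2)) (a : Fin B.A) (s' : Fin (B.N + 2)) : ℝ :=
  pick (fun j =>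
      if a.1 < B.K then pick (fun _ => (1 - B.armProb θ j a) / B.N) (B.armProb θ j a) 0 s'
      else if a.1 + 1 = B.A then pick (fun i => if i = j then 1 - 2 * B.q else 0) B.q B.q s'
      else pick (fun i => if i = B.dest j a then 1 else 0) 0 0 s')
    (pick (fun _ => B.η / B.N) (1 - B.η) 0 s') (pick (fun _ => 1 / B.N) 0 0 s') s

/-- rewards of the transitions -/
def rew (s : Fin (B.N + 2)) (a : Fin B.A) (s' : Fin (B.N + 2)) : ℝ :=
  pick (fun _ => if a.1 < B.K then pick (fun _ => 0) B.R₁ 0 s' else 0) B.R₂ B.R₃ s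

/-- the average over the contexts -/
def avg (f : Fin (B.N + 2) → ℝ) : ℝ := (∑ j : Fin B.N, f (ctx j)) / B.N

theorem N_pos' : (0 : ℝ) < B.N := Nat.cast_pos.2 B.N_pos

theorem avg_const {f : Fin (B.N + 2) → ℝ} {c : ℝ} (hf : ∀ j : Fin B.N, f (ctx j) = c) : B.avg f = c := by
  have := B.N_pos'
  simp only [avg, hf, Finset.sum_const, Finset.card_univ, Fintype.card_fin, nsmul_eq_mul]
  field_simp

theorem avg_le {f : Fin (B.N + 2) → ℝ} {c : ℝ} (hf : ∀ j : Fin B.N, f (ctx j) ≤ c) :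
    B.avg f ≤ c := by
  have := B.N_pos'
  rw [avg, div_le_iff₀ this]
  calc _ ≤ ∑ _j : Fin B.N, c := Finset.sum_le_sum fun j _ => hf j
    _ = _ := by simp [mul_comm]

variable {B} in
theorem sum_w_arm (θ : Fin B.N → ℕ) (j : Fin B.N) {a : Fin B.A} (ha : a.1 < B.K)
    (f : Fin (B.N + 2) → ℝ) : ∑ s', B.w θ (ctx j) a s' * f s' =
      (1 - B.armProb θ j a) * B.avg f + B.armProb θ j a * f good := by
  rw [sum_states]
  simp only [w, pick_ctx, ha, if_true, pick_good, pick_far, ← Finset.mul_sum, avg]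
  ring

variable {B} in
theorem sum_w_exit (θ : Fin B.N → ℕ) (j : Fin B.N) {a : Fin B.A} (ha : a.1 + 1 = B.A)
    (f : Fin (B.N + 2) → ℝ) : ∑ s', B.w θ (ctx j) a s' * f s' =
      (1 - 2 * B.q) * f (ctx j) + B.q * f good + B.q * f far := by
  have h : ¬ a.1 < B.K := by have := B.K_le; omega
  rw [sum_states]
  simp [w, h, ha, ite_mul]

variable {B} in
theorem sum_w_nav (θ : Fin B.N → ℕ) (j : Fin B.N) {a : Fin B.A} (h : ¬ a.1 < B.K)
    (h2 : a.1 + 1 ≠ B.A) (f : Fin (B.N + 2) → ℝ) :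
    ∑ s', B.w θ (ctx j) a s' * f s' = f (ctx (B.dest j a)) := by
  rw [sum_states]
  simp [w, h, h2, ite_mul]

theorem sum_w_good (θ : Fin B.N → ℕ) (a : Fin B.A) (f : Fin (B.N + 2) → ℝ) :
    ∑ s', B.w θ good a s' * f s' = B.η * B.avg f + (1 - B.η) * f good := by
  rw [sum_states]
  simp only [w, pick_ctx, pick_good, pick_far, ← Finset.mul_sum, avg]
  ring

theorem sum_w_far (θ : Fin B.N → ℕ) (a : Fin B.A) (f : Fin (B.N + 2) → ℝ) :
    ∑ s', B.w θ far a s' * f s' = B.avg f := by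
  rw [sum_states]
  simp only [w, pick_ctx, pick_good, pick_far, ← Finset.mul_sum, avg]
  ring

/-- The decision process with the hidden arms `θ`. -/
def mdp (θ : Fin B.N → ℕ) : FiniteMDP (B.N + 2) B.A where
  w := B.w θ
  rew := B.rew
  T := B.T
  w_nonneg s a s' := by
    have h1 := B.q_pos; have h2 := B.q_le; have h3 := B.η_pos; have h4 := B.η_le
    have h5 := B.N_pos'
    have h6 := fun j => B.armProb_pos θ j a
    have h7 := fun j => (B.armProb_le θ j a).trans B.δε_le
    have hx : ∀ j, 0 ≤ (1 - B.armProb θ j a) / B.N := fun j =>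
      div_nonneg (by linarith [h7 j]) h5.le
    revert s
    refine state_cases (fun j => ?_) ?_ ?_
    · simp only [w, pick_ctx]
      split_ifs
      · revert s'
        refine state_cases (fun i => ?_) ?_ ?_ <;> simp [hx, (h6 j).le]
      · revert s'
        refine state_cases (fun i => ?_) ?_ ?_ <;> simp [h1.le]
        split_ifs <;> linarith
      · revert s'
        refine state_cases (fun i => ?_) ?_ ?_ <;> simp
        split_ifs <;> simp
    · simp only [w, pick_good]
      revert s'
      refine state_cases (fun i => ?_) ?_ ?_ <;> simp [h4]
      positivity
    · simp only [w, pick_far]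
      revert s'
      refine state_cases (fun i => ?_) ?_ ?_ <;> simp
  w_sum s a := by
    have h1 : ∑ s', B.w θ s a s' = ∑ s', B.w θ s a s' * (fun _ => (1 : ℝ)) s' := by simp
    have h2 : B.avg (fun _ => 1) = 1 := B.avg_const fun _ => rfl
    rw [h1]
    revert s
    refine state_cases (fun j _ => ?_) (fun _ => ?_) (fun _ => ?_)
    · by_cases h3 : a.1 < B.K
      · rw [sum_w_arm θ j h3, h2]; ring
      · by_cases h4 : a.1 + 1 = B.A
        · rw [sum_w_exit θ j h4]; ring
        · rw [sum_w_nav θ j h3 h4]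
    · rw [sum_w_good, h2]; ring
    · rw [sum_w_far, h2]
  T_pos := B.T_pos

/-- the exit -/
def exit : Fin B.A := ⟨B.A - 1, by have := B.A_pos; omega⟩

theorem exit_succ : B.exit.1 + 1 = B.A := by have := B.A_pos; simp only [exit]; omega

/-! ### Navigation between contexts and the diameter. -/

section navigation

/-- Context `j` can be reached from context `i` in `k` steps. -/
def Reach (k : ℕ) (i j : Fin B.N) : Prop := ∃ r < B.b ^ k, (B.b ^ k * i + r) % B.N = j

theorem reach_of_le {k : ℕ} (hk : B.N ≤ B.b ^ k) (i j : Fin B.N) : B.Reach k i j := by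
  have hN := B.N_pos
  have h1 := Nat.mod_lt (B.b ^ k * i) hN
  refine ⟨(j + (B.N - (B.b ^ k * i) % B.N)) % B.N, (Nat.mod_lt _ hN).trans_le hk, ?_⟩
  rw [Nat.add_mod, Nat.mod_mod, Nat.add_mod_mod,
    show (B.b ^ k * i) % B.N + (j + (B.N - (B.b ^ k * i) % B.N)) = j + B.N by omega,
    Nat.add_mod_right, Nat.mod_eq_of_lt j.2]

/-- A navigating action is a digit in base `b`, appended to the number of the current context and
reduced modulo `N`. The first action to take is the leading digit of `r`, leaving the remainder of
`r` for the other `k` steps. -/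
theorem exists_nav_of_reach_succ {k : ℕ} {i j : Fin B.N} (h : B.Reach (k + 1) i j) :
    ∃ a : Fin B.A, ¬ a.1 < B.K ∧ a.1 + 1 ≠ B.A ∧ B.Reach k (B.dest i a) j := by
  obtain ⟨r, hr, hj⟩ := h
  have hb : 0 < B.b := by have := B.K_le; unfold b; omega
  have hbk : 0 < B.b ^ k := pow_pos hb k
  have h1 : r / B.b ^ k < B.b := by
    rw [Nat.div_lt_iff_lt_mul hbk]; rw [pow_succ'] at hr; exact hr
  have h2 : B.K + r / B.b ^ k + 1 < B.A := by
    have := B.K_le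
    unfold b at h1 ⊢; omega
  refine ⟨⟨B.K + r / B.b ^ k, by omega⟩, by simp, h2.ne, r % B.b ^ k, Nat.mod_lt _ hbk, ?_⟩
  simp only [dest, Nat.add_sub_cancel_left]
  rw [← hj, ← Nat.mod_add_mod, Nat.mul_mod_mod, Nat.mod_add_mod]
  congr 1
  have := Nat.div_add_mod r (B.b ^ k)
  calc _ = B.b ^ (k + 1) * i + (B.b ^ k * (r / B.b ^ k) + r % B.b ^ k) := by ring
    _ = _ := by rw [this]

/-- The number of steps needed to get from one context to another. -/
def dist (i j : Fin B.N) : ℕ := sInf {k | B.Reach k i j}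

theorem dist_self (j : Fin B.N) : B.dist j j = 0 :=
  Nat.sInf_eq_zero.2 (Or.inl ⟨0, by simp, by simp [Nat.mod_eq_of_lt j.2]⟩)

theorem dist_le {k : ℕ} (hk : B.N ≤ B.b ^ k) (i j : Fin B.N) : B.dist i j ≤ k :=
  Nat.sInf_le (B.reach_of_le hk i j)

theorem exists_nav {k : ℕ} (hk : B.N ≤ B.b ^ k) {i j : Fin B.N} (hij : i ≠ j) :
    ∃ a : Fin B.A, ¬ a.1 < B.K ∧ a.1 + 1 ≠ B.A ∧ B.dist (B.dest i a) j + 1 ≤ B.dist i j := by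
  have h1 : B.Reach (B.dist i j) i j :=
    Nat.sInf_mem (s := {k | B.Reach k i j}) ⟨k, B.reach_of_le hk i j⟩
  cases h : B.dist i j with
  | zero =>
    rw [h] at h1
    obtain ⟨r, hr, h2⟩ := h1
    have hr0 : r = 0 := by simpa using hr
    subst hr0
    exact absurd (Fin.ext (by simpa [Nat.mod_eq_of_lt i.2] using h2)) hij
  | succ n =>
    rw [h] at h1
    obtain ⟨a, ha1, ha2, ha3⟩ := B.exists_nav_of_reach_succ h1
    exact ⟨a, ha1, ha2, Nat.succ_le_succ (Nat.sInf_le ha3)⟩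

end navigation

/-- The extremal pair is `good`, `far`. Always taking the exit, the expected numbers `c` and `g` of
steps to `far` from a context and from `good` satisfy `2 * q * c = 1 + q * g` and `g = c + 1 / η`.
Other targets are no harder: `good` is reached by the exit and contexts by navigation. -/
theorem diameter_eq (θ : Fin B.N → ℕ) {k : ℕ} (hk : B.N ≤ B.b ^ k)
    (hkD : (k : ℝ) ≤ 1 / B.q + 1 / B.η) :
    ((B.mdp θ).toSMDP (ActionSets.full (B.N + 2) B.A B.A_pos)).diameter =
      ENNReal.ofReal (B.T * (1 / B.q + 2 / B.η)) := by
  have hq := B.q_pos; have hη := B.η_pos; have hη1 := B.η_le; have hT := B.T_pos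
  have hq2 := B.q_le
  have h1η : 1 ≤ 1 / B.η := by rw [le_div_iff₀ hη]; linarith
  have h2η : 2 / B.η = 1 / B.η + 1 / B.η := by ring
  have hexit := B.exit_succ
  apply le_antisymm
  · refine iSup_le fun s => iSup_le fun y => ?_
    suffices h : ∃ d : Fin (B.N + 2) → Fin B.A, ∃ V : Fin (B.N + 2) → ℝ, (∀ s, 0 ≤ V s) ∧ V y = 0 ∧
        (∀ s, s ≠ y → B.T + ∑ s', B.w θ s (d s) s' * V s' ≤ V s) ∧
        ∀ s, V s ≤ B.T * (1 / B.q + 2 / B.η) by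
      obtain ⟨d, V, h0, hy, hV, hD⟩ := h
      refine (iInf_le _ (StationaryPolicy.ofFun B.A_pos d)).trans ?_
      refine ((B.mdp θ).lintegral_hittingTime_le (FiniteMDP.plays_toPolicy _) s y V h0 hy
        (fun s a hs ha => ?_)).trans (ENNReal.ofReal_le_ofReal (hD s))
      rw [ha]
      exact hV s hs
    clear s
    have hconst : ∀ g z c : ℝ, B.avg (pick (fun _ => c) g z) = c := fun g z c =>
      B.avg_const fun j => by simp
    revert y
    refine state_cases (fun j => ?_) ?_ ?_
    · have hnav : ∀ i : Fin B.N, ∃ a : Fin B.A, i ≠ j → ¬ a.1 < B.K ∧ a.1 + 1 ≠ B.A ∧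
          B.dist (B.dest i a) j + 1 ≤ B.dist i j := fun i => by
        by_cases hij : i = j
        · exact ⟨B.exit, fun h => absurd hij h⟩
        · obtain ⟨a, ha⟩ := B.exists_nav hk hij
          exact ⟨a, fun _ => ha⟩
      choose d hd using hnav
      have hdk : ∀ i, (B.dist i j : ℝ) ≤ k := fun i => by exact_mod_cast B.dist_le hk i j
      -- Leaving `good` takes `1 / η` steps on average and leaving `far` one step; from the random
      -- context then reached, at most `k` navigating steps remain.
      refine ⟨pick d B.exit B.exit, pick (fun i => B.T * B.dist i j) (B.T * (1 / B.η + k))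
        (B.T * (1 + k)), ?_, by simp [dist_self], ?_, ?_⟩
      · refine state_cases (fun i => ?_) ?_ ?_
        · simp only [pick_ctx]; positivity
        · simp only [pick_good]; positivity
        · simp only [pick_far]; positivity
      · have havg : B.avg (pick (fun i => B.T * B.dist i j) (B.T * (1 / B.η + k))
          (B.T * (1 + k))) ≤ B.T * k := B.avg_le fun i => by
            simp only [pick_ctx]; exact mul_le_mul_of_nonneg_left (hdk i) hT.le
        refine state_cases (fun i hi => ?_) (fun _ => ?_) (fun _ => ?_)
        · obtain ⟨h1, h2, h3⟩ := hd i (fun h => hi (by rw [h]))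
          simp only [pick_ctx]
          rw [sum_w_nav θ i h1 h2, pick_ctx]
          have : ((B.dist (B.dest i (d i)) j : ℝ) + 1) ≤ B.dist i j := by exact_mod_cast h3
          nlinarith
        · rw [sum_w_good]
          simp only [pick_good]
          have : B.η * (B.T * (1 / B.η + k)) = B.T + B.η * (B.T * k) := by field_simp
          nlinarith
        · rw [sum_w_far]
          simp only [pick_far]
          nlinarith
      · refine state_cases (fun i => ?_) ?_ ?_
        · simp only [pick_ctx]
          have := hdk i
          gcongr; linarith
        · simp only [pick_good]; exact mul_le_mul_of_nonneg_left (by linarith) hT.le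
        · simp only [pick_far]; exact mul_le_mul_of_nonneg_left (by linarith) hT.le
    · refine ⟨fun _ => B.exit, pick (fun _ => B.T * (1 / B.q + 1)) 0 (B.T * (1 / B.q + 2)),
        ?_, by simp, ?_, ?_⟩
      · refine state_cases (fun i => ?_) ?_ ?_
        · simp only [pick_ctx]; positivity
        · simp
        · simp only [pick_far]; positivity
      · refine state_cases (fun i _ => ?_) (fun h => absurd rfl h) (fun _ => ?_)
        · rw [sum_w_exit θ i hexit]
          simp only [pick_ctx, pick_good, pick_far]
          apply le_of_eq
          field_simp
          ring
        · rw [sum_w_far, hconst]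
          simp only [pick_far]
          linarith
      · refine state_cases (fun i => ?_) ?_ ?_
        · simp only [pick_ctx]; gcongr; linarith
        · simp only [pick_good]; positivity
        · simp only [pick_far]; gcongr; linarith
    · refine ⟨fun _ => B.exit, pick (fun _ => B.T * (1 / B.q + 1 / B.η))
        (B.T * (1 / B.q + 2 / B.η)) 0, ?_, by simp, ?_, ?_⟩
      · refine state_cases (fun i => ?_) ?_ ?_
        · simp only [pick_ctx]; positivity
        · simp only [pick_good]; positivity
        · simp
      · refine state_cases (fun i _ => ?_) (fun _ => ?_) (fun h => absurd rfl h)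
        · rw [sum_w_exit θ i hexit]
          simp only [pick_ctx, pick_good, pick_far]
          apply le_of_eq
          field_simp
          ring
        · rw [sum_w_good, hconst]
          simp only [pick_good]
          apply le_of_eq
          field_simp
          ring
      · refine state_cases (fun i => ?_) ?_ ?_
        · simp only [pick_ctx]; gcongr; linarith
        · simp only [pick_good]; exact le_rfl
        · simp only [pick_far]; positivity
  · refine le_trans ?_ (le_iSup₂ (f := fun s s' : Fin (B.N + 2) =>
      ⨅ d : StationaryPolicy (ActionSets.full (B.N + 2) B.A B.A_pos),
        ∫⁻ ω, SMDP.hittingTime s' ω ∂(((B.mdp θ).toSMDP _).trajLaw d.toPolicy s)) good far)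
    refine le_iInf fun d => ?_
    have hconst : ∀ g z c : ℝ, B.avg (pick (fun _ => c) g z) = c := fun g z c =>
      B.avg_const fun j => by simp
    -- The exact solution for the exit is a subsolution for every action: an arm leads to contexts,
    -- or to `good` where the value is larger, and navigation does not change the value.
    have := (B.mdp θ).le_lintegral_hittingTime (FiniteMDP.plays_true d.toPolicy) good far
      good_ne_far (pick (fun _ => B.T * (1 / B.q + 1 / B.η)) (B.T * (1 / B.q + 2 / B.η)) 0)
      (by
        refine state_cases (fun i => ?_) ?_ ?_
        · simp only [pick_ctx]; positivity
        · simp only [pick_good]; positivity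
        · simp) (by simp) (by
        refine state_cases (fun i a _ _ => ?_) (fun a _ _ => ?_) (fun a h => absurd rfl h)
        · change _ ≤ B.T + ∑ s', B.w θ (ctx i) a s' * _
          by_cases h1 : a.1 < B.K
          · rw [sum_w_arm θ i h1, hconst]
            simp only [pick_ctx, pick_good]
            have h2 := (B.armProb_pos θ i a).le
            have : 0 ≤ B.armProb θ i a * (B.T * (1 / B.η)) := by positivity
            rw [h2η]
            linarith
          · by_cases h2 : a.1 + 1 = B.A
            · rw [sum_w_exit θ i h2]
              simp only [pick_ctx, pick_good, pick_far]
              apply le_of_eq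
              field_simp
              ring
            · rw [sum_w_nav θ i h1 h2]
              simp only [pick_ctx]
              linarith
        · change _ ≤ B.T + ∑ s', B.w θ good a s' * _
          rw [sum_w_good, hconst]
          simp only [pick_good]
          apply le_of_eq
          field_simp
          ring)
    simpa using this

end HiddenArms

/-! ### Optimal gain, and regret in terms of wrong actions. -/

namespace HiddenArms

variable (B : HiddenArms)

/-- an arm as an action -/
def arm (a : Fin B.K) : Fin B.A := Fin.castLE (by have := B.K_le; omega) a

@[simp] theorem arm_val (a : Fin B.K) : (B.arm a).1 = a.1 := rfl

theorem arm_inj {a a' : Fin B.K} : B.arm a = B.arm a' ↔ a = a' := by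
  rw [Fin.ext_iff, Fin.ext_iff]; rfl

/-- An action is wrong in a context if it is not the hidden arm. -/
def wrong (θ : Fin B.N → ℕ) (s : Fin (B.N + 2)) (a : Fin B.A) : ℕ :=
  pick (fun j => if a.1 = θ j then 0 else 1) 0 0 s

section optimality

variable {B} {H : ℝ} (hR₁ : 0 ≤ B.R₁) (hH : 0 ≤ H) (hqH : B.q * H ≤ B.δ * (B.R₁ + H))
  (hR₂ : B.R₂ = (B.δ + B.ε) * (B.R₁ + H) + B.η * H) (hR₃ : B.R₃ = (B.δ + B.ε) * (B.R₁ + H))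

include hR₁ hH hqH hR₂ hR₃

/-- An arm earns its success probability times `R₁ + H`, so missing the hidden one costs exactly `ε
* (R₁ + H)`. The exit earns only `q * H`, which `hqH` keeps below the value of an ordinary arm, and
navigation earns nothing. `R₂` and `R₃` make the equation exact in `good` and `far`. -/
theorem optimality_le (θ : Fin B.N → ℕ) (s : Fin (B.N + 2)) (a : Fin B.A) :
    ∑ s', B.w θ s a s' * (B.rew s a s' + B.ε * (B.R₁ + H) * B.wrong θ s a +
        pick (fun _ => 0) H 0 s') ≤
      (B.δ + B.ε) * (B.R₁ + H) + pick (fun _ => 0) H 0 s := by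
  have hε := B.ε_pos; have hδ := B.δ_pos; have hq := B.q_pos
  have hG : 0 ≤ B.R₁ + H := by linarith
  have hεG := mul_nonneg hε.le hG
  have hδG := mul_nonneg hδ.le hG
  revert s
  refine state_cases (fun j => ?_) ?_ ?_
  · by_cases h1 : a.1 < B.K
    · rw [sum_w_arm θ j h1, avg_const _ (c := B.ε * (B.R₁ + H) * B.wrong θ (ctx j) a)]
      · simp only [rew, pick_ctx, h1, if_true, pick_good, wrong, armProb]
        split_ifs <;> push_cast <;> linarith
      · intro i; simp [rew, h1]
    · have hw : (B.wrong θ (ctx j) a : ℝ) ≤ 1 := by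
        simp only [wrong, pick_ctx]; split_ifs <;> simp
      have hw' : B.ε * (B.R₁ + H) * B.wrong θ (ctx j) a ≤ B.ε * (B.R₁ + H) := by
        nlinarith
      by_cases h2 : a.1 + 1 = B.A
      · rw [sum_w_exit θ j h2]
        simp only [rew, pick_ctx, h1, if_false, pick_good, pick_far]
        linarith
      · rw [sum_w_nav θ j h1 h2]
        simp only [rew, pick_ctx, h1, if_false]
        linarith
  · rw [sum_w_good, avg_const _ (c := B.R₂)]
    · simp [rew, wrong, hR₂]; linarith
    · intro i; simp [rew, wrong]
  · rw [sum_w_far, avg_const _ (c := B.R₃)]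
    · simp [hR₃]
    · intro i; simp [rew, wrong]

theorem isOptimalGain_mdp (θ : Fin B.N → Fin B.K) :
    ((B.mdp fun j => θ j).toSMDP (ActionSets.full (B.N + 2) B.A B.A_pos)).IsOptimalGain
      ((B.δ + B.ε) * (B.R₁ + H) / B.T) := by
  have hε := B.ε_pos
  have hG : 0 ≤ B.R₁ + H := by linarith
  refine (B.mdp fun j => θ j).isOptimalGain (pick (fun _ => 0) H 0) _
    (StationaryPolicy.ofFun B.A_pos (pick (fun j => B.arm (θ j)) B.exit B.exit))
    (fun s a => ?_) ?_
  · refine le_trans (Finset.sum_le_sum fun s' _ => ?_)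
      (optimality_le hR₁ hH hqH hR₂ hR₃ (fun j => θ j) s a)
    refine mul_le_mul_of_nonneg_left ?_ ((B.mdp fun j => θ j).w_nonneg s a s')
    have : 0 ≤ B.ε * (B.R₁ + H) * B.wrong (fun j => θ j) s a := by positivity
    change B.rew s a s' + _ ≤ _
    linarith
  · refine state_cases (fun j => ?_) ?_ ?_
    · change _ ≤ ∑ s', B.w _ (ctx j) (pick (fun j => B.arm (θ j)) B.exit B.exit (ctx j)) s' *
        (B.rew (ctx j) (pick (fun j => B.arm (θ j)) B.exit B.exit (ctx j)) s' + _)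
      rw [pick_ctx, pick_ctx, sum_w_arm _ j (θ j).2, avg_const _ (c := 0)]
      · simp [rew, armProb]
      · intro i; simp [rew]
    · change _ ≤ ∑ s', B.w _ good (pick (fun j => B.arm (θ j)) B.exit B.exit good) s' *
        (B.rew good (pick (fun j => B.arm (θ j)) B.exit B.exit good) s' + _)
      rw [sum_w_good, avg_const _ (c := B.R₂)]
      · simp [rew, hR₂]; linarith
      · intro i; simp [rew]
    · change _ ≤ ∑ s', B.w _ far (pick (fun j => B.arm (θ j)) B.exit B.exit far) s' *
        (B.rew far (pick (fun j => B.arm (θ j)) B.exit B.exit far) s' + _)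
      rw [sum_w_far, avg_const _ (c := B.R₃)]
      · simp [hR₃]
      · intro i; simp [rew]

theorem le_expectedRegret_mdp (θ : Fin B.N → ℕ) {𝒜 : ActionSets (B.N + 2) B.A} (π : Policy 𝒜)
    (s : Fin (B.N + 2)) (n : ℕ) :
    B.ε * (B.R₁ + H) * ∫ ω, FiniteMDP.transSum (fun s a _ => (B.wrong θ s a : ℝ)) n ω
        ∂(((B.mdp θ).toSMDP 𝒜).trajLaw π s) - H ≤
      ((B.mdp θ).toSMDP 𝒜).expectedRegret ((B.δ + B.ε) * (B.R₁ + H) / B.T) π s n := by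
  have h1 := (B.mdp θ).le_expectedRegret π s (pick (fun _ => 0) H 0) ((B.δ + B.ε) * (B.R₁ + H))
    (fun s a _ => B.ε * (B.R₁ + H) * B.wrong θ s a) H
    (state_cases (by simp) (by simpa) (by simp)) (state_cases (fun _ => by simpa) (by simp) (by simpa))
    (optimality_le hR₁ hH hqH hR₂ hR₃ θ) n
  rw [← integral_const_mul]
  convert! h1 using 4
  simp [FiniteMDP.transSum, Finset.mul_sum]

end optimality

/-! ### Counts of actions and outcomes. -/

section counts

/-- For every context and action, the numbers of times that the action was taken in the context and
led to `good`, or to another state. -/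
abbrev Counts : Type := Fin B.N → Fin B.A → ℕ × ℕ

/-- Updates the counts of one context. -/
def ctxUpd (x : Fin B.A → ℕ × ℕ) (a : Fin B.A) (succ : Prop) [Decidable succ] :
    Fin B.A → ℕ × ℕ :=
  Function.update x a (if succ then ((x a).1 + 1, (x a).2) else ((x a).1, (x a).2 + 1))

/-- Updates the counts. -/
def upd (v : B.Counts) (s : Fin (B.N + 2)) (a : Fin B.A) (s' : Fin (B.N + 2)) : B.Counts :=
  pick (fun j => Function.update v j (B.ctxUpd (v j) a (s' = good))) v v s

variable {B}

/-- how often an action was taken -/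
def pulls (x : Fin B.A → ℕ × ℕ) (a : Fin B.A) : ℕ := (x a).1 + (x a).2

/-- how often a context was visited -/
def visits (x : Fin B.A → ℕ × ℕ) : ℕ := ∑ a, pulls x a

/-- the number of wrong actions -/
def wrongs (θ : Fin B.N → ℕ) (v : B.Counts) : ℕ :=
  ∑ j, ∑ a : Fin B.A, if a.1 = θ j then 0 else pulls (v j) a

theorem pulls_ctxUpd (x : Fin B.A → ℕ × ℕ) (a a' : Fin B.A) (p : Prop) [Decidable p] :
    pulls (B.ctxUpd x a p) a' = pulls x a' + if a' = a then 1 else 0 := by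
  unfold pulls ctxUpd
  by_cases h : a' = a
  · subst h; simp only [Function.update_self, if_true]; split_ifs <;> simp <;> omega
  · simp [h]

theorem visits_ctxUpd (x : Fin B.A → ℕ × ℕ) (a : Fin B.A) (p : Prop) [Decidable p] :
    visits (B.ctxUpd x a p) = visits x + 1 := by
  simp [visits, pulls_ctxUpd, Finset.sum_add_distrib]

theorem visits_upd (v : B.Counts) (s : Fin (B.N + 2)) (a : Fin B.A) (s' : Fin (B.N + 2))
    (i : Fin B.N) : visits (B.upd v s a s' i) = visits (v i) + if s = ctx i then 1 else 0 := by
  revert s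
  refine state_cases (fun j => ?_) ?_ ?_
  · simp only [upd, pick_ctx, ctx_inj]
    by_cases h : j = i
    · subst h; simp [visits_ctxUpd]
    · simp [Function.update_of_ne (Ne.symm h), h]
  · simp [upd]
  · simp [upd]

theorem wrongs_upd (θ : Fin B.N → ℕ) (v : B.Counts) (s : Fin (B.N + 2)) (a : Fin B.A)
    (s' : Fin (B.N + 2)) : wrongs θ (B.upd v s a s') = wrongs θ v + B.wrong θ s a := by
  revert s
  refine state_cases (fun j => ?_) ?_ ?_
  · simp only [upd, pick_ctx, wrong]
    have h1 : ∀ i, (∑ a' : Fin B.A, if a'.1 = θ i then 0 else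
        pulls (Function.update v j (B.ctxUpd (v j) a (s' = good)) i) a') =
        (∑ a' : Fin B.A, if a'.1 = θ i then 0 else pulls (v i) a') +
          if i = j then (if a.1 = θ j then 0 else 1) else 0 := by
      intro i
      by_cases h : i = j
      · subst h
        simp only [Function.update_self, pulls_ctxUpd, if_true]
        rw [show (if a.1 = θ i then 0 else 1) = ∑ a' : Fin B.A,
          if a' = a then (if a'.1 = θ i then 0 else 1) else 0 by simp, ← Finset.sum_add_distrib]
        refine Finset.sum_congr rfl fun a' _ => ?_
        split_ifs <;> simp
      · simp [h]
    simp only [wrongs, h1, Finset.sum_add_distrib]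
    simp
  · simp [upd, wrong]
  · simp [upd, wrong]

/-- the counts after `n` steps -/
def counts (n : ℕ) (ω : ℕ → Obs (B.N + 2) B.A) : B.Counts := stat B.upd 0 ω n

theorem wrongs_counts (θ : Fin B.N → ℕ) (n : ℕ) (ω : ℕ → Obs (B.N + 2) B.A) :
    (wrongs θ (counts n ω) : ℝ) =
      FiniteMDP.transSum (fun s a _ => (B.wrong θ s a : ℝ)) n ω := by
  induction n with
  | zero => simp [counts, stat, wrongs, pulls, FiniteMDP.transSum]
  | succ n ih =>
    rw [FiniteMDP.transSum_succ, ← ih]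
    change (wrongs θ (B.upd (counts n ω) _ _ _) : ℝ) = _
    rw [wrongs_upd]; push_cast; rfl

end counts

end HiddenArms

/-! ### Few wrong actions force many visits to most contexts. -/

namespace HiddenArms

variable {B : HiddenArms}

instance : DiscreteMeasurableSpace B.Counts := MeasurableSingletonClass.toDiscreteMeasurableSpace

section deficit

variable {N : ℕ}

/-- How many visits are missing until every context has been visited `r` times. -/
def deficit (r : ℕ) (c : Fin N → ℕ) : ℕ := ∑ j, (r - c j)

theorem exp_deficit_add (η : ℝ) (r : ℕ) (c : Fin N → ℕ) (i : Fin N) :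
    Real.exp (η * deficit r fun j => c j + if ctx i = ctx j then 1 else 0) =
      Real.exp (η * deficit r c) * if c i < r then Real.exp (-η) else 1 := by
  have h1 : (deficit r fun j => c j + if ctx i = ctx j then 1 else 0) +
      (if c i < r then 1 else 0) = deficit r c := by
    unfold deficit
    rw [show (if c i < r then 1 else 0) = ∑ j, if i = j then (if c j < r then 1 else 0) else 0 by
      simp, ← Finset.sum_add_distrib]
    refine Finset.sum_congr rfl fun j _ => ?_
    simp only [ctx_inj]
    split_ifs <;> omega
  rw [← h1]
  split_ifs
  · rw [← Real.exp_add]; push_cast; ring_nf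
  · simp

theorem half_le_one_sub_exp_neg {η : ℝ} (h0 : 0 ≤ η) (h1 : η ≤ 1) : η / 2 ≤ 1 - Real.exp (-η) := by
  have h2 : Real.exp (-η) ≤ 1 / (1 + η) := by
    rw [Real.exp_neg, ← one_div]
    exact one_div_le_one_div_of_le (by linarith) (by linarith [Real.add_one_le_exp η])
  have h3 : 1 / (1 + η) ≤ 1 - η / 2 := by
    rw [div_le_iff₀ (by linarith)]; nlinarith
  linarith

/-- A visit to a uniformly distributed context reduces the deficit. -/
theorem avg_exp_deficit_le {η ϑ : ℝ} (h0 : 0 ≤ η) (h1 : η ≤ 1) (r : ℕ) (c : Fin B.N → ℕ)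
    (hϑ : ϑ * B.N ≤ (Finset.univ.filter fun j => c j < r).card) {f : Fin (B.N + 2) → ℝ}
    (hf : ∀ i : Fin B.N, f (ctx i) ≤
      Real.exp (η * deficit r fun j => c j + if ctx i = ctx j then 1 else 0)) :
    B.avg f ≤ Real.exp (η * deficit r c) * (1 - η * ϑ / 2) := by
  have hN := B.N_pos'
  have h2 := half_le_one_sub_exp_neg h0 h1
  rw [avg, div_le_iff₀ hN]
  have hsum : ∑ i : Fin B.N, (if c i < r then Real.exp (-η) else 1) =
      B.N - (1 - Real.exp (-η)) * (Finset.univ.filter fun j => c j < r).card := by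
    rw [← Finset.sum_boole, Finset.mul_sum, ← sub_eq_zero, sub_sub_eq_add_sub,
      ← Finset.sum_add_distrib, sub_eq_zero,
      show (B.N : ℝ) = ∑ _i : Fin B.N, 1 by simp]
    exact Finset.sum_congr rfl fun i _ => by split_ifs <;> ring
  calc ∑ j : Fin B.N, f (ctx j) ≤ ∑ i : Fin B.N,
        Real.exp (η * deficit r c) * if c i < r then Real.exp (-η) else 1 :=
        Finset.sum_le_sum fun i _ => (hf i).trans (exp_deficit_add η r c i).le
    _ = Real.exp (η * deficit r c) * (B.N - (1 - Real.exp (-η)) *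
        (Finset.univ.filter fun j => c j < r).card) := by rw [← Finset.mul_sum, hsum]
    _ ≤ Real.exp (η * deficit r c) * ((1 - η * ϑ / 2) * B.N) := by
        refine mul_le_mul_of_nonneg_left ?_ (Real.exp_pos _).le
        have h3 : η / 2 * (ϑ * B.N) ≤ (1 - Real.exp (-η)) *
            (Finset.univ.filter fun j => c j < r).card := by
          have h4 : (0 : ℝ) ≤ (Finset.univ.filter fun j => c j < r).card := Nat.cast_nonneg _
          calc η / 2 * (ϑ * B.N) ≤ η / 2 * (Finset.univ.filter fun j => c j < r).card := by gcongr
            _ ≤ _ := by gcongr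
        linarith
    _ = _ := by ring

end deficit

/-- The visits of a context, including the current one. -/
def visitsWith (v : B.Counts) (s : Fin (B.N + 2)) (j : Fin B.N) : ℕ :=
  visits (v j) + if s = ctx j then 1 else 0

theorem visitsWith_upd (v : B.Counts) (s : Fin (B.N + 2)) (a : Fin B.A) (s' : Fin (B.N + 2)) :
    visitsWith (B.upd v s a s') s' =
      fun j => visitsWith v s j + if s' = ctx j then 1 else 0 := by
  funext j
  simp [visitsWith, visits_upd]

variable (B) in
/-- Exponential potential that decreases with every visit to a context that has to be visited more
often. -/
def deficitPotential (θ : Fin B.N → ℕ) (r : ℕ) (ϑ w₁ : ℝ) (t : ℕ) (s : Fin (B.N + 2))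
    (v : B.Counts) : ℝ :=
  if w₁ < deficit r (visitsWith v s) then
    pick (fun _ => 1) (1 + ϑ / 8) 1 s * (Real.exp (B.η * deficit r (visitsWith v s)) *
      Real.exp (-(3 * B.η * ϑ / 16) * wrongs θ v + B.η * ϑ / 16 * t))
  else 0

theorem deficitPotential_nonneg (θ : Fin B.N → ℕ) (r : ℕ) {ϑ : ℝ} (hϑ : 0 ≤ ϑ) (w₁ : ℝ) (t : ℕ)
    (s : Fin (B.N + 2)) (v : B.Counts) : 0 ≤ B.deficitPotential θ r ϑ w₁ t s v := by
  unfold deficitPotential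
  split_ifs
  · refine mul_nonneg ?_ (by positivity)
    revert s
    exact fun s _ => state_cases (p := fun s => (0 : ℝ) ≤ pick (fun _ => 1) (1 + ϑ / 8) 1 s)
      (by simp) (by simp only [pick_good]; positivity) (by simp) s
  · exact le_rfl

/-- While the deficit exceeds `w₁`, a random context lacks visits with probability at least `ϑ`, so
entering it shrinks `exp (η * deficit)` by a factor `1 - η * ϑ / 2` on average. This pays for the
drift `η * ϑ / 16` in time. The surcharge `1 + ϑ / 8` in `good` is consumed at rate `η` during the
stay there. Wrong actions need not lead to random contexts; their factor `exp (-3 * η * ϑ / 16)`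
compensates. -/
theorem deficitPotential_super (θ : Fin B.N → ℕ) (r : ℕ) {ϑ w₁ : ℝ} (hϑ : 0 ≤ ϑ) (hϑ1 : ϑ ≤ 1) (hθ : ∀ j, θ j < B.K)
    (h4 : B.δ + B.ε ≤ 1 / 4) (h2 : B.δ + B.ε ≤ 2 * B.η) (hq : B.q ≤ B.η)
    (hinc : ∀ c : Fin B.N → ℕ, w₁ < deficit r c →
      ϑ * B.N ≤ (Finset.univ.filter fun j => c j < r).card)
    (t : ℕ) (s : Fin (B.N + 2)) (v : B.Counts) (a : Fin B.A) :
    ∑ s', B.w θ s a s' * B.deficitPotential θ r ϑ w₁ (t + 1) s' (B.upd v s a s') ≤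
      B.deficitPotential θ r ϑ w₁ t s v := by
  have hη := B.η_pos; have hη1 := B.η_le; have hq0 := B.q_pos; have hq2 := B.q_le
  have hηϑ : 0 ≤ B.η * ϑ := by positivity
  set c := visitsWith v s with hc
  by_cases hw : w₁ < deficit r c
  · set Q := Real.exp (-(3 * B.η * ϑ / 16) * wrongs θ v + B.η * ϑ / 16 * t) with hQ
    set X := Real.exp (B.η * deficit r c) with hX
    set g := B.η * ϑ / 16 - (3 * B.η * ϑ / 16) * B.wrong θ s a with hg
    let Y : Fin (B.N + 2) → ℝ := fun s' => pick (fun _ => 1) (1 + ϑ / 8) 1 s' *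
      Real.exp (B.η * deficit r fun j => c j + if s' = ctx j then 1 else 0)
    have hY : ∀ s', B.deficitPotential θ r ϑ w₁ (t + 1) s' (B.upd v s a s') ≤
        Y s' * (Q * Real.exp g) := by
      intro s'
      have hp : (0 : ℝ) ≤ pick (fun _ => 1) (1 + ϑ / 8) 1 s' :=
        state_cases (p := fun s => (0 : ℝ) ≤ pick (fun _ => 1) (1 + ϑ / 8) 1 s)
          (by simp) (by simp only [pick_good]; positivity) (by simp) s'
      have : Q * Real.exp g = Real.exp (-(3 * B.η * ϑ / 16) * wrongs θ (B.upd v s a s') +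
          B.η * ϑ / 16 * (t + 1 : ℕ)) := by
        rw [hQ, hg, ← Real.exp_add, wrongs_upd]; push_cast; ring_nf
      rw [this]
      unfold deficitPotential
      split_ifs
      · rw [visitsWith_upd, ← mul_assoc]
      · positivity
    have hR : B.deficitPotential θ r ϑ w₁ t s v = pick (fun _ => 1) (1 + ϑ / 8) 1 s * X * Q := by
      rw [deficitPotential, if_pos hw, ← mul_assoc]
    have hQ0 : 0 < Q := Real.exp_pos _
    have hX0 : 0 < X := Real.exp_pos _
    have hXi : ∀ i : Fin B.N, Real.exp (B.η * deficit r fun j =>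
        c j + if ctx i = ctx j then 1 else 0) ≤ X := fun i => by
      rw [exp_deficit_add]
      refine mul_le_of_le_one_right hX0.le ?_
      split_ifs
      · exact Real.exp_le_one_iff.2 (by linarith)
      · exact le_rfl
    have hYg : Y good = (1 + ϑ / 8) * X := by simp [Y, hX]
    have hYf : Y far = X := by simp [Y, hX]
    have hYi : ∀ i : Fin B.N, Y (ctx i) ≤ X := fun i => by
      simpa [Y] using hXi i
    have havg : B.avg Y ≤ X * (1 - B.η * ϑ / 2) :=
      avg_exp_deficit_le hη.le hη1 r c (hinc c hw) fun i => by simp [Y]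
    have key : ∑ s', B.w θ s a s' * Y s' * Real.exp g ≤ pick (fun _ => 1) (1 + ϑ / 8) 1 s * X := by
      rw [← Finset.sum_mul]
      have hexp : ∀ {y z : ℝ}, y ≤ Real.exp (-g) * z → y * Real.exp g ≤ z := fun {y z} h => by
        have h1 : Real.exp (-g) * Real.exp g = 1 := by rw [← Real.exp_add]; simp
        calc y * Real.exp g ≤ Real.exp (-g) * z * Real.exp g := by gcongr
          _ = Real.exp (-g) * Real.exp g * z := by ring
          _ = z := by rw [h1, one_mul]
      apply hexp
      have hge := Real.add_one_le_exp (-g)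
      clear_value X Q Y c
      rcases eq_ctx_or s with ⟨j, rfl⟩ | rfl | rfl
      · simp only [pick_ctx, one_mul]
        by_cases h1 : a.1 < B.K
        · rw [sum_w_arm θ j h1, hYg]
          have hp0 := (B.armProb_pos θ j a).le
          have hp := B.armProb_le θ j a
          set p := B.armProb θ j a
          have hgle : g ≤ B.η * ϑ / 16 := by
            rw [hg]
            have : (0 : ℝ) ≤ B.wrong θ (ctx j) a := Nat.cast_nonneg _
            nlinarith
          have e1 : (1 - p) * B.avg Y ≤ (1 - p) * (X * (1 - B.η * ϑ / 2)) := by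
            gcongr; linarith
          -- By `p ≤ 1 / 4` the gain is at least `3 * η * ϑ / 8`, and by `p ≤ 2 * η` the loss is at
          -- most `η * ϑ / 4`.
          have e2 : (1 - p) * (1 - B.η * ϑ / 2) + p * (1 + ϑ / 8) ≤ 1 - B.η * ϑ / 16 := by
            nlinarith
          calc _ ≤ ((1 - p) * (1 - B.η * ϑ / 2) + p * (1 + ϑ / 8)) * X := by linarith
            _ ≤ Real.exp (-g) * X := by gcongr; linarith
        · have hwr : B.wrong θ (ctx j) a = 1 := by
            have : a.1 ≠ θ j := fun h => h1 (h ▸ hθ j)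
            simp [wrong, this]
          -- The net allowance `3 / 16 - 1 / 16` is just what the exit needs, since it reaches the
          -- surcharge `ϑ / 8` with probability `q ≤ η`.
          have hg' : -g = B.η * ϑ / 8 := by rw [hg, hwr]; push_cast; ring
          have hqϑ : B.q * ϑ ≤ B.η * ϑ := by gcongr
          have hqϑ0 : 0 ≤ B.q * ϑ := by positivity
          by_cases h3 : a.1 + 1 = B.A
          · rw [sum_w_exit θ j h3, hYg, hYf]
            have e1 : (1 - 2 * B.q) * Y (ctx j) ≤ (1 - 2 * B.q) * X :=
              mul_le_mul_of_nonneg_left (hYi j) (by linarith)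
            calc _ ≤ (1 + B.q * ϑ / 8) * X := by linarith
              _ ≤ Real.exp (-g) * X := by gcongr; linarith
          · rw [sum_w_nav θ j h1 h3]
            refine (hYi _).trans (le_mul_of_one_le_left hX0.le ?_)
            linarith
      · rw [sum_w_good, hYg]
        simp only [pick_good]
        have hg' : g = B.η * ϑ / 16 := by rw [hg]; simp [wrong]
        have e1 : B.η * B.avg Y ≤ B.η * (X * (1 - B.η * ϑ / 2)) := by gcongr
        have e2 : B.η * (1 - B.η * ϑ / 2) + (1 - B.η) * (1 + ϑ / 8) ≤
            (1 - B.η * ϑ / 16) * (1 + ϑ / 8) := by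
          nlinarith
        calc _ ≤ (B.η * (1 - B.η * ϑ / 2) + (1 - B.η) * (1 + ϑ / 8)) * X := by linarith
          _ ≤ (1 - B.η * ϑ / 16) * (1 + ϑ / 8) * X := by gcongr
          _ ≤ Real.exp (-g) * (1 + ϑ / 8) * X := by gcongr; linarith
          _ = _ := by ring
      · rw [sum_w_far]
        simp only [pick_far, one_mul]
        have hg' : g = B.η * ϑ / 16 := by rw [hg]; simp [wrong]
        calc _ ≤ (1 - B.η * ϑ / 2) * X := by linarith
          _ ≤ Real.exp (-g) * X := by gcongr; linarith
    rw [hR]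
    calc _ ≤ ∑ s', B.w θ s a s' * Y s' * Real.exp g * Q := by
          refine Finset.sum_le_sum fun s' _ => ?_
          calc _ ≤ B.w θ s a s' * (Y s' * (Q * Real.exp g)) :=
                mul_le_mul_of_nonneg_left (hY s') ((B.mdp θ).w_nonneg s a s')
            _ = _ := by ring
      _ = (∑ s', B.w θ s a s' * Y s' * Real.exp g) * Q := by rw [Finset.sum_mul]
      _ ≤ _ := by gcongr
  -- The deficit never increases, so the potential stays zero once it has been cut off.
  · have : ∀ s', B.deficitPotential θ r ϑ w₁ (t + 1) s' (B.upd v s a s') = 0 := by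
      intro s'
      rw [deficitPotential, if_neg]
      rw [visitsWith_upd, ← hc]
      refine fun h => hw (h.trans_le ?_)
      unfold deficit
      exact_mod_cast Finset.sum_le_sum fun j _ => Nat.sub_le_sub_left (Nat.le_add_right _ _) r
    simp only [this, mul_zero, Finset.sum_const_zero]
    exact deficitPotential_nonneg θ r hϑ _ _ _ _

/-- Markov's inequality for the potential: it starts at most at `9 / 8 * exp (η * N * r)`, as no
context can lack more than `r` visits, and on the event the drift in time has made it large. -/
theorem measure_deficit_le (θ : Fin B.N → ℕ) (hθ : ∀ j, θ j < B.K) (r : ℕ) {ϑ w₀ w₁ : ℝ}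
    (hϑ : 0 ≤ ϑ) (hϑ1 : ϑ ≤ 1)
    (h4 : B.δ + B.ε ≤ 1 / 4) (h2 : B.δ + B.ε ≤ 2 * B.η) (hq : B.q ≤ B.η)
    (hinc : ∀ c : Fin B.N → ℕ, w₁ < deficit r c →
      ϑ * B.N ≤ (Finset.univ.filter fun j => c j < r).card)
    {𝒜 : ActionSets (B.N + 2) B.A} (π : Policy 𝒜) (s : Fin (B.N + 2)) {n : ℕ} (hn : 0 < n) :
    ((B.mdp θ).toSMDP 𝒜).trajLaw π s {ω | wrongs θ (counts n ω) < w₀ ∧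
        w₁ < deficit r fun j => visits (counts n ω j)} ≤
      ENNReal.ofReal (2 * Real.exp (B.η * (B.N * r + 3 * ϑ / 16 * w₀ - ϑ / 16 * n))) := by
  have hη := B.η_pos; have hη1 := B.η_le
  -- A visit enters the counts when the context is left, whereas the potential already includes the
  -- current visit. The counts after `n + 1` steps therefore correspond to the potential after `n`
  -- steps.
  obtain ⟨n, rfl⟩ : ∃ k, n = k + 1 := ⟨n - 1, by omega⟩
  set P := ((B.mdp θ).toSMDP 𝒜).trajLaw π s
  set C := Real.exp (-(3 * B.η * ϑ / 16) * w₀ + B.η * ϑ / 16 * n) with hC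
  have hC0 : 0 < C := Real.exp_pos _
  have h1 := (B.mdp θ).lintegral_ofReal_potential_le (upd := B.upd) (v₀ := 0)
    (FiniteMDP.plays_true π) s (B.deficitPotential θ r ϑ w₁)
    (deficitPotential_nonneg θ r hϑ w₁)
    (fun t s v a _ => deficitPotential_super θ r hϑ hϑ1 hθ h4 h2 hq hinc t s v a) n
  have h3 := mul_meas_ge_le_lintegral (μ := P)
    (FiniteMDP.measurable_potential B.upd 0
      (fun s v => ENNReal.ofReal (B.deficitPotential θ r ϑ w₁ n s v)) n) (ENNReal.ofReal C)
  have hsub : {ω : ℕ → Obs (B.N + 2) B.A | (wrongs θ (counts (n + 1) ω) : ℝ) < w₀ ∧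
      w₁ < deficit r fun j => visits (counts (n + 1) ω j)} ⊆
      {ω | ENNReal.ofReal C ≤ ENNReal.ofReal
        (B.deficitPotential θ r ϑ w₁ n (ω n).state (stat B.upd 0 ω n))} := by
    rintro ω ⟨hω1, hω2⟩
    have hv : (fun j => visits (counts (n + 1) ω j)) =
        visitsWith (stat B.upd 0 ω n) (ω n).state := by
      funext j
      exact visits_upd _ _ _ _ _
    have hwr : (wrongs θ (stat B.upd 0 ω n) : ℝ) ≤ w₀ := by
      refine le_trans ?_ hω1.le
      change _ ≤ ((wrongs θ (B.upd (stat B.upd 0 ω n) _ _ _) : ℕ) : ℝ)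
      rw [wrongs_upd]
      exact_mod_cast Nat.le_add_right _ _
    rw [hv] at hω2
    refine ENNReal.ofReal_le_ofReal ?_
    rw [deficitPotential, if_pos hω2]
    have hp : (1 : ℝ) ≤ pick (fun _ => 1) (1 + ϑ / 8) 1 (ω n).state :=
      state_cases (p := fun s => (1 : ℝ) ≤ pick (fun _ => 1) (1 + ϑ / 8) 1 s)
        (by simp) (by simp only [pick_good]; linarith) (by simp) _
    have he : 1 ≤ Real.exp (B.η * deficit r (visitsWith (stat B.upd 0 ω n) (ω n).state)) :=
      Real.one_le_exp (by positivity)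
    have hE : C ≤ Real.exp (-(3 * B.η * ϑ / 16) * wrongs θ (stat B.upd 0 ω n) +
        B.η * ϑ / 16 * n) := by
      refine Real.exp_le_exp.2 ?_
      have : 0 ≤ 3 * B.η * ϑ / 16 := by positivity
      nlinarith
    calc C ≤ 1 * (1 * Real.exp (-(3 * B.η * ϑ / 16) * wrongs θ (stat B.upd 0 ω n) +
        B.η * ϑ / 16 * n)) := by linarith
      _ ≤ _ := by gcongr
  have h0 : B.deficitPotential θ r ϑ w₁ 0 s 0 ≤ (1 + 1 / 8) * Real.exp (B.η * (B.N * r)) := by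
    unfold deficitPotential
    split_ifs
    · have hp : pick (fun _ => (1 : ℝ)) (1 + ϑ / 8) 1 s ≤ 1 + 1 / 8 :=
        state_cases (p := fun s => pick (fun _ => (1 : ℝ)) (1 + ϑ / 8) 1 s ≤ 1 + 1 / 8)
          (by norm_num) (by simp only [pick_good]; linarith) (by norm_num) _
      have hd : (deficit r (visitsWith 0 s) : ℝ) ≤ B.N * r := by
        have : deficit r (visitsWith 0 s) ≤ ∑ _j : Fin B.N, r :=
          Finset.sum_le_sum fun j _ => Nat.sub_le _ _
        have h5 : ∑ _j : Fin B.N, r = B.N * r := by simp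
        rw [h5] at this
        exact_mod_cast this
      have hz : wrongs θ (0 : B.Counts) = 0 := by simp [wrongs, pulls]
      rw [hz]
      simp only [Nat.cast_zero, mul_zero, add_zero, Real.exp_zero, mul_one]
      gcongr
    · positivity
  calc P _ ≤ P {ω | ENNReal.ofReal C ≤ ENNReal.ofReal
        (B.deficitPotential θ r ϑ w₁ n (ω n).state (stat B.upd 0 ω n))} := measure_mono hsub
    _ ≤ (ENNReal.ofReal C)⁻¹ * ENNReal.ofReal ((1 + 1 / 8) * Real.exp (B.η * (B.N * r))) := by
        rw [← ENNReal.mul_le_iff_le_inv (by simpa using hC0) (by simp)]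
        exact h3.trans (h1.trans (ENNReal.ofReal_le_ofReal h0))
    _ = ENNReal.ofReal (C⁻¹ * ((1 + 1 / 8) * Real.exp (B.η * (B.N * r)))) := by
        rw [← ENNReal.ofReal_inv_of_pos hC0, ← ENNReal.ofReal_mul (by positivity)]
    _ ≤ _ := by
        refine ENNReal.ofReal_le_ofReal ?_
        -- The lost step costs at most `exp (1 / 16)`; together with the initial factor `9 / 8` this
        -- accounts for the `2` in the statement.
        have h16 : Real.exp (1 / 16) ≤ 16 / 9 := by
          have := Real.exp_one_lt_d9
          have h7 : Real.exp (1 / 16) ^ 16 = Real.exp 1 := by rw [← Real.exp_nat_mul]; norm_num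
          by_contra h
          have : (16 / 9 : ℝ) ^ 16 ≤ Real.exp (1 / 16) ^ 16 := by
            gcongr; exact (not_le.1 h).le
          norm_num at this
          linarith
        have hηϑ : B.η * ϑ ≤ 1 := mul_le_one₀ hη1 hϑ hϑ1
        calc C⁻¹ * ((1 + 1 / 8) * Real.exp (B.η * (B.N * r)))
            = 9 / 8 * Real.exp (B.η * ϑ / 16) *
              Real.exp (B.η * (B.N * r + 3 * ϑ / 16 * w₀ - ϑ / 16 * (n + 1 : ℕ))) := by
              have hx : C⁻¹ * Real.exp (B.η * (B.N * r)) = Real.exp (B.η * ϑ / 16) *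
                  Real.exp (B.η * (B.N * r + 3 * ϑ / 16 * w₀ - ϑ / 16 * (n + 1 : ℕ))) := by
                rw [hC, ← Real.exp_neg, ← Real.exp_add, ← Real.exp_add]
                congr 1
                push_cast
                ring
              linear_combination (9 / 8) * hx
          _ ≤ 9 / 8 * (16 / 9) * Real.exp (B.η * (B.N * r + 3 * ϑ / 16 * w₀ -
              ϑ / 16 * (n + 1 : ℕ))) := by
              gcongr
              exact (Real.exp_le_exp.2 (by linarith)).trans h16
          _ = _ := by norm_num

end HiddenArms

/-! ### Likelihood ratios against the process without hidden arms. -/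

namespace HiddenArms

variable (B : HiddenArms)

/-- likelihood ratio of a success of the hidden arm -/
def up : ℝ := 1 + B.ε / B.δ

/-- likelihood ratio of a failure of the hidden arm -/
def down : ℝ := 1 - B.ε / (1 - B.δ)

theorem up_pos : 0 < B.up := by
  have := B.δ_pos; have := B.ε_pos; unfold up; positivity

variable {B}

theorem down_pos (h : B.δ + B.ε < 1) : 0 < B.down := by
  have := B.ε_pos
  have h1 : 0 < 1 - B.δ := by linarith
  rw [down, sub_pos, div_lt_one h1]; linarith

theorem mul_up : B.δ * B.up = B.δ + B.ε := by
  have := B.δ_pos.ne'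
  unfold up; field_simp

theorem mul_down (h : B.δ + B.ε < 1) : (1 - B.δ) * B.down = 1 - (B.δ + B.ε) := by
  have := B.ε_pos
  have h1 : 1 - B.δ ≠ 0 := by linarith
  unfold down; field_simp; ring

/-- The likelihood ratio of the outcomes of action `a` under the hypothesis that it is the
hidden arm. -/
def lik (x : Fin B.A → ℕ × ℕ) (a : Fin B.A) : ℝ := B.up ^ (x a).1 * B.down ^ (x a).2

theorem lik_pos (h : B.δ + B.ε < 1) (x : Fin B.A → ℕ × ℕ) (a : Fin B.A) : 0 < lik x a :=
  mul_pos (pow_pos B.up_pos _) (pow_pos (down_pos h) _)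

theorem lik_ctxUpd (x : Fin B.A → ℕ × ℕ) (a a' : Fin B.A) (p : Prop) [Decidable p] :
    lik (B.ctxUpd x a p) a' = lik x a' * if a = a' then (if p then B.up else B.down) else 1 := by
  unfold lik ctxUpd
  by_cases h : a' = a
  · subst h
    simp only [Function.update_self, if_true]
    split_ifs <;> simp only [pow_succ] <;> ring
  · simp [h, Ne.symm h]

variable (B) in
/-- No arm is hidden. -/
def base (_ : Fin B.N) : ℕ := B.K

theorem armProb_base (j : Fin B.N) {a : ℕ} (ha : a < B.K) : B.armProb B.base j a = B.δ := by
  simp [armProb, base, ha.ne]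

/-- likelihood ratio of a transition -/
def stepLik (θ : Fin B.N → Fin B.K) (s : Fin (B.N + 2)) (a : Fin B.A) (s' : Fin (B.N + 2)) : ℝ :=
  pick (fun j => if a = B.arm (θ j) then (if s' = good then B.up else B.down) else 1) 1 1 s

theorem w_eq_mul_stepLik (h : B.δ + B.ε < 1) (θ : Fin B.N → Fin B.K) (s : Fin (B.N + 2))
    (a : Fin B.A) (s' : Fin (B.N + 2)) :
    B.w (fun j => θ j) s a s' = B.w B.base s a s' * stepLik θ s a s' := by
  rcases eq_ctx_or s with ⟨j, rfl⟩ | rfl | rfl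
  · have hiff : a = B.arm (θ j) ↔ a.1 = θ j := Fin.ext_iff
    simp only [w, stepLik, pick_ctx, hiff]
    by_cases h1 : a.1 < B.K
    · have hb := armProb_base j h1
      have ht : B.armProb (fun j => θ j) j a = if a.1 = θ j then B.δ + B.ε else B.δ := rfl
      simp only [h1, if_true, hb, ht]
      by_cases h2 : a.1 = θ j
      · simp only [h2, if_true]
        rcases eq_ctx_or s' with ⟨i, rfl⟩ | rfl | rfl
        · simp only [pick_ctx, ← mul_down h, ctx_ne_good, if_false]; ring
        · simp [mul_up]
        · simp
      · simp [h2]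
    · have h2 : a.1 ≠ θ j := fun h2 => h1 (h2 ▸ (θ j).2)
      simp [h1, h2]
  · simp [w, stepLik]
  · simp [w, stepLik]

/-- likelihood ratio of the counts -/
def likelihood (θ : Fin B.N → Fin B.K) (v : B.Counts) : ℝ := ∏ j, lik (v j) (B.arm (θ j))

theorem prod_upd_ctx (f : Fin B.N → (Fin B.A → ℕ × ℕ) → ℝ) (v : B.Counts) (j : Fin B.N)
    (x : Fin B.A → ℕ × ℕ) :
    ∏ i, f i (Function.update v j x i) = f j x * ∏ i ∈ Finset.univ.erase j, f i (v i) := by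
  rw [← Finset.mul_prod_erase _ _ (Finset.mem_univ j), Function.update_self]
  congr 1
  refine Finset.prod_congr rfl fun i hi => ?_
  rw [Function.update_of_ne (Finset.ne_of_mem_erase hi)]

theorem likelihood_upd (θ : Fin B.N → Fin B.K) (v : B.Counts) (s : Fin (B.N + 2)) (a : Fin B.A)
    (s' : Fin (B.N + 2)) :
    likelihood θ (B.upd v s a s') = likelihood θ v * stepLik θ s a s' := by
  rcases eq_ctx_or s with ⟨j, rfl⟩ | rfl | rfl
  · simp only [likelihood, upd, stepLik, pick_ctx]
    rw [prod_upd_ctx (fun i x => lik x (B.arm (θ i))), lik_ctxUpd,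
      ← Finset.mul_prod_erase _ _ (Finset.mem_univ j)]
    ring
  · simp [upd, stepLik]
  · simp [upd, stepLik]

/-- All hypotheses `θ` are referred to a single law, the one for `B.base`. The sum over `θ` can then
be taken inside the integral. -/
theorem measure_counts_eq (h : B.δ + B.ε < 1) (θ : Fin B.N → Fin B.K)
    {𝒜 : ActionSets (B.N + 2) B.A} (π : Policy 𝒜) (s : Fin (B.N + 2)) (n : ℕ) (S : Set B.Counts) :
    ((B.mdp fun j => θ j).toSMDP 𝒜).trajLaw π s {ω | counts n ω ∈ S} =
      ∫⁻ ω, S.indicator (fun v => ENNReal.ofReal (likelihood θ v)) (counts n ω)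
        ∂(((B.mdp B.base).toSMDP 𝒜).trajLaw π s) := by
  have hm : MeasurableSet {ω : ℕ → Obs (B.N + 2) B.A | counts n ω ∈ S} :=
    measurable_stat B.upd 0 n MeasurableSet.of_discrete
  rw [← lintegral_indicator_one hm,
    (B.mdp B.base).lintegral_change_of_measure (upd := B.upd) (v₀ := 0) (B.mdp fun j => θ j) π s
      (stepLik θ) (fun _ _ _ => rfl) (w_eq_mul_stepLik h θ) (likelihood θ)
      (fun v => Finset.prod_nonneg fun j _ => (lik_pos h _ _).le) (likelihood_upd θ)
      (by simp [likelihood, lik]) n (measurable_one.indicator hm)]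
  · refine lintegral_congr fun ω => ?_
    by_cases hω : counts n ω ∈ S
    · rw [Set.indicator_of_mem hω, Set.indicator_of_mem (s := {ω | counts n ω ∈ S}) hω]
      simp [counts]
    · rw [Set.indicator_of_notMem hω, Set.indicator_of_notMem (s := {ω | counts n ω ∈ S}) hω]
      simp
  · intro (x : ℕ → Obs _ _) (y : ℕ → Obs _ _) hxy
    have : counts n x = counts n y := dependsOn_stat B.upd 0 n hxy
    have hi : x ∈ {ω : ℕ → Obs (B.N + 2) B.A | counts n ω ∈ S} ↔
        y ∈ {ω : ℕ → Obs (B.N + 2) B.A | counts n ω ∈ S} := by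
      change counts n x ∈ S ↔ counts n y ∈ S
      rw [this]
    classical
    simp only [Set.indicator, hi, Pi.one_apply]

section convexity

/-- A convex function with `ℓ - 1 ≤ penalty ℓ` that grows slowly along likelihood ratios. -/
def penalty (ℓ : ℝ) : ℝ := 1 / 100 + 51 * (ℓ - 1) - 50 * Real.log ℓ

theorem sub_one_le_penalty {ℓ : ℝ} (h : 0 < ℓ) : ℓ - 1 ≤ penalty ℓ := by
  have := Real.log_le_sub_one_of_pos h
  unfold penalty; linarith

/-- With `x = 1 - ℓ > 0`, two terms of the series give `log (1 - x) ≤ -x - x ^ 2 / 2`, so the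
penalty is at least `1 / 100 - x + 25 * x ^ 2 = 25 * (x - 1 / 50) ^ 2`. This fixes the constant `1 /
100`. -/
theorem penalty_nonneg {ℓ : ℝ} (h : 0 < ℓ) : 0 ≤ penalty ℓ := by
  rcases le_or_gt 1 ℓ with h1 | h1
  · exact (sub_nonneg.2 h1).trans (sub_one_le_penalty h)
  · have h2 := (Real.hasSum_pow_div_log_of_abs_lt_one (x := 1 - ℓ)
      (by rw [abs_of_pos (by linarith)]; linarith))
    have h3 := sum_le_hasSum (Finset.range 2)
      (fun i _ => div_nonneg (pow_nonneg (by linarith) _) (by positivity)) h2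
    rw [sub_sub_cancel] at h3
    simp only [Finset.sum_range_succ, Finset.sum_range_zero] at h3
    norm_num at h3
    unfold penalty
    nlinarith [sq_nonneg (1 - ℓ - 1 / 50)]

/-- Expected growth of the penalty when the likelihood ratio is updated. -/
theorem penalty_step (h : B.δ + B.ε ≤ 1 / 2) {ℓ : ℝ} (hℓ : 0 < ℓ) :
    B.δ * penalty (ℓ * B.up) + (1 - B.δ) * penalty (ℓ * B.down) ≤
      penalty ℓ + 100 * B.ε ^ 2 / B.δ := by
  have hδ := B.δ_pos; have hε := B.ε_pos
  have hd := down_pos (B := B) (by linarith)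
  have hu := B.up_pos
  have h1 := Real.one_sub_inv_le_log_of_pos hu
  have h2 := Real.one_sub_inv_le_log_of_pos hd
  have h3 := mul_up (B := B)
  have h4 := mul_down (B := B) (by linarith)
  -- The likelihood ratio is a martingale, so only the logarithm contributes to the growth. By `log
  -- x ≥ 1 - 1 / x` its expected increment is at least `-ε² / ((δ + ε) * (1 - δ - ε))`.
  have h5 : B.δ * (1 - B.up⁻¹) + (1 - B.δ) * (1 - B.down⁻¹) ≥ -(2 * B.ε ^ 2 / B.δ) := by
    have e1 : B.up = (B.δ + B.ε) / B.δ := by rw [← h3]; field_simp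
    have hδ1 : 1 - B.δ ≠ 0 := by linarith
    have e2 : B.down = (1 - (B.δ + B.ε)) / (1 - B.δ) := by rw [← h4]; field_simp
    have e3 : B.δ * (1 - B.up⁻¹) + (1 - B.δ) * (1 - B.down⁻¹) =
        -(B.ε ^ 2 / ((B.δ + B.ε) * (1 - (B.δ + B.ε)))) := by
      have : B.δ + B.ε ≠ 0 := by linarith
      have : 1 - (B.δ + B.ε) ≠ 0 := by linarith
      rw [e1, e2]; field_simp; ring
    rw [e3, ge_iff_le, neg_le_neg_iff, div_le_div_iff₀ (by nlinarith) hδ]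
    nlinarith [sq_nonneg B.ε, mul_nonneg (sq_nonneg B.ε) hδ.le, mul_nonneg (sq_nonneg B.ε) hε.le]
  have h6 : B.δ * (1 - B.up⁻¹) + (1 - B.δ) * (1 - B.down⁻¹) ≤
      B.δ * Real.log B.up + (1 - B.δ) * Real.log B.down := by
    have := mul_le_mul_of_nonneg_left h1 hδ.le
    have := mul_le_mul_of_nonneg_left h2 (show 0 ≤ 1 - B.δ by linarith)
    linarith
  unfold penalty
  rw [Real.log_mul hℓ.ne' hu.ne', Real.log_mul hℓ.ne' hd.ne']
  have h7 : B.δ * (ℓ * B.up) + (1 - B.δ) * (ℓ * B.down) = ℓ := by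
    linear_combination ℓ * h3 + ℓ * h4
  have h8 : 100 * B.ε ^ 2 / B.δ = 50 * (2 * B.ε ^ 2 / B.δ) := by ring
  rw [h8]
  nlinarith

end convexity

/-- Upper bound for the posterior weight of contexts in which few wrong actions were taken. -/
def weight (x : Fin B.A → ℕ × ℕ) : ℝ :=
  1 / 100 + 1 / B.K + (∑ a : Fin B.K, penalty (lik x (B.arm a))) / B.K +
    Real.exp (-5) * ((∑ a : Fin B.K, lik x (B.arm a)) / B.K)

theorem K_pos' : (0 : ℝ) < B.K := Nat.cast_pos.2 B.K_pos

theorem weight_ge (h : B.δ + B.ε < 1) (x : Fin B.A → ℕ × ℕ) : 1 / 100 ≤ weight x := by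
  have := K_pos' (B := B)
  have h1 : 0 ≤ ∑ a : Fin B.K, penalty (lik x (B.arm a)) :=
    Finset.sum_nonneg fun a _ => penalty_nonneg (lik_pos h _ _)
  have h2 : 0 ≤ ∑ a : Fin B.K, lik x (B.arm a) := Finset.sum_nonneg fun a _ => (lik_pos h _ _).le
  unfold weight
  have : 0 ≤ 1 / (B.K : ℝ) := by positivity
  have : 0 ≤ (∑ a : Fin B.K, penalty (lik x (B.arm a))) / B.K := by positivity
  have : 0 ≤ Real.exp (-5) * ((∑ a : Fin B.K, lik x (B.arm a)) / B.K) := by positivity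
  linarith

theorem weight_ctxUpd_of_le (x : Fin B.A → ℕ × ℕ) {a : Fin B.A} (ha : ¬ a.1 < B.K) (p : Prop)
    [Decidable p] : weight (B.ctxUpd x a p) = weight x := by
  have h1 : ∀ a' : Fin B.K, a ≠ B.arm a' := fun a' h => ha (h ▸ a'.2)
  simp [weight, lik_ctxUpd, h1]

/-- A pull changes only the summands of the pulled arm: its likelihood is a martingale and its
penalty grows by at most `100 * ε² / δ`. -/
theorem weight_step (h : B.δ + B.ε ≤ 1 / 2) (x : Fin B.A → ℕ × ℕ) {a : Fin B.A} (ha : a.1 < B.K) :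
    (1 - B.δ) * weight (B.ctxUpd x a False) + B.δ * weight (B.ctxUpd x a True) ≤
      weight x * Real.exp (10000 * B.ε ^ 2 / (B.δ * B.K)) := by
  have hδ := B.δ_pos; have hε := B.ε_pos; have hK := K_pos' (B := B)
  have hlt : B.δ + B.ε < 1 := by linarith
  obtain ⟨a, rfl⟩ : ∃ b : Fin B.K, a = B.arm b := ⟨⟨a, ha⟩, rfl⟩
  have e1 : (1 - B.δ) * (∑ a' : Fin B.K, penalty (lik (B.ctxUpd x (B.arm a) False) (B.arm a'))) +
      B.δ * (∑ a' : Fin B.K, penalty (lik (B.ctxUpd x (B.arm a) True) (B.arm a'))) ≤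
      (∑ a' : Fin B.K, penalty (lik x (B.arm a'))) + 100 * B.ε ^ 2 / B.δ := by
    have hs : 100 * B.ε ^ 2 / B.δ = ∑ a' : Fin B.K, if a = a' then 100 * B.ε ^ 2 / B.δ else 0 := by
      simp
    rw [Finset.mul_sum, Finset.mul_sum, ← Finset.sum_add_distrib, hs, ← Finset.sum_add_distrib]
    refine Finset.sum_le_sum fun a' _ => ?_
    simp only [lik_ctxUpd, arm_inj, if_true, if_false]
    split_ifs
    · have := penalty_step h (lik_pos hlt x (B.arm a'))
      linarith
    · simp only [mul_one]; linarith
  have e2 : (1 - B.δ) * (∑ a' : Fin B.K, lik (B.ctxUpd x (B.arm a) False) (B.arm a')) +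
      B.δ * (∑ a' : Fin B.K, lik (B.ctxUpd x (B.arm a) True) (B.arm a')) =
      ∑ a' : Fin B.K, lik x (B.arm a') := by
    rw [Finset.mul_sum, Finset.mul_sum, ← Finset.sum_add_distrib]
    refine Finset.sum_congr rfl fun a' _ => ?_
    simp only [lik_ctxUpd, arm_inj, if_true, if_false]
    split_ifs
    · linear_combination lik x (B.arm a') * (mul_up (B := B)) +
        lik x (B.arm a') * mul_down hlt
    · ring
  have e3 : (1 - B.δ) * weight (B.ctxUpd x (B.arm a) False) +
      B.δ * weight (B.ctxUpd x (B.arm a) True) ≤ weight x + 100 * B.ε ^ 2 / B.δ / B.K := by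
    have e4 := div_le_div_of_nonneg_right e1 hK.le
    rw [add_div (∑ a' : Fin B.K, penalty (lik x (B.arm a')))] at e4
    have e5 : 1 / 100 + 1 / (B.K : ℝ) + ((1 - B.δ) *
        (∑ a' : Fin B.K, penalty (lik (B.ctxUpd x (B.arm a) False) (B.arm a'))) +
      B.δ * (∑ a' : Fin B.K, penalty (lik (B.ctxUpd x (B.arm a) True) (B.arm a')))) / B.K +
      Real.exp (-5) * (((1 - B.δ) * (∑ a' : Fin B.K, lik (B.ctxUpd x (B.arm a) False) (B.arm a')) +
      B.δ * (∑ a' : Fin B.K, lik (B.ctxUpd x (B.arm a) True) (B.arm a'))) / B.K) =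
      (1 - B.δ) * weight (B.ctxUpd x (B.arm a) False) +
        B.δ * weight (B.ctxUpd x (B.arm a) True) := by
      unfold weight; ring
    rw [← e5, e2]
    unfold weight
    linarith
  -- The lower bound `1 / 100` of the weight turns the additive increment into a factor, as needed
  -- for a product over contexts.
  refine e3.trans ?_
  have h1 := weight_ge hlt x
  have h2 := Real.add_one_le_exp (10000 * B.ε ^ 2 / (B.δ * B.K))
  have h3 : 0 ≤ 10000 * B.ε ^ 2 / (B.δ * B.K) := by positivity
  have h4 : 100 * B.ε ^ 2 / B.δ / B.K = 1 / 100 * (10000 * B.ε ^ 2 / (B.δ * B.K)) := by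
    field_simp; norm_num
  rw [h4]
  nlinarith

/-- The product of the weights grows slowly when no arm is hidden. -/
theorem lintegral_prod_weight_le (h : B.δ + B.ε ≤ 1 / 2) {𝒜 : ActionSets (B.N + 2) B.A}
    (π : Policy 𝒜) (s : Fin (B.N + 2)) (n : ℕ) :
    ∫⁻ ω, ENNReal.ofReal (∏ j, weight (counts n ω j))
        ∂(((B.mdp B.base).toSMDP 𝒜).trajLaw π s) ≤
      ENNReal.ofReal (Real.exp (10000 * B.ε ^ 2 / (B.δ * B.K) * n) *
        weight (B := B) (fun _ => 0) ^ B.N) := by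
  have hlt : B.δ + B.ε < 1 := by linarith
  set k := 10000 * B.ε ^ 2 / (B.δ * B.K) with hk
  have hδ := B.δ_pos; have hε := B.ε_pos; have hK := K_pos' (B := B)
  have hk0 : 0 ≤ k := by positivity
  have hw0 : ∀ x : Fin B.A → ℕ × ℕ, 0 ≤ weight x := fun x =>
    (by norm_num : (0 : ℝ) ≤ 1 / 100).trans (weight_ge hlt x)
  have hp0 : ∀ v : B.Counts, 0 ≤ ∏ j, weight (v j) := fun v => Finset.prod_nonneg fun j _ => hw0 _
  have h1 := (B.mdp B.base).lintegral_ofReal_potential_le (upd := B.upd) (v₀ := 0)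
    (FiniteMDP.plays_true π) s (fun t _ v => Real.exp (-(k * t)) * ∏ j, weight (v j))
    (fun t s v => mul_nonneg (Real.exp_pos _).le (hp0 v)) (fun t s v a _ => by
      have hexp : Real.exp (-(k * (t + 1 : ℕ))) = Real.exp (-(k * t)) * Real.exp (-k) := by
        rw [← Real.exp_add]; push_cast; ring_nf
      have hek : Real.exp (-k) ≤ 1 := Real.exp_le_one_iff.2 (by linarith)
      change ∑ s', B.w B.base s a s' * _ ≤ _
      simp only [hexp]
      have key : ∑ s', B.w B.base s a s' * ∏ j, weight (B.upd v s a s' j) ≤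
          Real.exp k * ∏ j, weight (v j) := by
        have hone : ∑ s', B.w B.base s a s' * ∏ j, weight (v j) = ∏ j, weight (v j) := by
          have hw : ∑ s', B.w B.base s a s' = 1 := (B.mdp B.base).w_sum s a
          rw [← Finset.sum_mul, hw, one_mul]
        have hle : ∏ j, weight (v j) ≤ Real.exp k * ∏ j, weight (v j) :=
          le_mul_of_one_le_left (hp0 v) (Real.one_le_exp hk0)
        rcases eq_ctx_or s with ⟨j, rfl⟩ | rfl | rfl
        · by_cases ha : a.1 < B.K
          · rw [sum_w_arm _ j ha (fun s' => ∏ i, weight (B.upd v (ctx j) a s' i)), armProb_base j ha,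
              B.avg_const (c := weight (B.ctxUpd (v j) a False) *
                ∏ i ∈ Finset.univ.erase j, weight (v i))]
            · simp only [upd, pick_ctx]
              rw [prod_upd_ctx (fun _ x => weight x), ← Finset.mul_prod_erase _ _ (Finset.mem_univ j)]
              have h2 := weight_step h (v j) ha
              rw [← hk] at h2
              have h3 : 0 ≤ ∏ i ∈ Finset.univ.erase j, weight (v i) :=
                Finset.prod_nonneg fun i _ => hw0 _
              have h4 : weight (B.ctxUpd (v j) a ((good : Fin (B.N + 2)) = good)) =
                weight (B.ctxUpd (v j) a True) := by simp [ctxUpd]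
              rw [h4]
              nlinarith
            · intro i
              simp only [upd, pick_ctx]
              rw [prod_upd_ctx (fun _ x => weight x)]
              congr 2
              simp [ctxUpd]
          · have h2 : ∀ s' i, weight (B.upd v (ctx j) a s' i) = weight (v i) := fun s' i => by
              simp only [upd, pick_ctx]
              by_cases hi : i = j
              · subst hi
                rw [Function.update_self, weight_ctxUpd_of_le _ ha]
              · rw [Function.update_of_ne hi]
            simp only [h2]
            rw [hone]; exact hle
        · simp only [upd, pick_good]
          rw [hone]; exact hle
        · simp only [upd, pick_far]
          rw [hone]; exact hle
      calc _ = Real.exp (-(k * t)) * Real.exp (-k) *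
            ∑ s', B.w B.base s a s' * ∏ j, weight (B.upd v s a s' j) := by
            rw [Finset.mul_sum]
            exact Finset.sum_congr rfl fun _ _ => by ring
        _ ≤ Real.exp (-(k * t)) * Real.exp (-k) * (Real.exp k * ∏ j, weight (v j)) := by gcongr
        _ = Real.exp (-(k * t)) * (Real.exp (-k) * Real.exp k) * ∏ j, weight (v j) := by ring
        _ = _ := by rw [← Real.exp_add (-k) k]; simp) n
  have h2 : ∀ ω : ℕ → Obs (B.N + 2) B.A, ENNReal.ofReal (∏ j, weight (counts n ω j)) =
      ENNReal.ofReal (Real.exp (k * n)) *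
        ENNReal.ofReal (Real.exp (-(k * n)) * ∏ j, weight (stat B.upd 0 ω n j)) := fun ω => by
    rw [← ENNReal.ofReal_mul (Real.exp_pos _).le, ← mul_assoc, ← Real.exp_add]
    simp [counts]
  simp only [h2]
  rw [lintegral_const_mul' _ _ ENNReal.ofReal_ne_top, ENNReal.ofReal_mul (Real.exp_pos _).le]
  gcongr
  refine h1.trans (ENNReal.ofReal_le_ofReal ?_)
  simp
  exact le_rfl

theorem pulls_add_pulls_le (x : Fin B.A → ℕ × ℕ) {a a' : Fin B.A} (h : a ≠ a') :
    pulls x a + pulls x a' ≤ visits x := by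
  rw [← Finset.sum_pair h]
  exact Finset.sum_le_sum_of_subset (Finset.subset_univ _)

/-- Let `m` be the most pulled arm. Any other arm takes at most half of the visits, so if it were
the hidden one, at least half of the visits would be wrong; up to missing visits this costs `exp
(-5)`, as `l * r = 10`. Only the likelihood of `m` escapes this factor. It is at most `1` plus its
penalty, and since `m` depends on the data, the penalties of all arms are added. -/
theorem sum_lik_exp_le (h : B.δ + B.ε < 1) (x : Fin B.A → ℕ × ℕ) {l : ℝ} {r : ℕ} (hl : 0 ≤ l)
    (hlr : l * r = 10) :
    ∑ a : Fin B.K, lik x (B.arm a) * Real.exp (-(l * ((visits x : ℝ) - pulls x (B.arm a)))) ≤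
      B.K * (Real.exp (l * (r - visits x : ℕ)) * weight x) := by
  have hK := K_pos' (B := B)
  obtain ⟨m, -, hm⟩ := Finset.exists_max_image Finset.univ (fun a : Fin B.K => pulls x (B.arm a))
    ⟨⟨0, B.K_pos⟩, Finset.mem_univ _⟩
  set X := Real.exp (l * (r - visits x : ℕ)) with hX
  have hX1 : 1 ≤ X := Real.one_le_exp (by positivity)
  have hterm : ∀ a : Fin B.K, lik x (B.arm a) *
      Real.exp (-(l * ((visits x : ℝ) - pulls x (B.arm a)))) ≤
      X * ((if m = a then lik x (B.arm a) else 0) + Real.exp (-5) * lik x (B.arm a)) := by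
    intro a
    have hl0 := (lik_pos h x (B.arm a)).le
    have hpv : (pulls x (B.arm a) : ℝ) ≤ visits x := by
      exact_mod_cast Finset.single_le_sum (f := pulls x) (fun _ _ => Nat.zero_le _)
        (Finset.mem_univ (B.arm a))
    by_cases hma : m = a
    · rw [if_pos hma]
      have e1 : Real.exp (-(l * ((visits x : ℝ) - pulls x (B.arm a)))) ≤ 1 :=
        Real.exp_le_one_iff.2 (by nlinarith)
      calc _ ≤ lik x (B.arm a) * 1 := by gcongr
        _ ≤ X * (lik x (B.arm a) + 0) := by nlinarith
        _ ≤ _ := by gcongr; positivity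
    · rw [if_neg hma, zero_add]
      have e1 : Real.exp (-(l * ((visits x : ℝ) - pulls x (B.arm a)))) ≤ X * Real.exp (-5) := by
        rw [hX, ← Real.exp_add]
        refine Real.exp_le_exp.2 ?_
        have e2 : (pulls x (B.arm m) : ℝ) + pulls x (B.arm a) ≤ visits x := by
          exact_mod_cast pulls_add_pulls_le x (fun e => hma (arm_inj B |>.1 e))
        have e3 : (pulls x (B.arm a) : ℝ) ≤ pulls x (B.arm m) := by
          exact_mod_cast hm a (Finset.mem_univ _)
        have e4 : (r : ℝ) ≤ (r - visits x : ℕ) + visits x := by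
          exact_mod_cast (show r ≤ r - visits x + visits x by omega)
        have e5 : (0 : ℝ) ≤ (r - visits x : ℕ) := Nat.cast_nonneg _
        nlinarith
      calc _ ≤ lik x (B.arm a) * (X * Real.exp (-5)) := by gcongr
        _ = _ := by ring
  refine (Finset.sum_le_sum fun a _ => hterm a).trans ?_
  rw [← Finset.mul_sum, Finset.sum_add_distrib, Finset.sum_ite_eq, if_pos (Finset.mem_univ m),
    ← Finset.mul_sum]
  have h1 := sub_one_le_penalty (lik_pos h x (B.arm m))
  have h2 : penalty (lik x (B.arm m)) ≤ ∑ a : Fin B.K, penalty (lik x (B.arm a)) :=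
    Finset.single_le_sum (f := fun a => penalty (lik x (B.arm a)))
      (fun a _ => penalty_nonneg (lik_pos h _ _)) (Finset.mem_univ m)
  have h3 : B.K * weight x = B.K / 100 + 1 + ∑ a : Fin B.K, penalty (lik x (B.arm a)) +
      Real.exp (-5) * ∑ a : Fin B.K, lik x (B.arm a) := by
    unfold weight; field_simp
  rw [mul_left_comm, h3]
  gcongr
  linarith [hK]

theorem visits_sub_pulls_sum (θ : Fin B.N → Fin B.K) (v : B.Counts) :
    (wrongs (fun j => θ j) v : ℝ) = ∑ j, ((visits (v j) : ℝ) - pulls (v j) (B.arm (θ j))) := by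
  unfold wrongs
  push_cast
  refine Finset.sum_congr rfl fun j _ => ?_
  rw [eq_sub_iff_add_eq, visits]
  push_cast
  have : (pulls (v j) (B.arm (θ j)) : ℝ) =
      ∑ a : Fin B.A, if a.1 = θ j then (pulls (v j) a : ℝ) else 0 := by
    have hiff : ∀ a : Fin B.A, a.1 = θ j ↔ a = B.arm (θ j) := fun a =>
      (Fin.ext_iff (a := a) (b := B.arm (θ j))).symm
    simp [hiff]
  rw [this, ← Finset.sum_add_distrib]
  exact Finset.sum_congr rfl fun a _ => by split_ifs <;> simp

/-- Summed over all hidden arms, the likelihood of few wrong actions is bounded by the product of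
the weights. -/
theorem sum_likelihood_le (h : B.δ + B.ε < 1) (v : B.Counts) {l w₀ w₁ : ℝ} {r : ℕ} (hl : 0 ≤ l)
    (hlr : l * r = 10) :
    ∑ θ : Fin B.N → Fin B.K, Set.indicator {v : B.Counts | wrongs (fun j => θ j) v < w₀ ∧
        (deficit r fun j => visits (v j)) ≤ w₁} (likelihood θ) v ≤
      B.K ^ B.N * (Real.exp (l * (w₀ + w₁)) * ∏ j, weight (v j)) := by
  set Df := deficit r fun j => visits (v j) with hDf
  -- The indicator is bounded by `exp (l * (w₀ + w₁ - deficit - wrongs))`. The wrong actions add up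
  -- over the contexts, so the sum over `θ` becomes a product.
  have h1 : ∀ θ : Fin B.N → Fin B.K, Set.indicator {v : B.Counts | wrongs (fun j => θ j) v < w₀ ∧
        (deficit r fun j => visits (v j)) ≤ w₁} (likelihood θ) v ≤
      Real.exp (l * (w₀ + w₁)) * Real.exp (-(l * Df)) * ∏ j, (lik (v j) (B.arm (θ j)) *
        Real.exp (-(l * ((visits (v j) : ℝ) - pulls (v j) (B.arm (θ j)))))) := by
    intro θ
    have hL : 0 ≤ likelihood θ v := Finset.prod_nonneg fun j _ => (lik_pos h _ _).le
    have e1 : ∏ j, (lik (v j) (B.arm (θ j)) *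
        Real.exp (-(l * ((visits (v j) : ℝ) - pulls (v j) (B.arm (θ j)))))) =
        likelihood θ v * Real.exp (-(l * wrongs (fun j => θ j) v)) := by
      rw [Finset.prod_mul_distrib, ← Real.exp_sum, Finset.sum_neg_distrib, ← Finset.mul_sum,
        visits_sub_pulls_sum]
      rfl
    rw [e1]
    by_cases hv : v ∈ {v : B.Counts | (wrongs (fun j => θ j) v : ℝ) < w₀ ∧
      ((deficit r fun j => visits (v j) : ℕ) : ℝ) ≤ w₁}
    · rw [Set.indicator_of_mem hv]
      have e2 : Real.exp (l * (w₀ + w₁)) * Real.exp (-(l * Df)) *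
          (likelihood θ v * Real.exp (-(l * wrongs (fun j => θ j) v))) = likelihood θ v *
          Real.exp (l * (w₀ + w₁) + -(l * Df) + -(l * wrongs (fun j => θ j) v)) := by
        rw [Real.exp_add, Real.exp_add]; ring
      rw [e2]
      refine le_mul_of_one_le_right hL (Real.one_le_exp ?_)
      obtain ⟨hv1, hv2⟩ := hv
      rw [← hDf] at hv2
      nlinarith
    · rw [Set.indicator_of_notMem hv]
      positivity
  refine (Finset.sum_le_sum fun θ _ => h1 θ).trans ?_
  rw [← Finset.mul_sum]
  have h2 : ∑ θ : Fin B.N → Fin B.K, ∏ j, (lik (v j) (B.arm (θ j)) *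
        Real.exp (-(l * ((visits (v j) : ℝ) - pulls (v j) (B.arm (θ j)))))) =
      ∏ j, ∑ a : Fin B.K, (lik (v j) (B.arm a) *
        Real.exp (-(l * ((visits (v j) : ℝ) - pulls (v j) (B.arm a))))) := by
    rw [Finset.prod_univ_sum, Fintype.piFinset_univ]
  have h3 : ∏ j, ∑ a : Fin B.K, (lik (v j) (B.arm a) *
        Real.exp (-(l * ((visits (v j) : ℝ) - pulls (v j) (B.arm a))))) ≤
      ∏ j, (B.K * (Real.exp (l * (r - visits (v j) : ℕ)) * weight (v j))) :=
    Finset.prod_le_prod (fun j _ => Finset.sum_nonneg fun a _ =>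
      mul_nonneg (lik_pos h _ _).le (Real.exp_pos _).le) fun j _ => sum_lik_exp_le h _ hl hlr
  have h4 : ∏ j : Fin B.N, (B.K * (Real.exp (l * (r - visits (v j) : ℕ)) * weight (v j))) =
      B.K ^ B.N * (Real.exp (l * Df) * ∏ j, weight (v j)) := by
    rw [Finset.prod_mul_distrib, Finset.prod_mul_distrib, ← Real.exp_sum, ← Finset.mul_sum, hDf]
    simp [deficit]
  rw [h2]
  calc _ ≤ Real.exp (l * (w₀ + w₁)) * Real.exp (-(l * Df)) *
        (B.K ^ B.N * (Real.exp (l * Df) * ∏ j, weight (v j))) := by rw [← h4]; gcongr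
    _ = B.K ^ B.N * (Real.exp (l * (w₀ + w₁)) * (Real.exp (-(l * Df)) * Real.exp (l * Df)) *
        ∏ j, weight (v j)) := by ring
    _ = _ := by rw [← Real.exp_add (-(l * Df))]; simp

theorem sum_measure_le (h : B.δ + B.ε ≤ 1 / 2) {l w₀ w₁ : ℝ} {r : ℕ} (hl : 0 ≤ l)
    (hlr : l * r = 10) {𝒜 : ActionSets (B.N + 2) B.A} (π : Policy 𝒜) (s : Fin (B.N + 2)) (n : ℕ) :
    ∑ θ : Fin B.N → Fin B.K, ((B.mdp fun j => θ j).toSMDP 𝒜).trajLaw π s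
        {ω | wrongs (fun j => θ j) (counts n ω) < w₀ ∧
          (deficit r fun j => visits (counts n ω j)) ≤ w₁} ≤
      ENNReal.ofReal (B.K ^ B.N * (Real.exp (l * (w₀ + w₁)) *
        (Real.exp (10000 * B.ε ^ 2 / (B.δ * B.K) * n) *
          weight (B := B) (fun _ => 0) ^ B.N))) := by
  have hlt : B.δ + B.ε < 1 := by linarith
  have h1 : ∀ θ : Fin B.N → Fin B.K, _ := fun θ => measure_counts_eq hlt θ π s n
    {v : B.Counts | wrongs (fun j => θ j) v < w₀ ∧ (deficit r fun j => visits (v j)) ≤ w₁}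
  calc _ = ∑ θ : Fin B.N → Fin B.K, ∫⁻ ω, Set.indicator
        {v : B.Counts | wrongs (fun j => θ j) v < w₀ ∧ (deficit r fun j => visits (v j)) ≤ w₁}
        (fun v => ENNReal.ofReal (likelihood θ v)) (counts n ω)
        ∂(((B.mdp B.base).toSMDP 𝒜).trajLaw π s) := Finset.sum_congr rfl fun θ _ => h1 θ
    _ = ∫⁻ ω, ∑ θ : Fin B.N → Fin B.K, Set.indicator
        {v : B.Counts | wrongs (fun j => θ j) v < w₀ ∧ (deficit r fun j => visits (v j)) ≤ w₁}
        (fun v => ENNReal.ofReal (likelihood θ v)) (counts n ω)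
        ∂(((B.mdp B.base).toSMDP 𝒜).trajLaw π s) := by
        rw [lintegral_finsetSum _ fun θ _ => ?_]
        exact FiniteMDP.measurable_potential B.upd 0 (fun _ v => Set.indicator
          {v : B.Counts | wrongs (fun j => θ j) v < w₀ ∧ (deficit r fun j => visits (v j)) ≤ w₁}
          (fun v => ENNReal.ofReal (likelihood θ v)) v) n
    _ ≤ ∫⁻ ω, ENNReal.ofReal (B.K ^ B.N * Real.exp (l * (w₀ + w₁))) *
        ENNReal.ofReal (∏ j, weight (counts n ω j))
        ∂(((B.mdp B.base).toSMDP 𝒜).trajLaw π s) := by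
        refine lintegral_mono fun ω => ?_
        rw [← ENNReal.ofReal_mul (by positivity), mul_assoc]
        refine le_trans (le_of_eq ?_) (ENNReal.ofReal_le_ofReal
          (sum_likelihood_le hlt (counts n ω) hl hlr))
        rw [ENNReal.ofReal_sum_of_nonneg]
        · refine Finset.sum_congr rfl fun θ _ => ?_
          simp only [Set.indicator]
          split_ifs <;> simp
        · intro θ _
          exact Set.indicator_nonneg (fun v _ =>
            Finset.prod_nonneg fun j _ => (lik_pos hlt _ _).le) _
    _ ≤ _ := by
        rw [lintegral_const_mul' _ _ ENNReal.ofReal_ne_top, ← mul_assoc (_ ^ _),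
          ENNReal.ofReal_mul (p := B.K ^ B.N * Real.exp (l * (w₀ + w₁))) (by positivity)]
        gcongr
        exact lintegral_prod_weight_le h π s n

end HiddenArms

/-! ### Choice of the hidden arms. -/

namespace HiddenArms

variable {B : HiddenArms}

theorem weight_zero :
    weight (B := B) (fun _ => 0) = 1 / 100 + 1 / B.K + 1 / 100 + Real.exp (-5) := by
  have h0 : (B.K : ℝ) ≠ 0 := K_pos'.ne'
  simp [weight, lik, penalty, h0]

theorem weight_zero_le (hK : 5 ≤ B.K) : weight (B := B) (fun _ => 0) ≤ 23 / 100 := by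
  have hK' : (5 : ℝ) ≤ B.K := by exact_mod_cast hK
  have h1 : 1 / (B.K : ℝ) ≤ 1 / 5 := one_div_le_one_div_of_le (by norm_num) hK'
  have h2 : Real.exp (-5) ≤ 1 / 100 := by
    rw [Real.exp_neg, ← one_div]
    refine one_div_le_one_div_of_le (by norm_num) ?_
    have h3 : Real.exp 5 = Real.exp 1 ^ 5 := by rw [← Real.exp_nat_mul]; norm_num
    rw [h3]
    calc (100 : ℝ) ≤ (27 / 10) ^ 5 := by norm_num
      _ ≤ _ := by gcongr; linarith [Real.exp_one_gt_d9]
  rw [weight_zero]; linarith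

/-- The allowance `3 / 100` is `1 / 50` from `l * (w₀ + w₁)` and `1 / 100` from the growth of the
weights during `n` steps. -/
theorem exp_mul_weight_pow_le (hK : 5 ≤ B.K) {x : ℝ} (hx : x ≤ 3 / 100 * B.N) :
    Real.exp x * weight (B := B) (fun _ => 0) ^ B.N ≤ (1 / 4) ^ B.N := by
  have h1 : Real.exp (3 / 100) ≤ 100 / 97 := by
    have := Real.one_sub_le_exp_neg (3 / 100)
    rw [Real.exp_neg] at this
    have hpos := Real.exp_pos (3 / 100)
    have h2 := mul_le_mul_of_nonneg_left this hpos.le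
    rw [mul_inv_cancel₀ hpos.ne'] at h2
    linarith
  have hw : 0 ≤ weight (B := B) (fun _ => 0) := by
    rw [weight_zero]; positivity
  calc _ ≤ Real.exp (3 / 100) ^ B.N * weight (B := B) (fun _ => 0) ^ B.N := by
        rw [← Real.exp_nat_mul]
        gcongr
        linarith
    _ = (Real.exp (3 / 100) * weight (B := B) (fun _ => 0)) ^ B.N := (mul_pow _ _ _).symm
    _ ≤ _ := by
        have := weight_zero_le hK
        gcongr
        calc _ ≤ 100 / 97 * (23 / 100 : ℝ) := by gcongr
          _ ≤ _ := by norm_num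

theorem add_two_mul_quarter_pow_le {N : ℕ} (hN : 0 < N) :
    ((N + 2 : ℕ) : ℝ) * (1 / 4) ^ N ≤ 3 / 4 := by
  obtain ⟨N, rfl⟩ := Nat.exists_eq_succ_of_ne_zero hN.ne'
  have h := one_add_mul_le_pow (show (-2 : ℝ) ≤ 3 by norm_num) N
  norm_num at h
  rw [one_div, inv_pow, ← div_eq_mul_inv, div_le_iff₀ (by positivity), pow_succ]
  push_cast
  nlinarith

theorem deficit_le_mul_card {N : ℕ} (r : ℕ) (c : Fin N → ℕ) :
    deficit r c ≤ r * (Finset.univ.filter fun j => c j < r).card := by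
  rw [deficit, Finset.card_filter, Finset.mul_sum]
  refine Finset.sum_le_sum fun j _ => ?_
  split_ifs <;> omega

/-- The hidden arms can be chosen such that from every initial state, many wrong actions are taken
with probability at least `3 / 16`. -/
theorem exists_measure_wrongs_le (hK : 5 ≤ B.K) (hδε : B.δ + B.ε ≤ 1 / 4)
    (hδη : B.δ + B.ε ≤ 2 * B.η) (hqη : B.q ≤ B.η) {r n : ℕ} {ϑ : ℝ} (hr : 0 < r) (hn : 0 < n)
    (hϑ : 0 ≤ ϑ) (hϑ1 : ϑ ≤ 1)
    (hinc : ∀ c : Fin B.N → ℕ, (B.N * r / 1000 : ℝ) < deficit r c →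
      ϑ * B.N ≤ (Finset.univ.filter fun j => c j < r).card)
    (hε : 10000 * B.ε ^ 2 / (B.δ * B.K) * n ≤ B.N / 100) (hrn : B.N * r ≤ ϑ * n / 64)
    (hlong : 30 * B.N ≤ B.η * ϑ * n / 32)
    {𝒜 : ActionSets (B.N + 2) B.A} (π : Policy 𝒜) :
    ∃ θ : Fin B.N → Fin B.K, ∀ s, ((B.mdp fun j => θ j).toSMDP 𝒜).trajLaw π s
      {ω | (wrongs (fun j => θ j) (counts n ω) : ℝ) < B.N * r / 1000} ≤ ENNReal.ofReal (13 / 16) := by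
  set w₀ : ℝ := B.N * r / 1000 with hw₀
  -- Otherwise for every `θ` the sum over initial states of the probabilities exceeds `13 / 16`. But
  -- summed also over `θ`, these are at most `K ^ N` times `(N + 2) / 4 ^ N ≤ 3 / 4` plus `1 / 16`
  -- from the event of a large deficit.
  by_contra! hcon
  have hr' : (0 : ℝ) < r := by exact_mod_cast hr
  have hN1 : (1 : ℝ) ≤ B.N := by exact_mod_cast B.N_pos
  have hη := B.η_pos
  have hKpos := K_pos' (B := B)
  have hdef : ∀ (θ : Fin B.N → Fin B.K) (s : Fin (B.N + 2)),
      ((B.mdp fun j => θ j).toSMDP 𝒜).trajLaw π s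
        {ω | (wrongs (fun j => θ j) (counts n ω) : ℝ) < w₀ ∧
          w₀ < deficit r fun j => visits (counts n ω j)} ≤
        ENNReal.ofReal (2 * Real.exp (-(30 * B.N))) := fun θ s => by
    refine (measure_deficit_le (fun j => θ j) (fun j => (θ j).2) r hϑ hϑ1 hδε hδη hqη hinc π s
      hn).trans (ENNReal.ofReal_le_ofReal ?_)
    gcongr
    have h1 : B.N * r + 3 * ϑ / 16 * w₀ - ϑ / 16 * n ≤ -(ϑ * n / 32) := by
      rw [hw₀]
      have : ϑ * (B.N * r : ℝ) ≤ 1 * (B.N * r) := by gcongr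
      have h0 : 0 ≤ (B.N * r : ℝ) := by positivity
      linarith
    have h2 := mul_le_mul_of_nonneg_left h1 hη.le
    linarith
  have hlik : ∀ s : Fin (B.N + 2), ∑ θ : Fin B.N → Fin B.K,
      ((B.mdp fun j => θ j).toSMDP 𝒜).trajLaw π s
        {ω | (wrongs (fun j => θ j) (counts n ω) : ℝ) < w₀ ∧
          (deficit r fun j => visits (counts n ω j)) ≤ w₀} ≤
        ENNReal.ofReal (B.K ^ B.N * (1 / 4) ^ B.N) := fun s => by
    refine (sum_measure_le (by linarith) (l := 10 / r) (by positivity)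
      (div_mul_cancel₀ _ hr'.ne') π s n).trans (ENNReal.ofReal_le_ofReal ?_)
    gcongr
    rw [← mul_assoc, ← Real.exp_add]
    refine exp_mul_weight_pow_le hK ?_
    have : 10 / r * (w₀ + w₀) = B.N / 50 := by rw [hw₀]; field_simp; norm_num
    rw [this]; linarith
  have hsum : ∑ θ : Fin B.N → Fin B.K, ∑ s, ((B.mdp fun j => θ j).toSMDP 𝒜).trajLaw π s
      {ω | (wrongs (fun j => θ j) (counts n ω) : ℝ) < w₀} ≤
      ENNReal.ofReal (B.K ^ B.N * (13 / 16)) := by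
    calc _ ≤ ∑ θ : Fin B.N → Fin B.K, ∑ s, (((B.mdp fun j => θ j).toSMDP 𝒜).trajLaw π s
          {ω | (wrongs (fun j => θ j) (counts n ω) : ℝ) < w₀ ∧
            (deficit r fun j => visits (counts n ω j)) ≤ w₀} +
          ENNReal.ofReal (2 * Real.exp (-(30 * B.N)))) := by
          gcongr with θ _ s _
          refine le_trans ?_ (add_le_add_right (hdef θ s) _)
          refine le_trans (measure_mono fun ω hω => ?_) (measure_union_le _ _)
          rcases le_or_gt ((deficit r fun j => visits (counts n ω j) : ℕ) : ℝ) w₀ with h | h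
          · exact Or.inl ⟨hω, h⟩
          · exact Or.inr ⟨hω, h⟩
      _ = ∑ s, ∑ θ : Fin B.N → Fin B.K, ((B.mdp fun j => θ j).toSMDP 𝒜).trajLaw π s
          {ω | (wrongs (fun j => θ j) (counts n ω) : ℝ) < w₀ ∧
            (deficit r fun j => visits (counts n ω j)) ≤ w₀} +
          ∑ _θ : Fin B.N → Fin B.K, ∑ _s : Fin (B.N + 2),
            ENNReal.ofReal (2 * Real.exp (-(30 * B.N))) := by
          simp only [Finset.sum_add_distrib]
          rw [Finset.sum_comm]
      _ ≤ ∑ _s : Fin (B.N + 2), ENNReal.ofReal (B.K ^ B.N * (1 / 4) ^ B.N) +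
          ∑ _θ : Fin B.N → Fin B.K, ∑ _s : Fin (B.N + 2),
            ENNReal.ofReal (2 * Real.exp (-(30 * B.N))) := by
          gcongr with s _
          exact hlik s
      _ = ENNReal.ofReal (B.K ^ B.N * (((B.N + 2 : ℕ) : ℝ) * (1 / 4) ^ B.N +
            ((B.N + 2 : ℕ) : ℝ) * (2 * Real.exp (-(30 * B.N))))) := by
          simp only [Finset.sum_const, Finset.card_univ, Fintype.card_fin, nsmul_eq_mul,
            Fintype.card_fun]
          rw [← ENNReal.ofReal_natCast, ← ENNReal.ofReal_natCast (B.K ^ B.N),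
            ← ENNReal.ofReal_mul (by positivity), ← ENNReal.ofReal_mul (by positivity),
            ← ENNReal.ofReal_mul (by positivity), ← ENNReal.ofReal_add (by positivity)
              (by positivity)]
          congr 1
          push_cast
          ring
      _ ≤ _ := by
          refine ENNReal.ofReal_le_ofReal ?_
          gcongr
          have h1 := add_two_mul_quarter_pow_le B.N_pos
          have h2 : ((B.N + 2 : ℕ) : ℝ) * (2 * Real.exp (-(30 * B.N))) ≤ 1 / 16 := by
            have h3 := Real.quadratic_le_exp_of_nonneg (x := 30 * B.N) (by positivity)
            rw [Real.exp_neg, ← mul_assoc, ← div_eq_mul_inv, div_le_iff₀ (Real.exp_pos _)]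
            push_cast
            nlinarith
          linarith
  have hgt : ENNReal.ofReal (B.K ^ B.N * (13 / 16)) < ∑ θ : Fin B.N → Fin B.K, ∑ s,
      ((B.mdp fun j => θ j).toSMDP 𝒜).trajLaw π s
        {ω | (wrongs (fun j => θ j) (counts n ω) : ℝ) < w₀} := by
    have h1 : ENNReal.ofReal (B.K ^ B.N * (13 / 16)) =
        ∑ _θ : Fin B.N → Fin B.K, ENNReal.ofReal (13 / 16) := by
      simp only [Finset.sum_const, Finset.card_univ, Fintype.card_fin, nsmul_eq_mul,
        Fintype.card_fun]
      rw [← ENNReal.ofReal_natCast, ← ENNReal.ofReal_mul (by positivity)]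
      push_cast; rfl
    rw [h1]
    have : Nonempty (Fin B.K) := ⟨⟨0, B.K_pos⟩⟩
    refine ENNReal.sum_lt_sum_of_nonempty Finset.univ_nonempty fun θ _ => ?_
    obtain ⟨s, hs⟩ := hcon θ
    exact hs.trans_le (Finset.single_le_sum (f := fun s =>
      ((B.mdp fun j => θ j).toSMDP 𝒜).trajLaw π s
        {ω | (wrongs (fun j => θ j) (counts n ω) : ℝ) < w₀}) (fun _ _ => zero_le)
        (Finset.mem_univ s))
  exact absurd hsum (not_le.2 hgt)

/-- If many wrong actions are taken with probability at least `3 / 16`, this holds in the mean. -/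
theorem le_integral_wrong (θ : Fin B.N → ℕ) {𝒜 : ActionSets (B.N + 2) B.A} (π : Policy 𝒜)
    (s : Fin (B.N + 2)) {n : ℕ} {w₀ : ℝ} (hw₀ : 0 ≤ w₀)
    (h : ((B.mdp θ).toSMDP 𝒜).trajLaw π s {ω | (wrongs θ (counts n ω) : ℝ) < w₀} ≤
      ENNReal.ofReal (13 / 16)) :
    3 / 16 * w₀ ≤ ∫ ω, FiniteMDP.transSum (fun s a _ => (B.wrong θ s a : ℝ)) n ω
      ∂(((B.mdp θ).toSMDP 𝒜).trajLaw π s) := by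
  set P := ((B.mdp θ).toSMDP 𝒜).trajLaw π s with hP
  have hm : MeasurableSet {ω : ℕ → Obs (B.N + 2) B.A | (wrongs θ (counts n ω) : ℝ) < w₀} :=
    measurable_stat B.upd 0 n
      (MeasurableSet.of_discrete (s := {v : B.Counts | (wrongs θ v : ℝ) < w₀}))
  have h1 := mul_meas_ge_le_integral_of_nonneg (μ := P)
    (f := FiniteMDP.transSum (fun s a _ => (B.wrong θ s a : ℝ)) n)
    (Filter.Eventually.of_forall fun ω => by
      rw [← wrongs_counts]; exact Nat.cast_nonneg _)
    (FiniteMDP.integrable_transSum P _ n) w₀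
  have h2 : {ω : ℕ → Obs (B.N + 2) B.A |
      w₀ ≤ FiniteMDP.transSum (fun s a _ => (B.wrong θ s a : ℝ)) n ω} =
      {ω | (wrongs θ (counts n ω) : ℝ) < w₀}ᶜ := by
    ext ω
    simp [← wrongs_counts]
  have h3 : P.real {ω | (wrongs θ (counts n ω) : ℝ) < w₀} ≤ 13 / 16 :=
    ENNReal.toReal_le_of_le_ofReal (by norm_num) h
  rw [h2, measureReal_compl hm] at h1
  simp only [probReal_univ] at h1
  nlinarith

theorem meanReward_mdp (θ : Fin B.N → ℕ) {𝒜 : ActionSets (B.N + 2) B.A} (s : Fin (B.N + 2))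
    (a : Fin B.A) :
    ((B.mdp θ).toSMDP 𝒜).meanReward s a = ∑ s', B.w θ s a s' * B.rew s a s' := by
  refine Finset.sum_congr rfl fun s' _ => ?_
  change (ENNReal.ofReal (B.w θ s a s')).toReal * ∫ x, x.1 ∂(Measure.dirac (B.rew s a s', B.T)) = _
  rw [ENNReal.toReal_ofReal (show 0 ≤ B.w θ s a s' from (B.mdp θ).w_nonneg s a s'),
      integral_dirac]

theorem meanHolding_mdp (θ : Fin B.N → ℕ) {𝒜 : ActionSets (B.N + 2) B.A} (s : Fin (B.N + 2))
    (a : Fin B.A) : ((B.mdp θ).toSMDP 𝒜).meanHolding s a = B.T := by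
  have h : ((B.mdp θ).toSMDP 𝒜).meanHolding s a = ∑ s', B.w θ s a s' * B.T := by
    refine Finset.sum_congr rfl fun s' _ => ?_
    change (ENNReal.ofReal (B.w θ s a s')).toReal *
      ∫ x, x.2 ∂(Measure.dirac (B.rew s a s', B.T)) = _
    rw [ENNReal.toReal_ofReal (show 0 ≤ B.w θ s a s' from (B.mdp θ).w_nonneg s a s'),
      integral_dirac]
  have hw : ∑ s', B.w θ s a s' = 1 := (B.mdp θ).w_sum s a
  rw [h, ← Finset.sum_mul, hw, one_mul]

theorem rew_mem (hR₁ : 0 ≤ B.R₁) (hR₂ : 0 ≤ B.R₂) (hR₃ : 0 ≤ B.R₃) {C : ℝ} (h₁ : B.R₁ ≤ C)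
    (h₂ : B.R₂ ≤ C) (h₃ : B.R₃ ≤ C) (s : Fin (B.N + 2)) (a : Fin B.A) (s' : Fin (B.N + 2)) :
    B.rew s a s' ∈ Set.Icc 0 C := by
  have hC : 0 ≤ C := hR₁.trans h₁
  revert s
  refine state_cases (fun j => ?_) ?_ ?_
  · revert s'
    refine state_cases (fun i => ?_) ?_ ?_ <;> simp only [rew, pick_ctx, pick_good, pick_far]
    all_goals split_ifs <;> constructor <;> first | assumption | exact le_rfl
  · exact ⟨by simpa [rew], by simpa [rew]⟩
  · exact ⟨by simpa [rew], by simpa [rew]⟩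

theorem meanReward_le (hR₁ : 0 ≤ B.R₁) {C : ℝ} (h₁ : (B.δ + B.ε) * B.R₁ ≤ C) (h₂ : B.R₂ ≤ C)
    (h₃ : B.R₃ ≤ C) (θ : Fin B.N → ℕ) (s : Fin (B.N + 2)) (a : Fin B.A) :
    ∑ s', B.w θ s a s' * B.rew s a s' ≤ C := by
  have hδε : 0 ≤ B.δ + B.ε := add_nonneg B.δ_pos.le B.ε_pos.le
  have hC : 0 ≤ C := (mul_nonneg hδε hR₁).trans h₁
  revert s
  refine state_cases (fun j => ?_) ?_ ?_
  · by_cases ha : a.1 < B.K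
    · rw [sum_w_arm θ j ha, avg_const _ (c := 0)]
      · have := mul_le_mul_of_nonneg_right (B.armProb_le θ j a) hR₁
        simp [rew, ha]; linarith
      · intro i; simp [rew]
    · refine le_of_eq_of_le (Finset.sum_eq_zero fun s' _ => ?_) hC
      simp [rew, ha]
  · rw [sum_w_good, avg_const _ (c := B.R₂)]
    · simp [rew]; linarith
    · intro i; simp [rew]
  · rw [sum_w_far, avg_const _ (c := B.R₃)]
    · exact h₃
    · intro i; simp [rew]

end HiddenArms

namespace HiddenArms

variable {B : HiddenArms}

/-- The decision processes with suitably chosen hidden arms are hard for a given algorithm. -/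
theorem exists_smdp (hK : 5 ≤ B.K) (hδε : B.δ + B.ε ≤ 1 / 4) (hδη : B.δ + B.ε ≤ 2 * B.η)
    (hqη : B.q ≤ B.η) {r n : ℕ} {ϑ : ℝ} (hr : 0 < r) (hϑ : 0 ≤ ϑ) (hϑ1 : ϑ ≤ 1)
    (hinc : ϑ = 1 / 1000 ∨ B.N = 1)
    (hε : 10000 * B.ε ^ 2 / (B.δ * B.K) * n ≤ B.N / 100) (hrn : B.N * r ≤ ϑ * n / 64)
    (hlong : 30 * B.N ≤ B.η * ϑ * n / 32) {k : ℕ} (hk : B.N ≤ B.b ^ k)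
    (hkD : (k : ℝ) ≤ 1 / B.q + 1 / B.η) {H G Tmax : ℝ} (hR₁ : 0 ≤ B.R₁) (hH : 0 ≤ H)
    (hqH : B.q * H ≤ B.δ * (B.R₁ + H)) (hR₂ : B.R₂ = (B.δ + B.ε) * (B.R₁ + H) + B.η * H)
    (hR₃ : B.R₃ = (B.δ + B.ε) * (B.R₁ + H)) (hG₁ : B.R₁ ≤ 1 / 2 * G * Tmax)
    (hG₂ : B.R₂ ≤ G * B.T) (hT : 2 * B.T ≤ Tmax) (hG : 0 < G)
    (π : Policy (ActionSets.full (B.N + 2) B.A B.A_pos)) :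
    ∃ (M : SMDP (ActionSets.full (B.N + 2) B.A B.A_pos)) (ρ : ℝ),
      M.diameter = ENNReal.ofReal (B.T * (1 / B.q + 2 / B.η)) ∧
      (∀ s a s', ∀ᵐ x ∂(M.law s a s'),
        x.1 ∈ Set.Icc 0 (1 / 2 * G * Tmax) ∧ x.2 ∈ Set.Icc B.T Tmax) ∧
      (∀ s a, M.meanReward s a ≤ G * M.meanHolding s a) ∧
      M.IsOptimalGain ρ ∧
      ∀ s, B.ε * (B.R₁ + H) * (3 / 16 * (B.N * r / 1000)) - H ≤ M.expectedRegret ρ π s n := by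
  have hη := B.η_pos; have hδ := B.δ_pos; have hε0 := B.ε_pos; have hT0 := B.T_pos
  have hN0 := B.N_pos'
  have hr0 : (0 : ℝ) < r := by exact_mod_cast hr
  have hn : 0 < n := by
    refine Nat.pos_of_ne_zero fun h => ?_
    rw [h, Nat.cast_zero, mul_zero, zero_div] at hlong
    linarith
  have hRH : 0 ≤ B.R₁ + H := by linarith
  have hηH : 0 ≤ B.η * H := by positivity
  have hR3 : 0 ≤ B.R₃ := by rw [hR₃]; positivity
  have hR32 : B.R₃ ≤ B.R₂ := by linarith
  have hR1 : (B.δ + B.ε) * B.R₁ ≤ B.R₃ := by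
    rw [hR₃]; gcongr; linarith
  have hGT : G * B.T ≤ 1 / 2 * G * Tmax := by nlinarith
  -- A context contributes at most `r` to the deficit, so a deficit above `N * r / 1000` needs at
  -- least `N / 1000` contexts lacking visits. If `N = 1`, the only context lacks visits and `ϑ = 1`
  -- is also allowed.
  obtain ⟨θ, hθ⟩ := exists_measure_wrongs_le hK hδε hδη hqη hr hn hϑ hϑ1 (fun c hc => by
    have h1 : (deficit r c : ℝ) ≤ r * (Finset.univ.filter fun j => c j < r).card := by
      exact_mod_cast deficit_le_mul_card r c
    rcases hinc with h | h
    · rw [h]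
      by_contra! h2
      have := mul_le_mul_of_nonneg_left h2.le hr0.le
      linarith
    · have hN1 : ϑ * (B.N : ℝ) = ϑ := by rw [h, Nat.cast_one, mul_one]
      rw [hN1]
      refine hϑ1.trans ?_
      have h2 : (Finset.univ.filter fun j => c j < r).card ≠ 0 := fun h3 => by
        rw [h3, Nat.cast_zero, mul_zero] at h1
        have : 0 ≤ (B.N * r / 1000 : ℝ) := by positivity
        linarith
      exact_mod_cast Nat.one_le_iff_ne_zero.2 h2) hε hrn hlong π
  refine ⟨(B.mdp fun j => θ j).toSMDP _, (B.δ + B.ε) * (B.R₁ + H) / B.T,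
    B.diameter_eq _ hk hkD, fun s a s' => ?_, fun s a => ?_,
    isOptimalGain_mdp hR₁ hH hqH hR₂ hR₃ θ, fun s => ?_⟩
  · refine (ae_dirac_iff ?_).2 ⟨rew_mem hR₁ (hR3.trans hR32) hR3 hG₁ (hG₂.trans hGT)
      (hR32.trans (hG₂.trans hGT)) s a s', le_rfl, by change B.T ≤ Tmax; linarith⟩
    exact (measurable_fst measurableSet_Icc).inter (measurable_snd measurableSet_Icc)
  · rw [meanReward_mdp, meanHolding_mdp]
    exact meanReward_le hR₁ (hR1.trans (hR32.trans hG₂)) hG₂ (hR32.trans hG₂) _ s a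
  · refine le_trans ?_ (le_expectedRegret_mdp hR₁ hH hqH hR₂ hR₃ (fun j => (θ j : ℕ)) π s n)
    have := le_integral_wrong (fun j => (θ j : ℕ)) π s (by positivity) (hθ s)
    gcongr

end HiddenArms

/-! ### Choice of the parameters. -/

section parameters

/-- The number of states that can be reached by `2 * Nat.clog A S` navigating actions. -/
theorem le_navigation_pow {S A : ℕ} (hA : 10 ≤ A) : S ≤ (A - 1 - A / 2) ^ (2 * Nat.clog A S) := by
  have h1 : A ≤ (A - 1 - A / 2) ^ 2 := by
    obtain ⟨b, hb⟩ : ∃ b, A - 1 - A / 2 = b := ⟨_, rfl⟩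
    have h2 : A ≤ 2 * b + 2 := by omega
    have h3 : 4 ≤ b := by omega
    rw [hb]
    nlinarith
  rw [pow_mul]
  exact (Nat.le_pow_clog (by omega) S).trans (Nat.pow_le_pow_left h1 _)

theorem two_mul_clog_le {S A : ℕ} {D : ℝ} (hS : 1 ≤ S) (hA : 1 < A)
    (hD : 20 * Real.logb A S ≤ D) :
    ((2 * Nat.clog A S : ℕ) : ℝ) ≤ D / 10 + 2 := by
  have h0 : 0 ≤ Real.logb A S :=
    Real.logb_nonneg (by exact_mod_cast hA) (by exact_mod_cast hS)
  have h1 := Nat.ceil_lt_add_one h0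
  rw [Real.natCeil_logb_natCast] at h1
  push_cast
  linarith

/-- Parameters for which there are hard decision processes. -/
theorem exists_smdp_of_parameters {S A n : ℕ} {Tmin Tmax G D η δ ϑ R₁ H : ℝ} (hS : 10 ≤ S)
    (hA : 10 ≤ A) (hTmin : 0 < Tmin) (hTmax : 3 * Tmin ≤ Tmax) (hG : 0 < G)
    (hD : 20 * Real.logb A S ≤ D / Tmin) (hη : 0 < η) (hη1 : η ≤ 1)
    (hδ : 0 < δ) (hδ1 : δ ≤ 1 / 12) (hδη : δ ≤ η) (hqη : 1 / η + 2 / η ≤ D / Tmin)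
    (hq : 2 + 2 / η ≤ D / Tmin) (hkD : D / Tmin / 10 + 2 + 1 / η ≤ D / Tmin)
    (hδn : (S * A : ℝ) / 4 ≤ δ * n)
    (hϑ : ϑ = 1 / 1000 ∧ 128000 * (S / 16000 + 1 : ℕ) ≤ n ∨
      ϑ = 1 ∧ S / 16000 + 1 = 1 ∧ 1200 ≤ n)
    (hlong : 30 * (S / 16000 + 1 : ℕ) ≤ η * ϑ * n / 32) (hR₁ : 0 ≤ R₁) (hH : 0 ≤ H)
    (hqH : H ≤ δ * (R₁ + H) * (D / Tmin - 2 / η)) (hG₁ : R₁ ≤ 1 / 2 * G * Tmax)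
    (hG₂ : 3 / 2 * δ * (R₁ + H) + η * H ≤ G * Tmin)
    (alg : (m : ℕ) → (𝒜 : ActionSets m A) → Policy 𝒜) :
    ∃ (m : ℕ) (𝒜 : ActionSets m A) (M : SMDP 𝒜) (ρ : ℝ), m ≤ S ∧
      M.diameter = ENNReal.ofReal D ∧
      (∀ s, ∀ a ∈ 𝒜.acts s, ∀ s', ∀ᵐ x ∂(M.law s a s'),
        x.1 ∈ Set.Icc 0 (1 / 2 * G * Tmax) ∧ x.2 ∈ Set.Icc Tmin Tmax) ∧
      (∀ s, ∀ a ∈ 𝒜.acts s, M.meanReward s a ≤ G * M.meanHolding s a) ∧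
      M.IsOptimalGain ρ ∧
      ∀ s : Fin m, √(2 / 10 ^ 11 * (S * A * δ / n)) * (R₁ + H) * (n * (3 / 2048000000)) - H ≤
        M.expectedRegret ρ (alg m 𝒜) s n := by
  obtain ⟨N, hN⟩ : ∃ N, N = S / 16000 + 1 := ⟨_, rfl⟩
  obtain ⟨K, hK⟩ : ∃ K, K = A / 2 := ⟨_, rfl⟩
  rw [← hN] at hϑ hlong
  have hN0 : 0 < N := by omega
  have hN1 : (1 : ℝ) ≤ N := by exact_mod_cast hN0
  have hNS : N + 2 ≤ S := by omega
  have hNS' : (N : ℝ) ≤ S := by exact_mod_cast (show N ≤ S by omega)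
  have hSN : (S : ℝ) ≤ 16000 * N := by exact_mod_cast (show S ≤ 16000 * N by omega)
  have hK5 : 5 ≤ K := by omega
  have hK0 : (0 : ℝ) < K := by exact_mod_cast (show 0 < K by omega)
  have hKA : (K : ℝ) ≤ A := by exact_mod_cast (show K ≤ A by omega)
  have hAK : (A : ℝ) ≤ 3 * K := by exact_mod_cast (show A ≤ 3 * K by omega)
  have hS0 : (0 : ℝ) < S := by linarith
  have hA0 : (0 : ℝ) < A := by linarith
  have hn : (0 : ℝ) < n := by
    by_contra! h
    have := mul_nonpos_of_nonneg_of_nonpos hδ.le h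
    have : 0 < (S * A : ℝ) / 4 := by positivity
    linarith
  have hq0 : 0 < D / Tmin - 2 / η := by linarith
  -- The largest gap that is not detected: the growth `10000 * ε² / (δ * K) * n` of the exponent
  -- equals `N / 100`.
  obtain ⟨ε, hεdef⟩ : ∃ ε, ε = √(1 / 10 ^ 6 * (N * K * δ / n)) := ⟨_, rfl⟩
  have hε0 : 0 < ε := by rw [hεdef]; positivity
  have hεsq : ε ^ 2 = 1 / 10 ^ 6 * (N * K * δ / n) := by
    rw [hεdef, Real.sq_sqrt (by positivity)]
  have hεδ : ε ≤ δ / 2 := by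
    rw [hεdef]
    refine Real.sqrt_le_iff.2 ⟨by positivity, ?_⟩
    have h1 : (N * K : ℝ) ≤ S * A := by gcongr
    rw [div_eq_mul_inv _ (n : ℝ), ← sub_nonneg]
    have h2 : (δ / 2) ^ 2 - 1 / 10 ^ 6 * (N * K * δ * (n : ℝ)⁻¹) =
        δ * (n : ℝ)⁻¹ * (δ * n / 4 - 1 / 10 ^ 6 * (N * K)) := by field_simp; ring
    rw [h2]
    have h3 : 0 < δ * (n : ℝ)⁻¹ := by positivity
    have h4 : (0 : ℝ) < S * A := by positivity
    refine mul_nonneg h3.le ?_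
    linarith
  have hεge : √(2 / 10 ^ 11 * (S * A * δ / n)) ≤ ε := by
    rw [hεdef]
    refine Real.sqrt_le_sqrt ?_
    have h1 : (S * A : ℝ) ≤ 16000 * N * (3 * K) := by gcongr
    calc (2 : ℝ) / 10 ^ 11 * (S * A * δ / n) ≤
          2 / 10 ^ 11 * (16000 * N * (3 * K) * δ / n) := by gcongr
      _ = 96000 / 10 ^ 11 * (N * K * δ / n) := by ring
      _ ≤ _ := by gcongr ?_ * _; norm_num
  have hϑ01 : 0 ≤ ϑ ∧ ϑ ≤ 1 := by
    rcases hϑ with ⟨h, _⟩ | ⟨h, _⟩ <;> rw [h] <;> norm_num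
  have hNR : (0 : ℝ) < N := by linarith
  -- Then `N * r` is at least `n / 128000`, yet at most `n / 64000` if `128000 * N ≤ n`, which is
  -- the required `ϑ * n / 64` for `ϑ = 1 / 1000`. The factor `3 / 2048000000` of the conclusion is
  -- `3 / 16 / 1000 / 128000`.
  obtain ⟨r, hr⟩ : ∃ r, r = ⌈(n : ℝ) / (128000 * N)⌉₊ := ⟨_, rfl⟩
  have hr1 : (n : ℝ) / 128000 ≤ N * r := by
    have := Nat.le_ceil ((n : ℝ) / (128000 * N))
    rw [← hr, div_le_iff₀ (by positivity)] at this
    linarith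
  have hr2 : (N * r : ℝ) ≤ n / 128000 + N := by
    have := (Nat.ceil_lt_add_one (a := (n : ℝ) / (128000 * N)) (by positivity)).le
    rw [← hr] at this
    have h2 := mul_le_mul_of_nonneg_left this hNR.le
    have h3 : (N : ℝ) * ((n : ℝ) / (128000 * N) + 1) = n / 128000 + N := by field_simp
    linarith
  have hr0 : 0 < r := by rw [hr]; exact Nat.ceil_pos.2 (by positivity)
  -- The exit probability solves `Tmin * (1 / q + 2 / η) = D`.
  let B : HiddenArms :=
    { N := N, K := K, A := A, q := 1 / (D / Tmin - 2 / η), η := η, δ := δ, ε := ε, R₁ := R₁,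
      R₂ := (δ + ε) * (R₁ + H) + η * H, R₃ := (δ + ε) * (R₁ + H), T := Tmin, N_pos := hN0,
      K_pos := by omega, K_le := by omega, q_pos := by positivity,
      q_le := by rw [mul_one_div, div_le_one hq0]; linarith
      η_pos := hη, η_le := hη1, δ_pos := hδ, ε_pos := hε0, δε_le := by linarith, T_pos := hTmin }
  have hqB : 1 / B.q = D / Tmin - 2 / η := one_div_one_div _
  have hRH : 0 ≤ R₁ + H := by linarith
  obtain ⟨M, ρ, h1, h2, h3, h4, h5⟩ := HiddenArms.exists_smdp (B := B) (r := r) (n := n) (ϑ := ϑ)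
    (k := 2 * Nat.clog A S) (H := H) (G := G) (Tmax := Tmax) hK5
    (show δ + ε ≤ 1 / 4 by linarith) (show δ + ε ≤ 2 * η by linarith)
    (show 1 / (D / Tmin - 2 / η) ≤ η by
      rw [one_div_le hq0 hη]; linarith) hr0 hϑ01.1 hϑ01.2
    (hϑ.imp (fun h => h.1) (fun h => h.2.1))
    (show 10000 * ε ^ 2 / (δ * K) * n ≤ N / 100 by
      rw [hεsq]; apply le_of_eq; field_simp; norm_num)
    (show (N : ℝ) * r ≤ ϑ * n / 64 by
      rcases hϑ with ⟨h, h'⟩ | ⟨h, h', h''⟩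
      · have : 128000 * (N : ℝ) ≤ n := by exact_mod_cast h'
        rw [h]; linarith
      · have : (1200 : ℝ) ≤ n := by exact_mod_cast h''
        have hN' : (N : ℝ) = 1 := by exact_mod_cast h'
        rw [h]; linarith) hlong
    ((show N ≤ S by omega).trans (by
      have := le_navigation_pow (S := S) hA
      rwa [← hK] at this))
    (by
      rw [hqB]
      change _ ≤ _ + 1 / η
      have := two_mul_clog_le (by omega) (by omega) hD
      have h2η : 2 / η = 1 / η + 1 / η := by ring
      linarith) hR₁ hH
    (show 1 / (D / Tmin - 2 / η) * H ≤ δ * (R₁ + H) by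
      rwa [one_div_mul_eq_div, div_le_iff₀ hq0]) rfl rfl hG₁
    (show (δ + ε) * (R₁ + H) + η * H ≤ G * Tmin by
      refine le_trans ?_ hG₂
      gcongr
      linarith) (show 2 * Tmin ≤ Tmax by linarith) hG (alg _ _)
  refine ⟨N + 2, _, M, ρ, hNS, ?_, fun s a _ => h2 s a, fun s a _ => h3 s a, h4, fun s => ?_⟩
  · rw [h1, hqB]
    congr 1
    change Tmin * (D / Tmin - 2 / η + 2 / η) = D
    field_simp
    ring
  · refine le_trans ?_ (h5 s)
    change _ ≤ ε * (R₁ + H) * (3 / 16 * ((N : ℝ) * r / 1000)) - H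
    refine sub_le_sub_right (mul_le_mul (mul_le_mul_of_nonneg_right hεge hRH) ?_ (by positivity)
      (by positivity)) _
    linarith

end parameters

end

theorem short_diameter_bound {S A n T Tmax G D : ℝ} (hS : 0 < S) (hA : 0 < A) (hn : 0 < n)
    (hT : 1 ≤ T) (hTmax : 0 < Tmax) (hG : 0 < G) (hD : D ≤ 4 * 10 ^ 26 * Tmax) :
    1 / 10 ^ 30 * ((√D + √Tmax) * G * √(S * A * n)) ≤
      √(2 / 10 ^ 11 * (S * A * (T / (4 * Tmax)) / n)) * (G * Tmax / 4 + 0) *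
        (n * (3 / 2048000000)) - 0 := by
  have hu : 0 ≤ √Tmax := Real.sqrt_nonneg _
  have hX : 0 ≤ √(S * A * n) := Real.sqrt_nonneg _
  have hD' : √D ≤ 2 * 10 ^ 13 * √Tmax := by
    refine Real.sqrt_le_iff.2 ⟨by positivity, ?_⟩
    rw [mul_pow, Real.sq_sqrt hTmax.le]
    linarith
  have h1 : 2 / 10 ^ 6 * (√Tmax * √(S * A * n)) / (Tmax * n) ≤
      √(2 / 10 ^ 11 * (S * A * (T / (4 * Tmax)) / n)) := by
    refine Real.le_sqrt_of_sq_le ?_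
    rw [div_pow, mul_pow, mul_pow, Real.sq_sqrt hTmax.le, Real.sq_sqrt (by positivity)]
    calc _ = 4 / 10 ^ 12 * (S * A * (1 / Tmax) / n) := by field_simp; norm_num
      _ ≤ 5 / 10 ^ 12 * (S * A * (T / Tmax) / n) := by gcongr; norm_num
      _ = _ := by field_simp; norm_num
  have h2 : 0 ≤ √Tmax * √(S * A * n) * G := by positivity
  calc _ ≤ 1 / 10 ^ 30 * ((2 * 10 ^ 13 * √Tmax + √Tmax) * G * √(S * A * n)) := by gcongr
    _ = (2 * 10 ^ 13 + 1) / 10 ^ 30 * (√Tmax * √(S * A * n) * G) := by ring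
    _ ≤ 2 / 10 ^ 6 / 4 * (3 / 2048000000) * (√Tmax * √(S * A * n) * G) := by
        gcongr; norm_num
    _ = 2 / 10 ^ 6 * (√Tmax * √(S * A * n)) / (Tmax * n) * (G * Tmax / 4 + 0) *
        (n * (3 / 2048000000)) - 0 := by field_simp; ring
    _ ≤ _ := by gcongr

/-- The loss `H` is of order `G * D`. It is absorbed by the main term because `n ≥ D * S * A` gives
`√D * √(S * A * n) ≥ 100 * D`, and because the factor `10 ^ 26` in `δ` outweighs the small
constants. -/
theorem long_diameter_bound {S A n T Tmax G D : ℝ} (hS : 10 ≤ S) (hA : 10 ≤ A)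
    (hn : D * S * A ≤ n) (hT : 1 ≤ T) (hG : 0 < G) (hD : 0 < D) (hTD : Tmax ≤ D) :
    1 / 10 ^ 30 * ((√D + √Tmax) * G * √(S * A * n)) ≤
      √(2 / 10 ^ 11 * (S * A * (10 ^ 26 * T / D) / n)) * (0 + G * D / (3 * 10 ^ 26)) *
        (n * (3 / 2048000000)) - G * D / (3 * 10 ^ 26) := by
  have hn0 : 0 < n := lt_of_lt_of_le (by positivity) hn
  have hu : 0 ≤ √D := Real.sqrt_nonneg _
  have hX : 0 ≤ √(S * A * n) := Real.sqrt_nonneg _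
  have hSA : 100 ≤ S * A := by nlinarith
  have h1 : 10 ^ 7 * (√D * √(S * A * n)) / (D * n) ≤
      √(2 / 10 ^ 11 * (S * A * (10 ^ 26 * T / D) / n)) := by
    refine Real.le_sqrt_of_sq_le ?_
    rw [div_pow, mul_pow, mul_pow, Real.sq_sqrt hD.le, Real.sq_sqrt (by positivity)]
    calc _ = 10 ^ 14 * (S * A * (1 / D) / n) := by field_simp
      _ ≤ 2 * 10 ^ 15 * (S * A * (T / D) / n) := by gcongr; norm_num
      _ = _ := by field_simp
  have h2 : 100 * √D ≤ √(S * A * n) := by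
    refine Real.le_sqrt_of_sq_le ?_
    rw [mul_pow, Real.sq_sqrt hD.le]
    calc (100 : ℝ) ^ 2 * D = 100 * (D * 100) := by ring
      _ ≤ S * A * (D * (S * A)) := by gcongr
      _ ≤ S * A * n := by gcongr; linarith
  have h3 : 100 * D ≤ √D * √(S * A * n) := by
    calc 100 * D = √D * (100 * √D) := by rw [mul_left_comm, Real.mul_self_sqrt hD.le]
      _ ≤ _ := by gcongr
  have h4 : 0 ≤ √D * √(S * A * n) := by positivity
  calc _ ≤ 1 / 10 ^ 30 * ((√D + √D) * G * √(S * A * n)) := by gcongr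
    _ = 2 / 10 ^ 30 * (√D * √(S * A * n)) * G := by ring
    _ ≤ (10 ^ 7 * (3 / 2048000000) / (3 * 10 ^ 26) * (√D * √(S * A * n)) -
          D / (3 * 10 ^ 26)) * G := by
        gcongr
        linarith
    _ = 10 ^ 7 * (√D * √(S * A * n)) / (D * n) * (0 + G * D / (3 * 10 ^ 26)) *
        (n * (3 / 2048000000)) - G * D / (3 * 10 ^ 26) := by field_simp; ring
    _ ≤ _ := by gcongr

theorem theorem2 :
    ∃ c : ℝ, 0 < c ∧
      ∀ (S A : ℕ) (Tmin Tmax Rmax D : ℝ) (n : ℕ),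
        10 ≤ S → 10 ≤ A → 3 ≤ 3 * Tmin → 3 * Tmin ≤ Tmax → 0 < Rmax →
        max (20 * Tmin * Real.logb A S) (12 * Tmin) < D →
        max D Tmax * S * A ≤ n →
        -- a learning algorithm is told the state space and the available actions
        ∀ alg : (m : ℕ) → (𝒜 : ActionSets m A) → Policy 𝒜,
          ∃ (m : ℕ) (𝒜 : ActionSets m A) (M : SMDP 𝒜) (ρ : ℝ),
            m ≤ S ∧
            M.diameter = ENNReal.ofReal D ∧
            (∀ s, ∀ a ∈ 𝒜.acts s, ∀ s', ∀ᵐ x ∂(M.law s a s'),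
              x.1 ∈ Set.Icc 0 (1 / 2 * Rmax * Tmax) ∧ x.2 ∈ Set.Icc Tmin Tmax) ∧
            (∀ s, ∀ a ∈ 𝒜.acts s, M.meanReward s a ≤ Rmax * M.meanHolding s a) ∧
            M.IsOptimalGain ρ ∧
            ∀ s : Fin m,
              c * ((√D + √Tmax) * Rmax * √((S : ℝ) * A * n)) ≤
                M.expectedRegret ρ (alg m 𝒜) s n := by
  refine ⟨1 / 10 ^ 30, by positivity, ?_⟩
  intro S A Tmin Tmax G D n hS hA hTmin hTmax hG hD hn alg
  have hT1 : 1 ≤ Tmin := by linarith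
  have hT0 : 0 < Tmin := by linarith
  have hT : 0 < Tmax := by linarith
  have hS' : (10 : ℝ) ≤ S := by exact_mod_cast hS
  have hA' : (10 : ℝ) ≤ A := by exact_mod_cast hA
  obtain ⟨hDlog, hD12⟩ := max_lt_iff.1 hD
  have hD0 : 0 < D := by linarith
  have hSA0 : (0 : ℝ) < S * A := by positivity
  have hSA : (100 : ℝ) ≤ S * A := by nlinarith
  have hSA10 : (10 * S : ℝ) ≤ S * A := by nlinarith
  have hnD : D * S * A ≤ n := le_trans (by gcongr; exact le_max_left _ _) hn
  have hnT : Tmax * S * A ≤ n := le_trans (by gcongr; exact le_max_right _ _) hn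
  have hn0 : (0 : ℝ) < n := lt_of_lt_of_le (by positivity) hnD
  have hlog : 20 * Real.logb A S ≤ D / Tmin := by
    rw [le_div_iff₀ hT0]; linarith
  have hDT : 12 ≤ D / Tmin := by rw [le_div_iff₀ hT0]; linarith
  have hn12 : 12 * (S * A : ℝ) ≤ n := by
    have : 12 * (S * A : ℝ) ≤ D * (S * A) := by gcongr; linarith
    linarith
  have hn120 : 120 * S ≤ n := by
    have : 120 * (S : ℝ) ≤ n := by linarith
    exact_mod_cast this
  -- For small `D`, `√D` is at most a constant times `√Tmax` and large rewards of successes do the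
  -- work. For large `D`, the bias of `good` does; the threshold ensures `δ = 10 ^ 26 * Tmin / D ≤ 1
  -- / 12`.
  rcases le_or_gt D (4 * 10 ^ 26 * Tmax) with hshort | hlong
  -- If `S ≥ 16000`, then `N = S / 16000 + 1 ≤ S / 8000`, hence `960000 * N ≤ 120 * S ≤ n`, which is
  -- what `30 * N ≤ ϑ * n / 32` asks for. Smaller `S` have a single context, for which `ϑ = 1` and
  -- `n ≥ 1200` suffice.
  · have hϑ : ∃ ϑ : ℝ, (ϑ = 1 / 1000 ∧ 128000 * (S / 16000 + 1 : ℕ) ≤ n ∨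
        ϑ = 1 ∧ S / 16000 + 1 = 1 ∧ 1200 ≤ n) ∧
        30 * ((S / 16000 + 1 : ℕ) : ℝ) ≤ 1 * ϑ * n / 32 := by
      by_cases hN : S / 16000 = 0
      · have h12 : 1200 ≤ n := by omega
        have h12' : (1200 : ℝ) ≤ n := by exact_mod_cast h12
        refine ⟨1, Or.inr ⟨rfl, by omega, h12⟩, ?_⟩
        rw [hN]; norm_num; linarith
      · refine ⟨1 / 1000, Or.inl ⟨rfl, by omega⟩, ?_⟩
        have : 960000 * (S / 16000 + 1 : ℕ) ≤ n := by omega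
        have : 960000 * ((S / 16000 + 1 : ℕ) : ℝ) ≤ n := by exact_mod_cast this
        linarith
    obtain ⟨ϑ, hϑ, hNn⟩ := hϑ
    have hδR : Tmin / (4 * Tmax) * (G * Tmax / 4) = G * Tmin / 16 := by field_simp; norm_num
    have hGT : 0 < G * Tmin := by positivity
    -- Successes are rare and pay of order `G * Tmax`, so that the mean reward stays of order `G *
    -- Tmin`. `good` is left at once and carries no bias, so nothing is subtracted from the regret.
    obtain ⟨m, 𝒜, M, ρ, h1, h2, h3, h4, h5, h6⟩ := exists_smdp_of_parameters (η := 1)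
      (δ := Tmin / (4 * Tmax)) (R₁ := G * Tmax / 4) (H := 0) hS hA hT0 hTmax hG hlog one_pos le_rfl
      (by positivity) (by rw [div_le_iff₀ (by positivity)]; linarith)
      (by rw [div_le_iff₀ (by positivity)]; linarith) (by linarith) (by linarith) (by linarith)
      (by
        rw [div_mul_eq_mul_div, div_le_div_iff₀ (by positivity) (by positivity)]
        have : 1 * (n : ℝ) ≤ Tmin * n := by gcongr
        linarith)
      hϑ hNn (by positivity) le_rfl
      (mul_nonneg (by positivity) (by linarith))
      (by have := mul_pos hG hT; linarith)
      (by rw [add_zero, mul_assoc, hδR]; linarith) alg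
    exact ⟨m, 𝒜, M, ρ, h1, h2, h3, h4, h5, fun s => (short_diameter_bound (by linarith)
      (by linarith) hn0 hT1 hT hG hshort).trans (h6 s)⟩
  · have hx : 12 * 10 ^ 26 ≤ D / Tmin := by rw [le_div_iff₀ hT0]; linarith
    have hη0 : 0 < 10 ^ 26 * Tmin / D := by positivity
    have hη12 : 10 ^ 26 * Tmin / D ≤ 1 / 12 := by
      rw [div_le_iff₀ hD0]; linarith
    have hηinv : 1 / (10 ^ 26 * Tmin / D) = D / Tmin / 10 ^ 26 := by field_simp
    have hηinv2 : 2 / (10 ^ 26 * Tmin / D) = 2 * (D / Tmin / 10 ^ 26) := by field_simp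
    have hηn : 10 ^ 26 * (S * A : ℝ) ≤ 10 ^ 26 * Tmin / D * n := by
      rw [div_mul_eq_mul_div, le_div_iff₀ hD0]
      calc 10 ^ 26 * (S * A : ℝ) * D = 10 ^ 26 * 1 * (D * S * A) := by ring
        _ ≤ 10 ^ 26 * Tmin * n := by gcongr
    have hηH : 10 ^ 26 * Tmin / D * (G * D / (3 * 10 ^ 26)) = G * Tmin / 3 := by
      field_simp
    have hGT : 0 < G * Tmin := by positivity
    have hNS : ((S / 16000 + 1 : ℕ) : ℝ) ≤ S := by exact_mod_cast (by omega)
    have hnS : 1000000 * S ≤ n := by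
      have h1 : 1000000 * (S * A : ℝ) ≤ D * (S * A) := by gcongr; linarith
      have : 1000000 * (S : ℝ) ≤ n := by linarith
      exact_mod_cast this
    -- Successes pay nothing, but lead to a stay of about `1 / η` steps in `good`. Since `δ = η` and
    -- `η * H = G * Tmin / 3`, the reward `R₂` is at most `5 / 6 * G * Tmin`.
    obtain ⟨m, 𝒜, M, ρ, h1, h2, h3, h4, h5, h6⟩ := exists_smdp_of_parameters
      (η := 10 ^ 26 * Tmin / D) (δ := 10 ^ 26 * Tmin / D) (ϑ := 1 / 1000) (R₁ := 0)
      (H := G * D / (3 * 10 ^ 26)) (n := n) hS hA hT0 hTmax hG hlog hη0 (by linarith) hη0 hη12 le_rfl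
      (by rw [hηinv, hηinv2]; linarith) (by rw [hηinv2]; linarith) (by rw [hηinv]; linarith)
      (by linarith) (Or.inl ⟨rfl, by omega⟩)
      (by linarith) le_rfl (by positivity)
      (by
        rw [hηinv2, zero_add, hηH]
        have : G * D / (3 * 10 ^ 26) = G * Tmin / 3 * (D / Tmin / 10 ^ 26) := by field_simp
        rw [this]
        gcongr
        linarith)
      (by positivity)
      (by rw [zero_add, mul_assoc, hηH]; linarith) alg
    exact ⟨m, 𝒜, M, ρ, h1, h2, h3, h4, h5, fun s => (long_diameter_bound hS' hA' hnD hT1 hG hD0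
      (by linarith)).trans (h6 s)⟩
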